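/- **Theorem 5.1.** For $x=[a_0,a_1,a_2,\dots]\ge 0$ (regular continued fraction, $a_0=\lfloor x\rfloor$) let $F(x)=1-2^{-a_0}+2^{-(a_0+a_1)}-2^{-(a_0+a_1+a_2)}+\cdots$ be the Minkowski question mark function on $[0,\infty)$ (a finite sum for rational $x$). Let $p$ be a complex number with $|p-2|\le 1$, or a real number with $p\ge 1$. Put $W_a=p^{-1}+p^{-2}+\dots+p^{-a}$ and let $$\mathfrak X_p(x)=W_{a_0}+\cfrac{p^{-a_0}}{W_{a_1}+\cfrac{p^{-a_1}}{W_{a_2}+\ddots}}$$ be the value of the $p$-continued fraction with the same partial quotients; for rational $x=[a_0,\dots,a_k]$ the last level is $W_{a_k}+p^{-a_k}(p-1)$, and for irrational $x$ the value is the limit of $\mathfrak X_p([a_0,\dots,a_n])$ as $n\to\infty$. (Thus $\mathfrak X_p(x+1)=\frac{\mathfrak X_p(x)+1}{p}$, $\mathfrak X_p(\frac{x}{x+1})=\frac{p\,\mathfrak X_p(x)}{\mathfrak X_p(x)+1}$, and $\mathfrak X_1(x)=x$.) Let $\mathscr I_p=\mathfrak X_p([0,\infty])\cap\mathbb C$ with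 $\mathfrak X_p(\infty)=\frac1{p-1}$ (so $\mathscr I_1=[0,\infty)$), and let $dF_p$ be the image of the measure $dF$ under $\mathfrak X_p$, that is, $F_p(\mathfrak X_p(x))=F(x)$. Let $m_L(p)=\int_{\mathscr I_p}\left(\frac{px}{x+1}\right)^L dF_p(x)$. Then $\mathbb C\setminus(\mathscr I_p+1)$ is an open set containing $0$, and the generating function $G_p(z)=\sum_{L\ge1}\frac{m_L(p)}{p^L}z^{L-1}$, which converges near $z=0$, extends to an analytic function on this set, given by the convergent integral $$G_p(z)=\int_{\mathscr I_p}\frac{dF_p(x)}{x+1-z}.$$ It satisfies the functional equation $$\frac1z+\frac{p}{z^2}G_p\Big(\frac pz\Big)+2G_p(z+1)=p\,G_p(pz)\qquad(z\ne0,\ z\notin\mathscr I_p).$$ Every function satisfying this equation, in particular $G_p$, has the symmetry property $$G_p(z+1)=-\frac1{z^2}G_p\Big(\frac1z+1\Big)-\frac1z\qquad(z\ne0,\ z\notin\mathscr I_p).$$ Moreover, $G_p(z)\to0$ as $\operatorname{dist}(z,\mathscr I_p)\to\infty$. Conversely, $G_p$ is the only function that is analytic on $\mathbb C\setminus(\mathscr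 I_p+1)$, satisfies the functional equation, and tends to $0$ as $\operatorname{dist}(z,\mathscr I_p)\to\infty$. -/

import Mathlib

/-! ### Regular continued fractions and the Minkowski question mark function on `[0, ∞)` -/

/-- The complete quotients of the regular continued fraction of `x`: `x₀ = x`,
`xₙ₊₁ = 1 / {xₙ}`.  If the expansion stops at index `n` (that is, `{xₙ} = 0`), all later values
are `0`, because `0⁻¹ = 0`. -/
noncomputable def completeQuotient (x : ℝ) : ℕ → ℝ
  | 0 => x
  | n + 1 => (Int.fract (completeQuotient x n))⁻¹

/-- The partial quotients `aₙ` of `x = [a₀, a₁, a₂, …]`, for `x ≥ 0`.  For `n ≥ 1` one has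
`aₙ ≥ 1` as long as the expansion has not stopped, and `aₙ = 0` afterwards. -/
noncomputable def partialQuotient (x : ℝ) (n : ℕ) : ℕ := ⌊completeQuotient x n⌋₊

/-- The `n`-th term `(-1)ⁿ⁺¹ 2 ^ (-(a₀ + ⋯ + aₙ))` of the series of the question mark function;
it is omitted if the continued fraction of `x` stops before index `n`. -/
noncomputable def questionMarkTerm (x : ℝ) (n : ℕ) : ℝ :=
  if n = 0 ∨ partialQuotient x n ≠ 0 then
    (-1) ^ (n + 1) * ((2 : ℝ) ^ (∑ i ∈ Finset.range (n + 1), partialQuotient x i))⁻¹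
  else 0

/-- The Minkowski question mark function `F : [0, ∞) → [0, 1)`,
`F([a₀, a₁, a₂, …]) = 1 - 2 ^ (-a₀) + 2 ^ (-(a₀ + a₁)) - 2 ^ (-(a₀ + a₁ + a₂)) + ⋯`,
extended by `0` to the negative half line. -/
noncomputable def questionMark (x : ℝ) : ℝ :=
  if x < 0 then 0 else 1 + ∑' n, questionMarkTerm x n

/-! ### `F` is monotone (needed for its Lebesgue–Stieltjes measure) -/

theorem completeQuotient_succ (x : ℝ) (n : ℕ) :
    completeQuotient x (n + 1) = completeQuotient (Int.fract x)⁻¹ n := by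
  induction n with
  | zero => rfl
  | succ k ih =>
    change (Int.fract (completeQuotient x (k + 1)))⁻¹ = _
    rw [ih]; rfl

theorem partialQuotient_succ (x : ℝ) (n : ℕ) :
    partialQuotient x (n + 1) = partialQuotient (Int.fract x)⁻¹ n := by
  simp only [partialQuotient, completeQuotient_succ]

theorem partialQuotient_zero_left (n : ℕ) : partialQuotient 0 n = 0 := by
  induction n with
  | zero => simp [partialQuotient, completeQuotient]
  | succ k ih => rw [partialQuotient_succ]; simpa using ih

theorem one_lt_inv_fract {x : ℝ} (h : Int.fract x ≠ 0) : 1 < (Int.fract x)⁻¹ :=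
  (one_lt_inv₀ (lt_of_le_of_ne (Int.fract_nonneg x) (Ne.symm h))).2 (Int.fract_lt_one x)

theorem partialQuotient_zero_pos {y : ℝ} (h : 1 ≤ y) : partialQuotient y 0 ≠ 0 := by
  have : 1 ≤ partialQuotient y 0 := Nat.le_floor (by simpa [completeQuotient] using h)
  omega

theorem questionMarkTerm_succ {x : ℝ} (h : Int.fract x ≠ 0) (n : ℕ) :
    questionMarkTerm x (n + 1)
      = -((2 : ℝ) ^ (partialQuotient x 0))⁻¹ * questionMarkTerm (Int.fract x)⁻¹ n := by
  have hy := partialQuotient_zero_pos (one_lt_inv_fract h).le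
  have hiff : (n + 1 = 0 ∨ partialQuotient x (n + 1) ≠ 0) ↔
      (n = 0 ∨ partialQuotient (Int.fract x)⁻¹ n ≠ 0) := by
    rw [partialQuotient_succ]
    rcases Nat.eq_zero_or_pos n with rfl | hn
    · simp [hy]
    · simp [hn.ne']
  unfold questionMarkTerm
  by_cases hc : n = 0 ∨ partialQuotient (Int.fract x)⁻¹ n ≠ 0
  · rw [if_pos (hiff.2 hc), if_pos hc, Finset.sum_range_succ' _ (n + 1)]
    simp only [partialQuotient_succ]
    rw [pow_add (2 : ℝ), mul_inv, pow_succ (-1 : ℝ) (n + 1)]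
    ring
  · rw [if_neg (fun h' => hc (hiff.1 h')), if_neg hc, mul_zero]

theorem questionMarkTerm_succ_of_fract {x : ℝ} (h : Int.fract x = 0) (n : ℕ) :
    questionMarkTerm x (n + 1) = 0 := by
  unfold questionMarkTerm
  rw [if_neg]
  rw [partialQuotient_succ, h, inv_zero, partialQuotient_zero_left]
  simp

theorem abs_questionMarkTerm_le (n : ℕ) : ∀ x : ℝ, |questionMarkTerm x n| ≤ (1 / 2 : ℝ) ^ n * 2 := by
  have h0 : ∀ x : ℝ, |questionMarkTerm x 0| ≤ ((2 : ℝ) ^ (partialQuotient x 0))⁻¹ := by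
    intro x
    simp [questionMarkTerm]
  have key : ∀ n, ∀ x : ℝ, |questionMarkTerm x n| ≤ ((2 : ℝ) ^ (partialQuotient x 0))⁻¹ *
      ((1 / 2 : ℝ) ^ n) := by
    intro n
    induction n with
    | zero => intro x; simpa using h0 x
    | succ k ih =>
      intro x
      by_cases hf : Int.fract x = 0
      · rw [questionMarkTerm_succ_of_fract hf, abs_zero]; positivity
      · rw [questionMarkTerm_succ hf, abs_mul, abs_neg,
          abs_of_pos (by positivity : (0 : ℝ) < ((2 : ℝ) ^ (partialQuotient x 0))⁻¹)]
        refine mul_le_mul_of_nonneg_left ((ih _).trans ?_) (by positivity)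
        rw [pow_succ, mul_comm]
        refine mul_le_mul_of_nonneg_left ?_ (by positivity)
        rw [one_div]
        refine inv_anti₀ (by norm_num) ?_
        have := partialQuotient_zero_pos (one_lt_inv_fract hf).le
        calc (2 : ℝ) = 2 ^ 1 := by norm_num
          _ ≤ _ := pow_le_pow_right₀ (by norm_num) (by omega)
  intro x
  have h1 : ((2 : ℝ) ^ (partialQuotient x 0))⁻¹ ≤ 1 := inv_le_one_of_one_le₀
    (one_le_pow₀ (by norm_num))
  have h2 : (0 : ℝ) ≤ (1 / 2 : ℝ) ^ n := by positivity
  nlinarith [key n x]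

theorem summable_questionMarkTerm (x : ℝ) : Summable (questionMarkTerm x) := by
  refine Summable.of_norm_bounded (g := fun n => (1 / 2 : ℝ) ^ n * 2)
    ((summable_geometric_of_lt_one (by norm_num) (by norm_num)).mul_right 2) ?_
  intro n
  exact abs_questionMarkTerm_le n x

theorem questionMark_rec {x : ℝ} (hx : 0 ≤ x) :
    questionMark x = 1 - ((2 : ℝ) ^ ⌊x⌋₊)⁻¹ *
      (if Int.fract x = 0 then 1 else questionMark (Int.fract x)⁻¹) := by
  have hz : questionMarkTerm x 0 = -((2 : ℝ) ^ ⌊x⌋₊)⁻¹ := by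
    simp [questionMarkTerm, partialQuotient, completeQuotient]
  have hp : partialQuotient x 0 = ⌊x⌋₊ := rfl
  rw [questionMark, if_neg hx.not_gt, (summable_questionMarkTerm x).tsum_eq_zero_add, hz]
  by_cases hf : Int.fract x = 0
  · simp only [questionMarkTerm_succ_of_fract hf, tsum_zero, hf, if_true]
    ring
  · have hy := one_lt_inv_fract hf
    rw [if_neg hf, questionMark, if_neg (by linarith : ¬ (Int.fract x)⁻¹ < 0)]
    simp only [questionMarkTerm_succ hf, tsum_mul_left, hp]
    ring

theorem questionMark_of_one_le {x : ℝ} (hx : 1 ≤ x) :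
    questionMark x = (questionMark (x - 1) + 1) / 2 := by
  rw [questionMark_rec (by linarith : (0 : ℝ) ≤ x),
    questionMark_rec (by linarith : (0 : ℝ) ≤ x - 1), Int.fract_sub_one]
  have h1 : ⌊x⌋₊ = ⌊x - 1⌋₊ + 1 := by
    rw [Nat.floor_sub_one]
    have : 1 ≤ ⌊x⌋₊ := Nat.le_floor (by simpa using hx)
    omega
  rw [h1, pow_succ, mul_inv]
  ring

theorem questionMark_of_lt_one {x : ℝ} (h0 : 0 < x) (h1 : x < 1) :
    questionMark x = 1 - questionMark x⁻¹ := by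
  have hf : Int.fract x = x := Int.fract_eq_self.2 ⟨h0.le, h1⟩
  rw [questionMark_rec h0.le, hf, if_neg h0.ne', Nat.floor_eq_zero.2 h1]
  simp

theorem questionMark_zero : questionMark 0 = 0 := by
  rw [questionMark_rec le_rfl]; simp

theorem questionMark_add_inv {x : ℝ} (h0 : 0 < x) : questionMark x + questionMark x⁻¹ = 1 := by
  rcases lt_trichotomy x 1 with h | h | h
  · rw [questionMark_of_lt_one h0 h]; ring
  · subst h
    rw [inv_one, questionMark_of_one_le le_rfl, sub_self, questionMark_zero]; norm_num
  · have := questionMark_of_lt_one (inv_pos.2 h0) (inv_lt_one_of_one_lt₀ h)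
    rw [inv_inv] at this
    linarith

theorem questionMark_of_lt_one' {x : ℝ} (h0 : 0 ≤ x) (h1 : x < 1) :
    questionMark x = questionMark (x / (1 - x)) / 2 := by
  rcases h0.eq_or_lt with rfl | h0
  · simp [questionMark_zero]
  · have hi : 1 < x⁻¹ := (one_lt_inv₀ h0).2 h1
    have e : x / (1 - x) = (x⁻¹ - 1)⁻¹ := by
      have : 1 - x ≠ 0 := by linarith
      field_simp
    have := questionMark_add_inv (by linarith : 0 < x⁻¹ - 1)
    rw [questionMark_of_lt_one h0 h1, questionMark_of_one_le hi.le, e]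
    linarith

theorem questionMark_mem (x : ℝ) : 0 ≤ questionMark x ∧ questionMark x ≤ 1 := by
  have key : ∀ n : ℕ, ∀ x : ℝ, 0 ≤ x →
      -((1 / 2 : ℝ) ^ n * 5) ≤ questionMark x ∧ questionMark x ≤ 1 + (1 / 2 : ℝ) ^ n * 5 := by
    intro n
    induction n with
    | zero =>
      intro x hx
      have hb : |∑' n, questionMarkTerm x n| ≤ 4 := by
        have hs := (summable_geometric_of_lt_one (r := (1 / 2 : ℝ)) (by norm_num)
          (by norm_num)).mul_right 2
        have h := tsum_of_norm_bounded (f := questionMarkTerm x) hs.hasSum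
          (fun n => abs_questionMarkTerm_le n x)
        rw [tsum_mul_right, tsum_geometric_of_lt_one (by norm_num) (by norm_num)] at h
        rw [Real.norm_eq_abs] at h
        norm_num at h ⊢
        exact h
      have := abs_le.1 hb
      rw [questionMark, if_neg hx.not_gt]
      constructor <;> norm_num <;> linarith
    | succ k ih =>
      intro x hx
      have hk : (0 : ℝ) < (1 / 2 : ℝ) ^ k := by positivity
      rw [pow_succ]
      rcases le_or_gt 1 x with h1 | h1
      · rw [questionMark_of_one_le h1]
        have := ih (x - 1) (by linarith)
        constructor <;> linarith [this.1, this.2]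
      · rw [questionMark_of_lt_one' hx h1]
        have := ih (x / (1 - x)) (div_nonneg hx (by linarith))
        constructor <;> linarith [this.1, this.2]
  rcases lt_or_ge x 0 with hx | hx
  · simp [questionMark, hx]
  · have ht : Filter.Tendsto (fun n : ℕ => (1 / 2 : ℝ) ^ n * 5) Filter.atTop (nhds 0) := by
      simpa using (tendsto_pow_atTop_nhds_zero_of_lt_one (r := (1 / 2 : ℝ)) (by norm_num)
        (by norm_num)).mul_const 5
    have h1 : Filter.Tendsto (fun n : ℕ => -((1 / 2 : ℝ) ^ n * 5)) Filter.atTop (nhds 0) := by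
      have := ht.neg
      rwa [neg_zero] at this
    have h2 : Filter.Tendsto (fun n : ℕ => (1 : ℝ) + (1 / 2 : ℝ) ^ n * 5) Filter.atTop
        (nhds 1) := by
      have := ht.const_add 1
      rwa [add_zero] at this
    exact ⟨le_of_tendsto' h1 (fun n => (key n x hx).1), ge_of_tendsto' h2 (fun n => (key n x hx).2)⟩

theorem questionMark_monotone : Monotone questionMark := by
  have key : ∀ n : ℕ, ∀ x y : ℝ, 0 ≤ x → x ≤ y →
      questionMark x ≤ questionMark y + (1 / 2 : ℝ) ^ n := by
    intro n
    induction n with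
    | zero =>
      intro x y _ _
      have := (questionMark_mem x).2
      have := (questionMark_mem y).1
      norm_num
      linarith
    | succ k ih =>
      intro x y hx hxy
      have hk : (0 : ℝ) < (1 / 2 : ℝ) ^ k := by positivity
      rw [pow_succ]
      rcases le_or_gt 1 x with h1 | h1
      · rw [questionMark_of_one_le h1, questionMark_of_one_le (h1.trans hxy)]
        have := ih (x - 1) (y - 1) (by linarith) (by linarith)
        linarith
      · rw [questionMark_of_lt_one' hx h1]
        rcases le_or_gt 1 y with h2 | h2
        · rw [questionMark_of_one_le h2]
          have := (questionMark_mem (x / (1 - x))).2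
          have := (questionMark_mem (y - 1)).1
          linarith
        · rw [questionMark_of_lt_one' (hx.trans hxy) h2]
          have := ih (x / (1 - x)) (y / (1 - y)) (div_nonneg hx (by linarith))
            (by rw [div_le_div_iff₀ (by linarith) (by linarith)]; nlinarith)
          linarith
  intro x y hxy
  rcases lt_or_ge x 0 with hx | hx
  · rw [questionMark, if_pos hx]; exact (questionMark_mem y).1
  · have ht : Filter.Tendsto (fun n : ℕ => questionMark y + (1 / 2 : ℝ) ^ n) Filter.atTop
        (nhds (questionMark y)) := by
      simpa using tendsto_const_nhds.add (tendsto_pow_atTop_nhds_zero_of_lt_one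
        (r := (1 / 2 : ℝ)) (by norm_num) (by norm_num))
    exact ge_of_tendsto' ht (fun n => key n x y hx hxy)

/-- The Lebesgue–Stieltjes measure `dF` of the question mark function, carried by `[0, ∞)`. -/
noncomputable def questionMarkMeasure : MeasureTheory.Measure ℝ :=
  questionMark_monotone.stieltjesFunction.measure

/-! ### `p`-continued fractions, the curve `I_p` and the measure `dF_p` -/

/-- `W_a(p) = p⁻¹ + p⁻² + ⋯ + p⁻ᵃ`, which is `(pᵃ - 1) / (pᵃ⁺¹ - pᵃ)` for `p ≠ 1` and `a` for
`p = 1`. -/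
noncomputable def pW (p : ℂ) (a : ℕ) : ℂ := ∑ i ∈ Finset.range a, (p ^ (i + 1))⁻¹

/-- The value of the `p`-continued fraction
`W_{a₀} + p^{-a₀} / (W_{a₁} + p^{-a₁} / (W_{a₂} + ⋯ ))` of `x = [a₀, a₁, a₂, …] ≥ 0` after
truncating the regular continued fraction of `x` at the partial quotient `a_n` (or at its last
partial quotient, if that comes earlier).  The last level of a finite fraction
`[a₀, …, a_k]` is `W_{a_k} + p^{-a_k} (p - 1)`: the root `1` of the tree of the maps
`T x = (x + 1) / p`, `U x = p x / (x + 1)` is `W_1 + p⁻¹ (p - 1)`, and `T^a x = W_a + p^{-a} x`. -/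
noncomputable def pConvergent (p : ℂ) : ℕ → ℝ → ℂ
  | 0, x => pW p ⌊x⌋₊ + (p ^ ⌊x⌋₊)⁻¹ * (p - 1)
  | n + 1, x => pW p ⌊x⌋₊ + (p ^ ⌊x⌋₊)⁻¹ *
      (if Int.fract x = 0 then p - 1 else (pConvergent p n (Int.fract x)⁻¹)⁻¹)

/-- The function `X(p, x)`, `x ≥ 0`: the value `[a₀, a₁, a₂, …]_p` of the `p`-continued fraction
with the regular partial quotients of `x`.  For rational `x` the sequence is eventually
constant. -/
noncomputable def pX (p : ℂ) (x : ℝ) : ℂ :=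
  Filter.limUnder Filter.atTop (fun n => pConvergent p n x)

/-- The curve `I_p`, the image of `[0, ∞]` under `X(p, ·)`, where `X(p, ∞) = 1 / (p - 1)`.
For `p = 1` this last point is the point at infinity, which does not belong to `ℂ`. -/
noncomputable def pCurve (p : ℂ) : Set ℂ :=
  pX p '' Set.Ici 0 ∪ {w | p ≠ 1 ∧ w = (p - 1)⁻¹}

/-- The translate `I_p + 1`. -/
def pCurveShift (p : ℂ) : Set ℂ := (fun w => w + 1) '' pCurve p

/-- The measure `dF_p` on `I_p`, where `F_p(X(p, x)) = F(x)`: the image of `dF` under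
`X(p, ·)`. -/
noncomputable def pMeasure (p : ℂ) : MeasureTheory.Measure ℂ :=
  questionMarkMeasure.map (pX p)

/-- The function `G_p(z) = ∫ dF_p(x) / (x + 1 - z)`. -/
noncomputable def pG (p z : ℂ) : ℂ := ∫ x, 1 / (x + 1 - z) ∂(pMeasure p)

/-- The moments `m_L(p) = ∫ (p x / (x + 1)) ^ L dF_p(x)`. -/
noncomputable def pMoment (p : ℂ) (L : ℕ) : ℂ := ∫ x, (p * x / (x + 1)) ^ L ∂(pMeasure p)

/-! ### The three-term equation and the symmetry property -/

/-- `1/z + (p/z²) H(p/z) + 2 H(z+1) = p H(p z)` for all `z ≠ 0` outside `I_p`. -/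
def ThreeTermEquation (p : ℂ) (H : ℂ → ℂ) : Prop :=
  ∀ z : ℂ, z ≠ 0 → z ∉ pCurve p →
    1 / z + p / z ^ 2 * H (p / z) + 2 * H (z + 1) = p * H (p * z)

/-- `H(z+1) = -z⁻² H(1/z + 1) - 1/z` for all `z ≠ 0` outside `I_p`. -/
def SymmetryProperty (p : ℂ) (H : ℂ → ℂ) : Prop :=
  ∀ z : ℂ, z ≠ 0 → z ∉ pCurve p →
    H (z + 1) = -(1 / z ^ 2) * H (1 / z + 1) - 1 / z

/-- `H(z) → 0` when the distance from `z` to the curve `I_p` tends to infinity. -/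
def VanishesFarFromCurve (p : ℂ) (H : ℂ → ℂ) : Prop :=
  Filter.Tendsto H
    (Filter.comap (fun z => Metric.infDist z (pCurve p)) Filter.atTop) (nhds 0)

/-! Write T z = (z+1)/p and q = 1/(p-1), the fixed point of T. On the curve, T and 1/T act as x ↦
x+1 and x ↦ 1/(x+1) act on [0,∞], whose two images cover [0,∞]. The theory of G_p needs only what
`IsRegularCurve` records: X_p respects translation and inversion and is continuous, and the curve is
closed and misses -1.

Given that, F(x+1) = (F(x)+1)/2 and F(x)+F(1/x) = 1 say that 2 dF is the sum of its images under x+1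
and 1/(x+1) (`questionMarkMeasure_add_self`). On the curve this becomes 2∫f = ∫f∘T + ∫f∘(1/T). The
kernel f(w) = 1/(w-z) yields the three-term equation. Adding that equation at z and at 1/z cancels
the terms in pz and p/z and leaves the symmetry. The moment series is a geometric series with sum ∫
dF_p(w)/(1/w+1-z), which equals G_p because dF_p is invariant under inversion.

The hard part is regularity for p ≠ 1. T contracts towards q, but 1/T need not contract in the
Euclidean metric. A bounded open set V, stable under inversion and mapped by T well inside itself
(`IsContractive`), repairs this: by the Earle–Hamilton argument derivatives of words in T, 1/T decay
exponentially on V, so the convergents are Cauchy and X_p is continuous in the Farey coding of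
[0,∞]. V is built from a region R that contains T^(n+1)(closure of 1/R) for all n ≥ 0
(`exists_region`). With q = k - hi and, by conjugation, h ≥ 0, a disc serves for R when h ≤ k+2/5 or
h = 0; otherwise R is the half-plane Re > 2/5 together with a disc about q. These choices rest on
the explicit inequalities below. For p = 1 the curve is [0,∞) and classical convergence suffices.

Uniqueness: the difference E of two solutions, shifted by 1, satisfies a homogeneous equation, one
of whose two right-hand terms dominates. For p ≠ 1, following the dominating term n times writes z =
w(ζ) for a word w of length n with |E(z)||w'(ζ)| ≤ |E(ζ)|. For large n, ζ lies outside V, where the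
symmetry gives |E(ζ)||ζ-q|² ≤ M. The Möbius identity (w(ζ)-w(q))² = w'(ζ)w'(q)(ζ-q)² turns this into
|E(z)|·dist² ≤ M|w'(q)| → 0. For p = 1 a maximum principle on (-∞,-1] and the identity theorem do
the same. -/

/-! ### Inequalities for the single invariant disc -/

/-- Here e stands for the square of the e in `regimeI_ineq`, and b for a·e there. With t the excess
of b over its lower bound and z, zy the distances of e to the ends of its interval (z+zy is
constant), homogenising in z and zy gives a Bernstein form with positive coefficients only. -/
theorem regimeI_poly_aux {e b : ℝ} (he0 : 1 / 2 ≤ e) (he1 : e ≤ 1)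
    (h : (15 / 29 ≤ e ∧ 1 - e / 2 ≤ b) ∨ 13 / 10 - e / 2 ≤ b) :
    0 < (2 * e - 1) * b ^ 4 + e * (3 * e - 1) * b ^ 3 + e * (3 * e - 1) ^ 2 * b ^ 2 / 4
      - 2 * e ^ 3 * (1 - e) * b - e ^ 4 * (1 - e) := by
  obtain ⟨zy, hy⟩ : ∃ y, y = 1 - e := ⟨_, rfl⟩
  have hy0 : 0 ≤ zy := by linarith
  have hpos : ∀ z t : ℝ, 0 ≤ z → 0 ≤ t → z + zy ≠ 0 → (0 < z ∨ 0 < zy) := by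
    intro z t hz ht hs
    rcases hz.eq_or_lt with h0 | h0
    · right; rcases hy0.eq_or_lt with h1 | h1
      · exact absurd (by linarith) hs
      · exact h1
    · exact Or.inl h0
  rcases h with ⟨h1, h2⟩ | h2
  · obtain ⟨t, ht⟩ : ∃ t, t = b - (1 - e / 2) := ⟨_, rfl⟩
    obtain ⟨z, hz⟩ : ∃ z, z = e - 15 / 29 := ⟨_, rfl⟩
    have ht0 : 0 ≤ t := by linarith
    have hz0 : 0 ≤ z := by linarith
    have hs : 0 < z ∨ 0 < zy := hpos z t hz0 ht0 (by rw [hz, hy]; norm_num)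
    have : (2 * e - 1) * b ^ 4 + e * (3 * e - 1) * b ^ 3 + e * (3 * e - 1) ^ 2 * b ^ 2 / 4
        - 2 * e ^ 3 * (1 - e) * b - e ^ 4 * (1 - e)
        = 107598961 / 537824 * t * z * zy ^ 4 + 321143419 / 537824 * t * z ^ 2 * zy ^ 3
        + 52119293 / 67228 * t * z ^ 3 * zy ^ 2 + 511364163 / 1075648 * t * z ^ 4 * zy
        + 61533447 / 537824 * t * z ^ 5 + 18522503 / 1075648 * t * zy ^ 5
        + 383325277 / 1075648 * t ^ 2 * z * zy ^ 4 + 36819821 / 33614 * t ^ 2 * z ^ 2 * zy ^ 3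
        + 390345945 / 268912 * t ^ 2 * z ^ 3 * zy ^ 2 + 959780317 / 1075648 * t ^ 2 * z ^ 4 * zy
        + 225622639 / 1075648 * t ^ 2 * z ^ 5 + 32317107 / 1075648 * t ^ 2 * zy ^ 5
        + 3707128 / 16807 * t ^ 3 * z * zy ^ 4 + 12194500 / 16807 * t ^ 3 * z ^ 2 * zy ^ 3
        + 134602891 / 134456 * t ^ 3 * z ^ 3 * zy ^ 2 + 170454721 / 268912 * t ^ 3 * z ^ 4 * zy
        + 20511149 / 134456 * t ^ 3 * z ^ 5 + 3975407 / 268912 * t ^ 3 * zy ^ 5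
        + 23340273 / 537824 * t ^ 4 * z * zy ^ 4 + 43144141 / 268912 * t ^ 4 * z ^ 2 * zy ^ 3
        + 62948009 / 268912 * t ^ 4 * z ^ 3 * zy ^ 2 + 82751877 / 537824 * t ^ 4 * z ^ 4 * zy
        + 20511149 / 537824 * t ^ 4 * z ^ 5 + 707281 / 537824 * t ^ 4 * zy ^ 5
        + 174320653 / 8605184 * z * zy ^ 4 + 281754343 / 4302592 * z ^ 2 * zy ^ 3
        + 389321607 / 4302592 * z ^ 3 * zy ^ 2 + 566532081 / 8605184 * z ^ 4 * zy
        + 184600341 / 8605184 * z ^ 5 + 4834321 / 8605184 * zy ^ 5 := by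
      rw [ht, hy, hz]; ring
    rw [this]
    rcases hs with hs | hs <;> positivity
  · obtain ⟨t, ht⟩ : ∃ t, t = b - (13 / 10 - e / 2) := ⟨_, rfl⟩
    obtain ⟨z, hz⟩ : ∃ z, z = e - 1 / 2 := ⟨_, rfl⟩
    have ht0 : 0 ≤ t := by linarith
    have hz0 : 0 ≤ z := by linarith
    have hs : 0 < z ∨ 0 < zy := hpos z t hz0 ht0 (by rw [hz, hy]; norm_num)
    have : (2 * e - 1) * b ^ 4 + e * (3 * e - 1) * b ^ 3 + e * (3 * e - 1) ^ 2 * b ^ 2 / 4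
        - 2 * e ^ 3 * (1 - e) * b - e ^ 4 * (1 - e)
        = 46302 / 125 * t * z * zy ^ 4 + 148588 / 125 * t * z ^ 2 * zy ^ 3
        + 200252 / 125 * t * z ^ 3 * zy ^ 2 + 124848 / 125 * t * z ^ 4 * zy + 29952 / 125 * t * z ^ 5
        + 614 / 25 * t * zy ^ 5 + 11112 / 25 * t ^ 2 * z * zy ^ 4
        + 37043 / 25 * t ^ 2 * z ^ 2 * zy ^ 3 + 51082 / 25 * t ^ 2 * z ^ 3 * zy ^ 2
        + 32208 / 25 * t ^ 2 * z ^ 4 * zy + 7712 / 25 * t ^ 2 * z ^ 5 + 131 / 5 * t ^ 2 * zy ^ 5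
        + 1032 / 5 * t ^ 3 * z * zy ^ 4 + 3688 / 5 * t ^ 3 * z ^ 2 * zy ^ 3
        + 5272 / 5 * t ^ 3 * z ^ 3 * zy ^ 2 + 3408 / 5 * t ^ 3 * z ^ 4 * zy + 832 / 5 * t ^ 3 * z ^ 5
        + 8 * t ^ 3 * zy ^ 5 + 32 * t ^ 4 * z * zy ^ 4 + 128 * t ^ 4 * z ^ 2 * zy ^ 3
        + 192 * t ^ 4 * z ^ 3 * zy ^ 2 + 128 * t ^ 4 * z ^ 4 * zy + 32 * t ^ 4 * z ^ 5
        + 114919 / 1250 * z * zy ^ 4 + 184303 / 625 * z ^ 2 * zy ^ 3 + 248202 / 625 * z ^ 3 * zy ^ 2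
        + 159408 / 625 * z ^ 4 * zy + 41472 / 625 * z ^ 5 + 10327 / 2000 * zy ^ 5 := by
      rw [ht, hy, hz]; ring
    rw [this]
    rcases hs with hs | hs <;> positivity

/-- The e here is again a square, the smaller root of a quadratic. Below 2k+1 the left side of the
defining equation decreases in e while the right side increases, so a test value E0 at which the
left side still dominates lies below the root. -/
theorem regimeI_sq_ge {k n e E0 : ℝ} (hk : 1 / 2 ≤ k) (he : 0 < e) (he1 : e ≤ 1)
    (h : (2 * k + 1 - e) ^ 2 = 4 * n * e) (hn : n ≤ k ^ 2 + (k + 2 / 5) ^ 2)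
    (h0 : E0 ≤ 1) (hE : 4 * (k ^ 2 + (k + 2 / 5) ^ 2) * E0 ≤ (2 * k + 1 - E0) ^ 2) :
    E0 ≤ e := by
  by_contra hlt
  push Not at hlt
  have h1 : (2 * k + 1 - E0) ^ 2 < (2 * k + 1 - e) ^ 2 := by nlinarith
  have h2 : 0 < (k ^ 2 + (k + 2 / 5) ^ 2) := by positivity
  nlinarith [mul_le_mul_of_nonneg_right hn he.le]

/-- The parameter inequality for the invariant disc. -/
theorem regimeI_ineq {k n a e : ℝ} (ha : 0 < a) (hna : n = a ^ 2) (he : 0 < e) (he1 : e ≤ 1)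
    (hk : 2 * k + 1 = 2 * a * e + e ^ 2) (hk0 : 0 < k)
    (h : (e = 1) ∨ (1 / 2 ≤ k ∧ n ≤ k ^ 2 + (k + 2 / 5) ^ 2)) :
    (1 - e ^ 2) * (a + e) ^ 2 * (n + e ^ 2) < (k + 1) ^ 2 * n := by
  subst hna
  have hb : a * e = k + 1 / 2 - e ^ 2 / 2 := by linarith
  have hb0 : 0 < a * e := by positivity
  have key : 0 < (2 * e ^ 2 - 1) * (a * e) ^ 4 + e ^ 2 * (3 * e ^ 2 - 1) * (a * e) ^ 3
      + e ^ 2 * (3 * e ^ 2 - 1) ^ 2 * (a * e) ^ 2 / 4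
      - 2 * (e ^ 2) ^ 3 * (1 - e ^ 2) * (a * e) - (e ^ 2) ^ 4 * (1 - e ^ 2) := by
    rcases h with rfl | ⟨h1, h2⟩
    · norm_num; positivity
    · have he2 : e ^ 2 ≤ 1 := by nlinarith
      have heq : (2 * k + 1 - e ^ 2) ^ 2 = 4 * a ^ 2 * e ^ 2 := by
        rw [hk]; ring
      have hhalf : 1 / 2 ≤ e ^ 2 := regimeI_sq_ge h1 (by positivity) he2 heq h2 (by norm_num)
        (by nlinarith)
      apply regimeI_poly_aux hhalf he2
      -- For k ≤ 4/5 the bound e² ≥ 15/29 is available. For larger k only e² ≥ 1/2 is used, but then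
      -- b = k + 1/2 - e²/2 is larger.
      rcases le_total k (4 / 5) with h3 | h3
      · left
        refine ⟨regimeI_sq_ge h1 (by positivity) he2 heq h2 (by norm_num)
          (by nlinarith), by linarith⟩
      · right; linarith
  have h3 : (k + 1) ^ 2 * a ^ 2 - (1 - e ^ 2) * (a + e) ^ 2 * (a ^ 2 + e ^ 2)
      = ((2 * e ^ 2 - 1) * (a * e) ^ 4 + e ^ 2 * (3 * e ^ 2 - 1) * (a * e) ^ 3
      + e ^ 2 * (3 * e ^ 2 - 1) ^ 2 * (a * e) ^ 2 / 4
      - 2 * (e ^ 2) ^ 3 * (1 - e ^ 2) * (a * e) - (e ^ 2) ^ 4 * (1 - e ^ 2)) / e ^ 4 := by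
    have : k = a * e + e ^ 2 / 2 - 1 / 2 := by linarith
    subst this
    field_simp
    ring
  have h4 : 0 < (k + 1) ^ 2 * a ^ 2 - (1 - e ^ 2) * (a + e) ^ 2 * (a ^ 2 + e ^ 2) := by
    rw [h3]; positivity
  linarith

/-! ### Inequalities for the half-plane construction (prefix `s1`: inverse of the half-plane; `s2`:
inverse of the disc) -/

/-- The polynomial core of `s2_exp`, with u = (k+1/2)/h ≤ 10/9. The constant 58/25 lies just below
π/2 + 3/4. Rescaling u to [0,1] gives a Bernstein form with positive coefficients. -/
theorem s2_poly {u y : ℝ} (h0 : 0 ≤ u) (h1 : u ≤ 10 / 9) (hy : y = 58 / 25 * (1 - 9 / 40 * u)) :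
    2 + u ^ 2 * (1 + u - 13 / 50 * u ^ 3) < (1 - u + 9 / 8 * u ^ 2 - u ^ 3 / 3) *
      (y * (1 + u * y / 2 + u ^ 2 * y ^ 2 / 6 + u ^ 3 * y ^ 3 / 24 + u ^ 4 * y ^ 4 / 120)) := by
  obtain ⟨w, rfl⟩ : ∃ w, u = 10 / 9 * w := ⟨9 / 10 * u, by ring⟩
  obtain ⟨x, hx⟩ : ∃ x, x = 1 - w := ⟨_, rfl⟩
  have hw : 0 ≤ w := by linarith
  have hx0 : 0 ≤ x := by linarith
  have h0 : 0 < w ∨ 0 < x := by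
    rcases hw.eq_or_lt with h | h
    · right; linarith
    · exact Or.inl h
  rw [← sub_pos]
  have : (1 - (10 / 9 * w) + 9 / 8 * (10 / 9 * w) ^ 2 - (10 / 9 * w) ^ 3 / 3) *
      (y * (1 + (10 / 9 * w) * y / 2 + (10 / 9 * w) ^ 2 * y ^ 2 / 6
        + (10 / 9 * w) ^ 3 * y ^ 3 / 24 + (10 / 9 * w) ^ 4 * y ^ 4 / 120))
      - (2 + (10 / 9 * w) ^ 2 * (1 + (10 / 9 * w) - 13 / 50 * (10 / 9 * w) ^ 3))
      = 8263 / 2250 * w * x ^ 11 + 5971963 / 303750 * w ^ 2 * x ^ 10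
        + 883827047 / 13668750 * w ^ 3 * x ^ 9 + 74285422237 / 512578125 * w ^ 4 * x ^ 8
        + 77110326241123 / 332150625000 * w ^ 5 * x ^ 7
        + 811443832610437 / 2989355625000 * w ^ 6 * x ^ 6
        + 12492378574688467 / 53808401250000 * w ^ 7 * x ^ 5
        + 102412018116371 / 717445350000 * w ^ 8 * x ^ 4
        + 723328345155197 / 11957422500000 * w ^ 9 * x ^ 3
        + 65013849835157 / 3985807500000 * w ^ 10 * x ^ 2
        + 1587910310807 / 664301250000 * w ^ 11 * x + 7051771117 / 55358437500 * w ^ 12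
        + 8 / 25 * x ^ 12 := by
    rw [hy, hx]; ring
  rw [this]
  rcases h0 with h0 | h0 <;> positivity

/-- The polynomial core of `s1_exp_of_le`, with u = 1/h ≤ 5/6. The constant 227/100 lies just below
π/2 + 7/10. -/
theorem s1_poly {u y : ℝ} (h0 : 0 < u) (h1 : u ≤ 5 / 6)
    (hy : y = (227 / 100 - 7 / 10 * u) * (1 - 9 / 40 * u)) :
    1 + 9 / 32 * u ^ 2 + 5 / 4 * u < (1 - u + 9 / 8 * u ^ 2 - u ^ 3 / 3) *
      (1 + u * y + (u * y) ^ 2 / 2 + (u * y) ^ 3 / 6) := by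
  obtain ⟨w, rfl⟩ : ∃ w, u = 5 / 6 * w := ⟨6 / 5 * u, by ring⟩
  obtain ⟨x, hx⟩ : ∃ x, x = 1 - w := ⟨_, rfl⟩
  have hw : 0 < w := by linarith
  have hx0 : 0 ≤ x := by linarith
  rw [← sub_pos]
  have : (1 - (5 / 6 * w) + 9 / 8 * (5 / 6 * w) ^ 2 - (5 / 6 * w) ^ 3 / 3) *
      (1 + (5 / 6 * w) * y + ((5 / 6 * w) * y) ^ 2 / 2 + ((5 / 6 * w) * y) ^ 3 / 6)
      - (1 + 9 / 32 * (5 / 6 * w) ^ 2 + 5 / 4 * (5 / 6 * w))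
      = 5 / 6 * w * (4069 / 24000 * w * x ^ 10 + 133841 / 180000 * w ^ 2 * x ^ 9
        + 12355139 / 6144000 * w ^ 3 * x ^ 8 + 87216366397 / 19906560000 * w ^ 4 * x ^ 7
        + 24606650621467 / 2866544640000 * w ^ 5 * x ^ 6
        + 37630720323631 / 2866544640000 * w ^ 6 * x ^ 5
        + 3769448120467133 / 275188285440000 * w ^ 7 * x ^ 4
        + 4530556915703371 / 495338913792000 * w ^ 8 * x ^ 3
        + 1525003801042927 / 412782428160000 * w ^ 9 * x ^ 2
        + 167177013672719 / 206391214080000 * w ^ 10 * x + 22304937700813 / 309586821120000 * w ^ 11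
        + 1 / 50 * x ^ 11) := by
    rw [hy, hx]; ring
  rw [this]
  positivity

/-- A truncated expansion of √(1/u² + 9/4) at small u. The 9/4 comes from (k+1)² ≥ (3/2)² in M². -/
theorem sqrt_lower_poly {u : ℝ} (h0 : 0 < u) (h1 : u ≤ 10 / 9) {M : ℝ} (hM : 0 < M)
    (h : 1 / u ^ 2 + 9 / 4 ≤ M ^ 2) : 1 / u + 9 / 8 * u - u ^ 2 / 3 ≤ M := by
  apply le_of_sq_le_sq _ hM.le
  refine le_trans ?_ h
  have : (1 / u + 9 / 8 * u - u ^ 2 / 3) ^ 2 = 1 / u ^ 2 + 9 / 4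
      + u * (-(2 / 3) + 81 / 64 * u - 3 / 4 * u ^ 2 + u ^ 3 / 9) := by
    field_simp; ring
  rw [this]
  have h2 : -(2 / 3) + 81 / 64 * u - 3 / 4 * u ^ 2 + u ^ 3 / 9 ≤ 0 := by
    nlinarith [mul_nonneg (mul_nonneg h0.le h0.le) (sub_nonneg.2 h1), sq_nonneg (u - 1),
      sq_nonneg (u - 10 / 9)]
  nlinarith

/-- The half-plane condition of `disc_orbit` after one application of T, multiplied by a·M, for the
disc inverse to the half-plane. -/
theorem s1_first {k h a M : ℝ} (hk : 1 / 2 ≤ k) (hh : k + 2 / 5 ≤ h)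
    (ha2 : a ^ 2 = k ^ 2 + h ^ 2) (hM2 : M ^ 2 = (k + 1) ^ 2 + h ^ 2) :
    5 / 4 * (a * M) < (k - 2 / 5) * M ^ 2 + (5 / 4 - k) * (a ^ 2 + k) + h ^ 2 := by
  -- The product a·M is replaced by squares through (5a-3M)² ≥ 0, leaving a polynomial inequality in
  -- k and h.
  have h1 : 25 * (a * M) ≤ 25 * (5 / 6 * a ^ 2 + 3 / 10 * M ^ 2) := by
    nlinarith [sq_nonneg (5 * a - 3 * M)]
  rw [ha2, hM2] at h1
  rw [ha2, hM2]
  nlinarith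

theorem lt_radius {k h M : ℝ} (hk : 1 / 2 ≤ k) (hh : k + 2 / 5 ≤ h) (hM : 0 < M)
    (hM2 : M ^ 2 = (k + 1) ^ 2 + h ^ 2) : 7 / 5 * k + 1 / 50 ≤ M - 1 := by
  have h1 : (7 / 5 * k + 51 / 50) ^ 2 ≤ M ^ 2 := by
    have h2 : (k + 2 / 5) ^ 2 ≤ h ^ 2 := by gcongr
    rw [hM2]; nlinarith [sq_nonneg (k - 7 / 10)]
  have := le_of_sq_le_sq h1 hM.le
  linarith

/-- The one-step condition for the disc inverse to the disc about q, multiplied by a·M·s with s =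
2(M-k-1). The variable r = M-k-1 eliminates h, since h² = r² + 2r(k+1). -/
theorem s2_first {k h a M : ℝ} (hk : 1 / 2 ≤ k) (hh : k + 2 / 5 ≤ h) (hM : 0 < M)
    (ha2 : a ^ 2 = k ^ 2 + h ^ 2) (hM2 : M ^ 2 = (k + 1) ^ 2 + h ^ 2) :
    (M - 1) * (a * M) < (k - 2 / 5) * M ^ 2 * (2 * (M - k - 1))
      + k * (1 - 2 * (M - k - 1)) * (a ^ 2 + k) + h ^ 2 * (1 + 2 * (M - k - 1)) := by
  have h3 := lt_radius hk hh hM hM2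
  have h1 : a * M ≤ a ^ 2 + k + 1 / 2 := by nlinarith [sq_nonneg (a - M)]
  have h2 : (M - 1) * (a * M) ≤ (M - 1) * (a ^ 2 + k + 1 / 2) :=
    mul_le_mul_of_nonneg_left h1 (by linarith)
  refine h2.trans_lt ?_
  obtain ⟨r, rfl⟩ : ∃ r, M = k + r + 1 := ⟨M - k - 1, by ring⟩
  have hr : 2 / 5 * k + 1 / 50 ≤ r := by linarith
  have hh2 : h ^ 2 = r ^ 2 + 2 * r * (k + 1) := by nlinarith
  rw [ha2, hh2, ← sub_pos]
  have : (k - 2 / 5) * (k + r + 1) ^ 2 * (2 * (k + r + 1 - k - 1))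
      + k * (1 - 2 * (k + r + 1 - k - 1)) * (k ^ 2 + (r ^ 2 + 2 * r * (k + 1)) + k)
      + (r ^ 2 + 2 * r * (k + 1)) * (1 + 2 * (k + r + 1 - k - 1))
      - (k + r + 1 - 1) * (k ^ 2 + (r ^ 2 + 2 * r * (k + 1)) + k + 1 / 2)
      = 7 / 5 * (k * (r - 2 / 5 * k)) + 7 / 10 * (r - 2 / 5 * k) + 14 / 25 * k * (k - 1 / 2)
        + 3 / 50 * k + 7 / 5 * r ^ 2 + 1 / 5 * k ^ 2 * r + 2 / 5 * k * r ^ 2 + 1 / 5 * r ^ 3 := by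
    ring
  rw [this]
  have h5 : 0 ≤ r - 2 / 5 * k := by linarith
  have h6 : 0 ≤ k - 1 / 2 := by linarith
  have h7 : 0 < k := by linarith
  have h8 : 0 < r := by linarith
  positivity

/-- The half-plane condition after two steps, multiplied by a²M², with the double-angle formulas
inserted. -/
theorem s1_second {k h a M : ℝ} (hk : 1 / 2 ≤ k) (hh : k + 2 / 5 ≤ h)
    (ha2 : a ^ 2 = k ^ 2 + h ^ 2) (hM2 : M ^ 2 = (k + 1) ^ 2 + h ^ 2) :
    5 / 4 * (a ^ 2 * M ^ 2) < (k - 2 / 5) * M ^ 4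
      + (5 / 4 - k) * ((a ^ 2 + k) ^ 2 - h ^ 2) + 2 * h ^ 2 * (a ^ 2 + k) := by
  have : M ^ 4 = (M ^ 2) ^ 2 := by ring
  rw [this, ha2, hM2, ← sub_pos]
  obtain ⟨t, rfl⟩ : ∃ t, k = 1 / 2 + t := ⟨k - 1 / 2, by ring⟩
  obtain ⟨g, rfl⟩ : ∃ g, h = 1 / 2 + t + 2 / 5 + g := ⟨h - (1 / 2 + t + 2 / 5), by ring⟩
  have ht : 0 ≤ t := by linarith
  have hg : 0 ≤ g := by linarith
  ring_nf
  positivity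

/-- For h ≤ 6/5 the third power of |p| = M/a already shrinks the image into the disc about q, so all
later iterates need no angle estimate. -/
theorem s1_third {k h a M : ℝ} (hk : 1 / 2 ≤ k) (hh : k + 2 / 5 ≤ h) (ha : 0 < a) (hM : 0 < M)
    (ha2 : a ^ 2 = k ^ 2 + h ^ 2) (hM2 : M ^ 2 = (k + 1) ^ 2 + h ^ 2) (h5 : h ≤ 6 / 5) :
    √((5 / 4 - k) ^ 2 + h ^ 2) + 5 / 4 < (M - 1) * (M / a) ^ 3 := by
  have hma : 0 < M / a := by positivity
  have hx : (M / a) ^ 2 = 1 + (2 * k + 1) / (k ^ 2 + h ^ 2) := by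
    rw [div_pow, ha2, hM2]; field_simp; ring
  have hmono : 2 / (1 / 4 + h ^ 2) ≤ (2 * k + 1) / (k ^ 2 + h ^ 2) := by
    have h2 : (k + 2 / 5) ^ 2 ≤ h ^ 2 := by gcongr
    have h3 : 0 ≤ h ^ 2 - k - 1 / 4 := by nlinarith
    rw [div_le_div_iff₀ (by positivity) (by positivity)]
    nlinarith [mul_nonneg (sub_nonneg.2 hk) h3]
  have hR : √((5 / 4 - k) ^ 2 + h ^ 2) ≤ √(9 / 16 + h ^ 2) :=
    Real.sqrt_le_sqrt (by nlinarith)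
  have fin : ∀ m r R : ℝ, 0 < m → 0 < r → m ^ 2 ≤ (M / a) ^ 2 → (r + 1) ^ 2 ≤ M ^ 2 → 0 ≤ R →
      9 / 16 + h ^ 2 ≤ R ^ 2 → R + 5 / 4 < r * m ^ 3 →
      √((5 / 4 - k) ^ 2 + h ^ 2) + 5 / 4 < (M - 1) * (M / a) ^ 3 := by
    intro m r R hm hr h1 h2 hR0 h3 h4
    have h1' : m ≤ M / a := le_of_sq_le_sq h1 hma.le
    have h2' : r + 1 ≤ M := le_of_sq_le_sq h2 hM.le
    have h3' : √(9 / 16 + h ^ 2) ≤ R := Real.sqrt_le_iff.2 ⟨hR0, h3⟩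
    calc _ < r * m ^ 3 := by linarith
      _ ≤ _ := by
        have : r ≤ M - 1 := by linarith
        have : 0 ≤ M - 1 := by linarith
        gcongr
  -- On each subinterval M/a is bounded below at the right end of h and M - 1 at the left end.
  rcases le_total h (27 / 25) with h6 | h6
  · have h7 : h ^ 2 ≤ (27 / 25) ^ 2 := by gcongr; linarith
    have h8 : 2 / (1 / 4 + (27 / 25) ^ 2) ≤ 2 / (1 / 4 + h ^ 2) := by gcongr
    refine fin (31 / 20) (37 / 50) (132 / 100) (by norm_num) (by norm_num) ?_ ?_ (by norm_num) ?_
      (by norm_num)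
    · rw [hx]; norm_num at h8 ⊢; linarith
    · rw [hM2]; nlinarith
    · linarith
  · have h7 : h ^ 2 ≤ (6 / 5) ^ 2 := by gcongr
    have h8 : 2 / (1 / 4 + (6 / 5) ^ 2) ≤ 2 / (1 / 4 + h ^ 2) := by gcongr
    refine fin (1477 / 1000) (106 / 125) (142 / 100) (by norm_num) (by norm_num) ?_ ?_ (by norm_num) ?_
      (by norm_num)
    · rw [hx]; norm_num at h8 ⊢; linarith
    · rw [hM2]; nlinarith
    · linarith

/-- The half-plane condition when the rotation angle is π/2 + x: cosine and sine have become -sin x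
and cos x, and at least two steps have been made, whence the square of M/a. -/
theorem s1_mid {k h a M : ℝ} (hk : 1 / 2 ≤ k) (hh : k + 2 / 5 ≤ h)
    (ha2 : a ^ 2 = k ^ 2 + h ^ 2) (hM2 : M ^ 2 = (k + 1) ^ 2 + h ^ 2) (h5 : 6 / 5 ≤ h)
    {x : ℝ} (hx0 : 0 ≤ x) (hx1 : x ≤ 7 / 10 - 7 / 10 / h) :
    5 / 4 < (k - 2 / 5) * (M / a) ^ 2 + h * Real.cos x - (5 / 4 - k) * Real.sin x := by
  have hh0 : 0 < h := by linarith
  have hx2 : (M / a) ^ 2 = 1 + (2 * k + 1) / (k ^ 2 + h ^ 2) := by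
    rw [div_pow, ha2, hM2]; field_simp; ring
  have hc := Real.one_sub_sq_div_two_le_cos (x := x)
  have hs : Real.sin x ≤ x := Real.sin_le hx0
  have hx3 : x ≤ 7 / 10 := hx1.trans (by have : 0 < 7 / 10 / h := by positivity
                                         linarith)
  have hs0 : 0 ≤ Real.sin x := Real.sin_nonneg_of_nonneg_of_le_pi hx0
    (by linarith [Real.pi_gt_three])
  have h1 : h * (1 - x ^ 2 / 2) ≤ h * Real.cos x := mul_le_mul_of_nonneg_left hc hh0.le
  rw [hx2]
  have h2 : 0 < (2 * k + 1) / (k ^ 2 + h ^ 2) := by positivity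
  rcases le_total (5 / 4) k with h6 | h6
  · have h3 : 0 ≤ (k - 5 / 4) * Real.sin x := mul_nonneg (sub_nonneg.2 h6) hs0
    have h4 : 0 < (k - 2 / 5) * ((2 * k + 1) / (k ^ 2 + h ^ 2)) := mul_pos (by linarith) h2
    have h5 : h * (1 - x ^ 2 / 2) ≥ h * (3 / 4) := by
      apply mul_le_mul_of_nonneg_left _ hh0.le
      nlinarith
    linarith
  · have h3 : (5 / 4 - k) * Real.sin x ≤ (5 / 4 - k) * x :=
      mul_le_mul_of_nonneg_left hs (by linarith)
    have h4 : 1 / 5 / (1 / 4 + h ^ 2) ≤ (k - 2 / 5) * ((2 * k + 1) / (k ^ 2 + h ^ 2)) := by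
      rw [mul_div_assoc', div_le_div_iff₀ (by positivity) (by positivity)]
      nlinarith [mul_nonneg (sub_nonneg.2 hk) (sub_nonneg.2 hk), sq_nonneg h,
        mul_nonneg (sub_nonneg.2 hk) (sq_nonneg h)]
    have h7 : 0 < 1 / 5 / (1 / 4 + h ^ 2) := by positivity
    have hxh : h * x ≤ 7 / 10 * (h - 1) := by
      have := mul_le_mul_of_nonneg_left hx1 hh0.le
      have e : h * (7 / 10 - 7 / 10 / h) = 7 / 10 * (h - 1) := by field_simp
      linarith
    have h8 : 5 / 4 < (1 / 10) + h * (1 - x ^ 2 / 2) - 3 / 4 * x + 1 / 5 / (1 / 4 + h ^ 2) := by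
      rcases le_total h (27 / 20) with h9 | h9
      · have : 1 / 5 / (1 / 4 + (27 / 20) ^ 2) ≤ 1 / 5 / (1 / 4 + h ^ 2) := by gcongr
        norm_num at this
        have hx4 : x ≤ 19 / 100 := by nlinarith
        nlinarith [mul_le_mul_of_nonneg_right hxh hx0]
      · have hx5 : h * x * x ≤ 7 / 10 * (h - 1) * (7 / 10) := by
          have : 0 ≤ h - 1 := by linarith
          gcongr
        rcases le_total h 2 with h10 | h10
        · have hx4 : x ≤ 35 / 100 := by nlinarith
          nlinarith [mul_le_mul_of_nonneg_right hxh hx0]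
        · nlinarith
    nlinarith

/-- The same window past π/2 for the second disc. The half-plane term with (M/a)² is nonnegative and
can be omitted here. -/
theorem s2_mid {k h M : ℝ} (hk : 1 / 2 ≤ k) (hh : k + 2 / 5 ≤ h) (hM : 0 < M)
    (hM2 : M ^ 2 = (k + 1) ^ 2 + h ^ 2) {x : ℝ} (hx0 : 0 ≤ x) (hx1 : x ≤ 3 / 4) :
    M - 1 < h * (1 + 2 * (M - k - 1)) * Real.cos x
      - k * (1 - 2 * (M - k - 1)) * Real.sin x := by
  have h3 := lt_radius hk hh hM hM2
  have hc := Real.one_sub_sq_div_two_le_cos (x := x)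
  have hc' : 23 / 32 ≤ Real.cos x := by nlinarith
  have hs : Real.sin x ≤ x := Real.sin_le hx0
  have hs0 : 0 ≤ Real.sin x := Real.sin_nonneg_of_nonneg_of_le_pi hx0
    (by linarith [Real.pi_gt_three])
  obtain ⟨r, rfl⟩ : ∃ r, M = k + r + 1 := ⟨M - k - 1, by ring⟩
  have hr : 2 / 5 * k + 1 / 50 ≤ r := by linarith
  have hh2 : h ^ 2 = r ^ 2 + 2 * r * (k + 1) := by nlinarith
  have e : k + r + 1 - k - 1 = r := by ring
  rw [e]
  have h1 : h * (1 + 2 * r) * (23 / 32) ≤ h * (1 + 2 * r) * Real.cos x :=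
    mul_le_mul_of_nonneg_left hc' (mul_nonneg (by linarith) (by linarith))
  rcases le_total (1 / 2) r with h4 | h4
  · have h5 : k * (1 - 2 * r) * Real.sin x ≤ 0 :=
      mul_nonpos_of_nonpos_of_nonneg (mul_nonpos_of_nonneg_of_nonpos (by linarith) (by linarith)) hs0
    nlinarith
  · have h5 : k * (1 - 2 * r) * Real.sin x ≤ k * (1 - 2 * r) * (3 / 4) :=
      mul_le_mul_of_nonneg_left (hs.trans hx1) (mul_nonneg (by linarith) (by linarith))
    have h6 : (k + 2 / 5) ^ 2 ≤ r * (2 * k + 5 / 2) := by nlinarith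
    have h7 : (k + 2 / 5) * (1 + 2 * r) * (23 / 32) ≤ h * (1 + 2 * r) * (23 / 32) := by
      have : 0 ≤ 1 + 2 * r := by linarith
      gcongr
    suffices k + r < (k + 2 / 5) * (1 + 2 * r) * (23 / 32) - k * (1 - 2 * r) * (3 / 4) by linarith
    nlinarith

/-- A lower bound for `log ‖p‖ / arg p`, where `1 / (p - 1) = k - h i`. -/
noncomputable def growthRate (k h : ℝ) : ℝ :=
  (k + 1 / 2) * (k ^ 2 + h ^ 2 + k) / (h * (k ^ 2 + h ^ 2 + k + 1 / 2))

theorem growthRate_eq {k h : ℝ} (hk : 1 / 2 ≤ k) (hh : 0 < h) :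
    growthRate k h
      = (k + 1 / 2) / h * (1 - 1 / 2 / ((k + 1 / 2) ^ 2 + h ^ 2 + 1 / 4)) := by
  have h1 : k ^ 2 + h ^ 2 + k + 1 / 2 ≠ 0 := by positivity
  have h2 : (k + 1 / 2) ^ 2 + h ^ 2 + 1 / 4 ≠ 0 := by positivity
  unfold growthRate
  field_simp
  ring

theorem one_add_add_le_exp {x : ℝ} (hx : 0 ≤ x) :
    1 + x + x ^ 2 / 2 + x ^ 3 / 6 + x ^ 4 / 24 + x ^ 5 / 120 ≤ Real.exp x := by
  have := Real.sum_le_exp_of_nonneg hx 6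
  simp [Finset.sum_range_succ, Nat.factorial] at this
  linarith

/-- `growthRate` in terms of a scale-invariant parameter. -/
theorem le_growthRate {k h u : ℝ} (hk : 1 / 2 ≤ k) (hh : 0 < h) (hu : 0 < u)
    (h1 : u ≤ (k + 1 / 2) / h)
    (h2 : 1 / u ^ 2 + 1 ≤ (k + 1 / 2) ^ 2 + h ^ 2) : u * (1 - 9 / 40 * u) ≤ growthRate k h := by
  rw [growthRate_eq hk hh]
  have h3 : 1 / 2 / ((k + 1 / 2) ^ 2 + h ^ 2 + 1 / 4) ≤ 9 / 40 * u := by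
    have : 1 / 2 / ((k + 1 / 2) ^ 2 + h ^ 2 + 1 / 4) ≤ 1 / 2 / (1 / u ^ 2 + 5 / 4) := by
      apply div_le_div_of_nonneg_left (by norm_num) (by positivity) (by linarith)
    refine this.trans ?_
    rw [div_le_iff₀ (by positivity)]
    have e : 9 / 40 * u * (1 / u ^ 2 + 5 / 4) = 1 / 2 + (9 / 32 * u ^ 2 + 9 / 40 - 1 / 2 * u) / u := by
      field_simp; ring
    rw [e]
    have : 0 ≤ (9 / 32 * u ^ 2 + 9 / 40 - 1 / 2 * u) / u :=
      div_nonneg (by nlinarith [sq_nonneg (u - 8 / 9)]) hu.le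
    linarith
  have h4 : 1 / 2 / ((k + 1 / 2) ^ 2 + h ^ 2 + 1 / 4) ≤ 1 := by
    rw [div_le_one (by positivity)]
    nlinarith [sq_nonneg h]
  calc u * (1 - 9 / 40 * u) ≤ u * (1 - 1 / 2 / ((k + 1 / 2) ^ 2 + h ^ 2 + 1 / 4)) := by
        gcongr
    _ ≤ _ := by
        apply mul_le_mul_of_nonneg_right h1; linarith

/-- Once the angle exceeds π/2 + ψ, the accumulated growth of |p|^n must push the image into the
disc about q. Everything is bounded by polynomials in u = 1/h and reduced to `s1_poly`. -/
theorem s1_exp_of_le {k h M : ℝ} (hk : 1 / 2 ≤ k) (hh : k + 2 / 5 ≤ h) (hM : 0 < M)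
    (hM2 : M ^ 2 = (k + 1) ^ 2 + h ^ 2) (h5 : 6 / 5 ≤ h) (h6 : k ≤ 5 / 4) :
    √((5 / 4 - k) ^ 2 + h ^ 2) + 5 / 4
      < (M - 1) * Real.exp (growthRate k h * (Real.pi / 2 + (7 / 10 - 7 / 10 / h))) := by
  have hh0 : 0 < h := by linarith
  have hr := lt_radius hk hh hM hM2
  have hpi := Real.pi_gt_d2
  have hu1 : 1 / h ≤ 5 / 6 := by
    rw [div_le_iff₀ hh0]; linarith
  have hu0 : 0 < 1 / h := by positivity
  have e7 : 7 / 10 / h = 7 / 10 * (1 / h) := by ring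
  obtain ⟨u, hu⟩ : ∃ u, u = 1 / h := ⟨_, rfl⟩
  have hhu : h = 1 / u := by rw [hu]; field_simp
  rw [e7, ← hu]
  rw [← hu] at hu0 hu1
  obtain ⟨y, hy⟩ : ∃ y, y = (227 / 100 - 7 / 10 * u) * (1 - 9 / 40 * u) := ⟨_, rfl⟩
  have hy0 : 0 < y := by rw [hy]; apply mul_pos <;> linarith
  have hg : u * (1 - 9 / 40 * u) ≤ growthRate k h := by
    apply le_growthRate hk hh0 hu0
    · rw [hu]; gcongr; linarith
    · have : 1 / u ^ 2 = h ^ 2 := by rw [hhu]; field_simp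
      rw [this]; nlinarith
  have hx : u * y ≤ growthRate k h * (Real.pi / 2 + (7 / 10 - 7 / 10 * u)) := by
    calc u * y = u * (1 - 9 / 40 * u) * (227 / 100 - 7 / 10 * u) := by rw [hy]; ring
      _ ≤ _ := by
        apply mul_le_mul hg (by linarith) (by linarith)
        refine le_trans ?_ hg
        apply mul_nonneg hu0.le; linarith
  have hMl : 1 / u + 9 / 8 * u - u ^ 2 / 3 ≤ M := by
    apply sqrt_lower_poly hu0 (by linarith) hM
    have : 1 / u ^ 2 = h ^ 2 := by rw [hhu]; field_simp
    rw [this, hM2]; nlinarith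
  have hRl : √((5 / 4 - k) ^ 2 + h ^ 2) ≤ 1 / u + 9 / 32 * u := by
    rw [Real.sqrt_le_iff]
    refine ⟨by positivity, ?_⟩
    have : (1 / u + 9 / 32 * u) ^ 2 = h ^ 2 + 9 / 16 + (9 / 32 * u) ^ 2 := by
      rw [hhu]; field_simp; ring
    rw [this]; nlinarith [sq_nonneg (9 / 32 * u)]
  have hexp : 1 + u * y + (u * y) ^ 2 / 2 + (u * y) ^ 3 / 6
      ≤ Real.exp (growthRate k h * (Real.pi / 2 + (7 / 10 - 7 / 10 * u))) := by
    refine le_trans ?_ (Real.exp_le_exp.2 hx)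
    refine le_trans ?_ (one_add_add_le_exp (by positivity))
    have : 0 ≤ (u * y) ^ 4 / 24 + (u * y) ^ 5 / 120 := by positivity
    linarith
  have hP := s1_poly hu0 hu1 hy
  calc _ ≤ (1 + 9 / 32 * u ^ 2 + 5 / 4 * u) / u := by
        refine (add_le_add_left hRl _).trans (le_of_eq ?_)
        field_simp
    _ < ((1 - u + 9 / 8 * u ^ 2 - u ^ 3 / 3) *
    (1 + u * y + (u * y) ^ 2 / 2 + (u * y) ^ 3 / 6)) / u := by gcongr
    _ = (1 / u + 9 / 8 * u - u ^ 2 / 3 - 1) * (1 + u * y + (u * y) ^ 2 / 2 + (u * y) ^ 3 / 6) := by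
        field_simp; ring
    _ ≤ _ := by
        apply mul_le_mul (by linarith) hexp (by positivity) (by linarith)
-- Here the square root is at most M and the exponential exceeds 1 plus its argument, so (M-1) times
-- the argument need only exceed 9/4.
theorem s1_exp_of_ge {k h M : ℝ} (hk : 1 / 2 ≤ k) (hh : k + 2 / 5 ≤ h) (hM : 0 < M)
    (hM2 : M ^ 2 = (k + 1) ^ 2 + h ^ 2) (h6 : 5 / 4 ≤ k) :
    √((5 / 4 - k) ^ 2 + h ^ 2) + 5 / 4
      < (M - 1) * Real.exp (growthRate k h * (Real.pi / 2 + (7 / 10 - 7 / 10 / h))) := by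
  have hh0 : 0 < h := by linarith
  have hr := lt_radius hk hh hM hM2
  have hpi := Real.pi_gt_d2
  have hu0 : 0 < 1 / h := by positivity
  have e7 : 7 / 10 / h = 7 / 10 * (1 / h) := by ring
  have hRM : √((5 / 4 - k) ^ 2 + h ^ 2) ≤ M := by
    rw [Real.sqrt_le_iff]
    refine ⟨hM.le, by rw [hM2]; nlinarith⟩
  have hMl : 1 + 22 / 25 * h ≤ M := by
    apply le_of_sq_le_sq _ hM.le
    have : (9 / 4) ^ 2 ≤ (k + 1) ^ 2 := by gcongr; linarith
    rw [hM2]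
    nlinarith [sq_nonneg (h - 39 / 10)]
  have hg : (77 / 80) / h * (5 / 3) ≤ growthRate k h := by
    rw [growthRate_eq hk hh0]
    have h3 : 1 / 2 / ((k + 1 / 2) ^ 2 + h ^ 2 + 1 / 4) ≤ 1 / 2 / 6 := by
      gcongr; nlinarith
    calc (77 / 80) / h * (5 / 3) = (7 / 4) / h * (11 / 12) := by ring
      _ ≤ _ := by
        have : 7 / 4 / h ≤ (k + 1 / 2) / h := by gcongr; linarith
        apply mul_le_mul this (by linarith) (by norm_num) (by positivity)
  have hu2 : 1 / h ≤ 20 / 33 := by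
    rw [div_le_iff₀ hh0]; linarith
  have hx : (77 / 80) / h * (5 / 3) * (9 / 5)
      ≤ growthRate k h * (Real.pi / 2 + (7 / 10 - 7 / 10 / h)) := by
    apply mul_le_mul hg _ (by norm_num) (le_trans (by positivity) hg)
    rw [e7]; linarith
  have hexp := (Real.add_one_le_exp _).trans (Real.exp_le_exp.2 hx)
  have : 9 / 4 < (22 / 25 * h) * ((77 / 80) / h * (5 / 3) * (9 / 5)) := by
    have : (22 / 25 * h) * ((77 / 80) / h * (5 / 3) * (9 / 5)) = 22 / 25 * (77 / 80) * 3 := by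
      field_simp; norm_num
    rw [this]; norm_num
  have h8 : (M - 1) * ((77 / 80) / h * (5 / 3) * (9 / 5) + 1)
      ≤ (M - 1) * Real.exp (growthRate k h * (Real.pi / 2 + (7 / 10 - 7 / 10 / h))) :=
    mul_le_mul_of_nonneg_left hexp (by linarith)
  have h9 : (22 / 25 * h) * ((77 / 80) / h * (5 / 3) * (9 / 5))
      ≤ (M - 1) * ((77 / 80) / h * (5 / 3) * (9 / 5)) := by
    apply mul_le_mul_of_nonneg_right (by linarith) (by positivity)
  linarith

theorem s1_exp {k h M : ℝ} (hk : 1 / 2 ≤ k) (hh : k + 2 / 5 ≤ h) (hM : 0 < M)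
    (hM2 : M ^ 2 = (k + 1) ^ 2 + h ^ 2) (h5 : 6 / 5 ≤ h) :
    √((5 / 4 - k) ^ 2 + h ^ 2) + 5 / 4
      < (M - 1) * Real.exp (growthRate k h * (Real.pi / 2 + (7 / 10 - 7 / 10 / h))) := by
  rcases le_total k (5 / 4) with h6 | h6
  · exact s1_exp_of_le hk hh hM hM2 h5 h6
  · exact s1_exp_of_ge hk hh hM hM2 h6

/-- The hypothesis bounds E by u/√(1+u²), and the cubic is an upper bound for that on (0, 10/9]. -/
theorem le_of_sq_le_mul {u E : ℝ} (hu0 : 0 < u) (hu1 : u ≤ 10 / 9)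
    (hEu : E ^ 2 ≤ u ^ 2 * (1 - E ^ 2)) : E ≤ u - 13 / 50 * u ^ 3 := by
  have hu2 : u ^ 2 ≤ 100 / 81 := by nlinarith
  have h1 : 0 ≤ u - 13 / 50 * u ^ 3 := by
    have : 0 ≤ u * (1 - 13 / 50 * u ^ 2) := mul_nonneg hu0.le (by linarith)
    linarith
  apply le_of_sq_le_sq _ h1
  have h2 : u ^ 2 ≤ (u - 13 / 50 * u ^ 3) ^ 2 * (1 + u ^ 2) := by
    have h3 : (u - 13 / 50 * u ^ 3) ^ 2 * (1 + u ^ 2) = u ^ 2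
        + u ^ 4 * (12 / 25 - 1131 / 2500 * u ^ 2 + 169 / 2500 * (u ^ 2) ^ 2) := by ring
    have h4 : 0 ≤ 12 / 25 - 1131 / 2500 * u ^ 2 + 169 / 2500 * (u ^ 2) ^ 2 := by
      generalize u ^ 2 = w at hu2
      nlinarith [sq_nonneg (w - 100 / 81)]
    rw [h3]
    have := mul_nonneg (by positivity : 0 ≤ u ^ 4) h4
    linarith
  have h5 : E ^ 2 * (1 + u ^ 2) ≤ (u - 13 / 50 * u ^ 3) ^ 2 * (1 + u ^ 2) := by linarith
  exact le_of_mul_le_mul_right h5 (by positivity)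

/-- M and a are the distances from q to -1 and to 0. The difference of their squares is 2k+1, and
their sum is at least twice the distance from q to the midpoint -1/2. -/
theorem sub_sq_le {k h a M : ℝ} (hh : 0 < h) (ha : 0 < a) (hM : 0 < M)
    (ha2 : a ^ 2 = k ^ 2 + h ^ 2) (hM2 : M ^ 2 = (k + 1) ^ 2 + h ^ 2) :
    (M - a) ^ 2 ≤ ((k + 1 / 2) / h) ^ 2 * (1 - (M - a) ^ 2) := by
  have h2 : (M - a) * (M + a) = 2 * k + 1 := by nlinarith
  have h3 : 4 * (h ^ 2 + (k + 1 / 2) ^ 2) ≤ (M + a) ^ 2 := by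
    have : k ^ 2 + k + h ^ 2 ≤ a * M := by
      apply le_of_sq_le_sq _ (by positivity)
      rw [mul_pow, ha2, hM2]; nlinarith [sq_nonneg h]
    nlinarith
  have h4 : (M - a) ^ 2 * (h ^ 2 + (k + 1 / 2) ^ 2) ≤ (k + 1 / 2) ^ 2 := by
    have h5 : ((M - a) * (M + a)) ^ 2 = (2 * k + 1) ^ 2 := by rw [h2]
    have := mul_le_mul_of_nonneg_left h3 (sq_nonneg (M - a))
    rw [mul_pow] at h5
    linarith
  rw [div_pow, div_mul_eq_mul_div, le_div_iff₀ (by positivity)]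
  linarith

/-- The left side bounds the distance from q to the far side of the inverted disc: the inverse of
the ball of radius M-1 about q lies within 1/(a-(M-1)) of 0. -/
theorem s2_exp {k h a M : ℝ} (hk : 1 / 2 ≤ k) (hh : k + 2 / 5 ≤ h) (ha : 0 < a) (hM : 0 < M)
    (ha2 : a ^ 2 = k ^ 2 + h ^ 2) (hM2 : M ^ 2 = (k + 1) ^ 2 + h ^ 2) :
    a + 1 / (1 - (M - a)) < (M - 1) * Real.exp (growthRate k h * (Real.pi / 2 + 3 / 4)) := by
  have hh0 : 0 < h := by linarith
  have hpi := Real.pi_gt_d2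
  obtain ⟨E, hE⟩ : ∃ E, E = M - a := ⟨_, rfl⟩
  have hE0 : 0 < E := by
    rw [hE, sub_pos]; apply lt_of_pow_lt_pow_left₀ 2 hM.le; rw [ha2, hM2]; nlinarith
  have hE1 : E < 1 := by
    have : M < a + 1 := by
      apply lt_of_pow_lt_pow_left₀ 2 (by linarith)
      have : k < a := by apply lt_of_pow_lt_pow_left₀ 2 ha.le; rw [ha2]; nlinarith
      rw [hM2]; nlinarith
    linarith
  obtain ⟨u, hu⟩ : ∃ u, u = (k + 1 / 2) / h := ⟨_, rfl⟩
  have hu0 : 0 < u := by rw [hu]; positivity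
  have hu1 : u ≤ 10 / 9 := by rw [hu, div_le_iff₀ hh0]; linarith
  have hinv : 1 / u ^ 2 = h ^ 2 / (k + 1 / 2) ^ 2 := by rw [hu]; field_simp
  have hinv' : 1 / u ^ 2 * (k + 1 / 2) ^ 2 = h ^ 2 := by rw [hinv]; field_simp
  have hi0 : 0 < 1 / u ^ 2 := by positivity
  obtain ⟨y, hy⟩ : ∃ y, y = 58 / 25 * (1 - 9 / 40 * u) := ⟨_, rfl⟩
  have hy0 : 0 < y := by rw [hy]; linarith
  have hg : u * (1 - 9 / 40 * u) ≤ growthRate k h := by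
    apply le_growthRate hk hh0 hu0 hu.le
    have : 1 ≤ (k + 1 / 2) ^ 2 := by nlinarith
    nlinarith [mul_nonneg hi0.le (sub_nonneg.2 this)]
  have hx : u * y ≤ growthRate k h * (Real.pi / 2 + 3 / 4) := by
    calc u * y = u * (1 - 9 / 40 * u) * (58 / 25) := by rw [hy]; ring
      _ ≤ _ := by
        apply mul_le_mul hg (by linarith) (by norm_num)
        refine le_trans ?_ hg
        apply mul_nonneg hu0.le; linarith
  have hMl : 1 / u + 9 / 8 * u - u ^ 2 / 3 ≤ M := by
    apply sqrt_lower_poly hu0 (by linarith) hM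
    have : 1 ≤ (k + 1 / 2) ^ 2 := by nlinarith
    rw [hM2]; nlinarith [mul_nonneg hi0.le (sub_nonneg.2 this)]
  have hP := s2_poly hu0.le hu1 hy
  have hexp := (one_add_add_le_exp (by positivity)).trans (Real.exp_le_exp.2 hx)
  have hEu : E ^ 2 ≤ u ^ 2 * (1 - E ^ 2) := by
    rw [hE, hu]; exact sub_sq_le hh0 ha hM ha2 hM2
  have hEe : E ≤ u - 13 / 50 * u ^ 3 := le_of_sq_le_mul hu0 hu1 hEu
  have hfrac : a + 1 / (1 - (M - a)) - (M - 1) ≤ 2 + u ^ 2 * (1 + u - 13 / 50 * u ^ 3) := by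
    rw [← hE]
    -- Subtracting M - 1 from both sides cancels the leading 1/u and leaves the exponential minus 1.
    have e : a + 1 / (1 - E) - (M - 1) = 2 + E ^ 2 / (1 - E) := by
      have : 1 - E ≠ 0 := by linarith
      have : a = M - E := by linarith
      rw [this]; field_simp; ring
    have : E ^ 2 / (1 - E) ≤ u ^ 2 * (1 + E) := by
      rw [div_le_iff₀ (by linarith)]; linarith
    have : u ^ 2 * (1 + E) ≤ u ^ 2 * (1 + u - 13 / 50 * u ^ 3) := by
      gcongr ?_ * ?_; linarith
    linarith
  have hl : (1 - u + 9 / 8 * u ^ 2 - u ^ 3 / 3) *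
      (y * (1 + u * y / 2 + u ^ 2 * y ^ 2 / 6 + u ^ 3 * y ^ 3 / 24 + u ^ 4 * y ^ 4 / 120))
      ≤ (M - 1) * (Real.exp (growthRate k h * (Real.pi / 2 + 3 / 4)) - 1) := by
    have e : (1 - u + 9 / 8 * u ^ 2 - u ^ 3 / 3) *
      (y * (1 + u * y / 2 + u ^ 2 * y ^ 2 / 6 + u ^ 3 * y ^ 3 / 24 + u ^ 4 * y ^ 4 / 120))
      = (1 / u + 9 / 8 * u - u ^ 2 / 3 - 1) * (u * y + (u * y) ^ 2 / 2 + (u * y) ^ 3 / 6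
        + (u * y) ^ 4 / 24 + (u * y) ^ 5 / 120) := by
      field_simp; ring
    rw [e]
    have := lt_radius hk hh hM hM2
    apply mul_le_mul (by linarith) (by linarith) (by positivity) (by linarith)
  linarith

/-! ### Invariant regions and the inversion of discs -/

/-- A region that is mapped into itself by all the maps `z ↦ Tⁿ⁺¹ (1 / z)`, where
`T z = (z + 1) / p`, and is bounded away from `0`. -/
structure IsInvariantRegion (p : ℂ) (R : Set ℂ) : Prop where
  isOpen : IsOpen R
  fixedPoint_mem : (p - 1)⁻¹ ∈ R
  away : ∃ ε > 0, ∀ z ∈ R, ε ≤ ‖z‖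
  orbit : ∀ z ∈ closure ((fun w => w⁻¹) '' R), ∀ n : ℕ,
    (p - 1)⁻¹ + (z - (p - 1)⁻¹) * p⁻¹ ^ (n + 1) ∈ R

/-- Inversion in the circle picture: s is the power of 0 with respect to the circle, and its
positivity keeps 0 outside the disc. Clearing denominators reduces the claim to |z-q|² ≤ r². -/
theorem inv_mem_closedBall {q z : ℂ} {r s : ℝ} (hr : 0 ≤ r) (hs : 0 < s)
    (h : s = ‖q‖ ^ 2 - r ^ 2) (hz : z ∈ Metric.ball q r) :
    z⁻¹ ∈ Metric.closedBall ((starRingEnd ℂ) q / s) (r / s) := by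
  have hz0 : z ≠ 0 := by
    rintro rfl
    rw [Metric.mem_ball, dist_zero_left] at hz
    nlinarith [norm_nonneg q]
  have hs' : (s : ℂ) ≠ 0 := by exact_mod_cast hs.ne'
  rw [Metric.mem_ball, dist_eq_norm] at hz
  rw [Metric.mem_closedBall, dist_eq_norm]
  have e : z⁻¹ - (starRingEnd ℂ) q / s = (s - (starRingEnd ℂ) q * z) / (z * s) := by
    field_simp
  rw [e, norm_div, norm_mul, Complex.norm_real, Real.norm_of_nonneg hs.le,
    div_le_div_iff₀ (by positivity) hs]
  suffices ‖(s : ℂ) - (starRingEnd ℂ) q * z‖ ≤ r * ‖z‖ by nlinarith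
  apply le_of_sq_le_sq _ (by positivity)
  have h1 : ‖z - q‖ ^ 2 ≤ r ^ 2 := by gcongr
  rw [mul_pow]
  rw [← Complex.normSq_eq_norm_sq] at *
  rw [← Complex.normSq_eq_norm_sq]
  simp only [Complex.normSq_apply, Complex.sub_re, Complex.sub_im, Complex.mul_re, Complex.mul_im,
    Complex.conj_re, Complex.conj_im, Complex.ofReal_re, Complex.ofReal_im] at *
  nlinarith

theorem inv_mem_closedBall_of_re {c : ℝ} (hc : 0 < c) {z : ℂ} (hz : c < z.re) :
    z⁻¹ ∈ Metric.closedBall ((1 / (2 * c) : ℝ) : ℂ) (1 / (2 * c)) := by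
  have hz0 : z ≠ 0 := by rintro rfl; simp at hz; linarith
  have hc' : (c : ℂ) ≠ 0 := by exact_mod_cast hc.ne'
  rw [Metric.mem_closedBall, dist_eq_norm]
  have e : z⁻¹ - ((1 / (2 * c) : ℝ) : ℂ) = (2 * c - z) / (z * (2 * c)) := by
    push_cast; field_simp
  have e2 : ‖(2 * c : ℂ)‖ = 2 * c := by
    rw [← Complex.ofReal_ofNat, ← Complex.ofReal_mul, Complex.norm_real,
      Real.norm_of_nonneg (by positivity)]
  rw [e, norm_div, norm_mul, e2, div_le_div_iff₀ (by positivity) (by positivity)]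
  suffices ‖(2 * c : ℂ) - z‖ ≤ ‖z‖ by nlinarith
  apply le_of_sq_le_sq _ (by positivity)
  rw [← Complex.normSq_eq_norm_sq, ← Complex.normSq_eq_norm_sq]
  simp [Complex.normSq_apply]
  nlinarith

/-! ### A single invariant disc -/

/-- The condition on t is a quadratic inequality with leading coefficient 2m²(m-P). The choice t =
C/B succeeds exactly under the discriminant condition and, unlike the vertex, remains meaningful
when m = P, that is for real p. -/
theorem exists_disc_parameter {P Q m : ℝ} (hm : m ^ 2 = P ^ 2 + Q ^ 2)
    (hB : 0 < m ^ 2 - P)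
    (h : 2 * m ^ 2 * (m - P) * (1 + (m - 1) ^ 2) < (m ^ 2 - P) ^ 2) :
    ∃ t : ℝ, 0 < t ∧ (t * P + 1 - t * m ^ 2) ^ 2 + (t * Q) ^ 2
      < (t ^ 2 * m ^ 2 - 1) * (m - 1) ^ 2 := by
  refine ⟨(1 + (m - 1) ^ 2) / (m ^ 2 - P), by positivity, ?_⟩
  set C := 1 + (m - 1) ^ 2 with hC
  set B := m ^ 2 - P with hB'
  have hC0 : 0 < C := by positivity
  obtain ⟨t, ht⟩ : ∃ t, t = C / B := ⟨_, rfl⟩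
  have htB : t * B = C := by rw [ht]; field_simp
  have key : 2 * m ^ 2 * (m - P) * t ^ 2 - 2 * B * t + C < 0 := by
    have h1 : 2 * m ^ 2 * (m - P) * C * C < B ^ 2 * C := mul_lt_mul_of_pos_right h hC0
    have h2 : (2 * m ^ 2 * (m - P) * t ^ 2 - 2 * B * t + C) * B ^ 2
        = 2 * m ^ 2 * (m - P) * C * C - B ^ 2 * C := by
      calc _ = 2 * m ^ 2 * (m - P) * (t * B) ^ 2 - 2 * B ^ 2 * (t * B) + C * B ^ 2 := by ring
        _ = _ := by rw [htB]; ring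
    have h3 : (2 * m ^ 2 * (m - P) * t ^ 2 - 2 * B * t + C) * B ^ 2 < 0 := by linarith
    by_contra hcon
    push Not at hcon
    have := mul_nonneg hcon (sq_nonneg B)
    linarith
  rw [← ht]
  have e : (t * P + 1 - t * m ^ 2) ^ 2 + (t * Q) ^ 2 - (t ^ 2 * m ^ 2 - 1) * (m - 1) ^ 2
      = 2 * m ^ 2 * (m - P) * t ^ 2 - 2 * B * t + C + t ^ 2 * (P ^ 2 + Q ^ 2 - m ^ 2) := by
    rw [hB', hC]; ring
  rw [hm] at e
  simp only [sub_self, mul_zero, add_zero] at e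
  rw [← hm] at e
  linarith

/-- The ball has centre c = t·conj p and radius r with |c|² - r² = 1, so inversion turns it into its
complex conjugate, of the same radius. As p·c = t|p|² is real, the conditions that T map the ball
and its conjugate strictly into the ball coincide, and iteration is immediate. -/
theorem isInvariantRegion_ball {p : ℂ} (hp1 : 1 < ‖p‖) {t : ℝ} (ht : 0 < t)
    (h : (t * p.re + 1 - t * ‖p‖ ^ 2) ^ 2 + (t * p.im) ^ 2
      < (t ^ 2 * ‖p‖ ^ 2 - 1) * (‖p‖ - 1) ^ 2) :
    ∃ R, IsInvariantRegion p R := by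
  have hp0 : p ≠ 0 := by rintro rfl; simp at hp1; linarith
  have hp1' : p - 1 ≠ 0 := by
    intro h0
    rw [sub_eq_zero.1 h0] at hp1; simp at hp1
  have hq := inv_mul_cancel₀ hp1'
  set q := (p - 1)⁻¹ with hqdef
  have hr2 : 0 < t ^ 2 * ‖p‖ ^ 2 - 1 := by
    by_contra hcon
    push Not at hcon
    have h1 := mul_nonneg (neg_nonneg.2 hcon) (sq_nonneg (‖p‖ - 1))
    nlinarith [sq_nonneg (t * p.re + 1 - t * ‖p‖ ^ 2), sq_nonneg (t * p.im)]
  obtain ⟨r, hr0, hr⟩ : ∃ r : ℝ, 0 < r ∧ r ^ 2 = t ^ 2 * ‖p‖ ^ 2 - 1 :=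
    ⟨√(t ^ 2 * ‖p‖ ^ 2 - 1), Real.sqrt_pos.2 hr2, Real.sq_sqrt hr2.le⟩
  set c : ℂ := t * (starRingEnd ℂ) p with hc
  have hcn : ‖c‖ = t * ‖p‖ := by simp [hc, abs_of_pos ht]
  have hcc : (starRingEnd ℂ) c = t * p := by simp [hc]
  have hpp : p * (starRingEnd ℂ) p = (‖p‖ ^ 2 : ℝ) := by
    rw [Complex.mul_conj, Complex.normSq_eq_norm_sq]
  have norm_lt : ∀ w : ℂ, ‖w‖ ^ 2 < (t ^ 2 * ‖p‖ ^ 2 - 1) * (‖p‖ - 1) ^ 2 →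
      ‖w‖ < r * (‖p‖ - 1) := by
    intro w hw
    apply lt_of_pow_lt_pow_left₀ 2 (mul_nonneg hr0.le (by linarith))
    rw [mul_pow, hr]; exact hw
  have hd1 : ‖t * p + 1 - t * (‖p‖ ^ 2 : ℝ)‖ < r * (‖p‖ - 1) := by
    apply norm_lt
    rw [← Complex.normSq_eq_norm_sq]
    simp only [Complex.normSq_apply]
    simp [-Complex.ofReal_pow] at h ⊢
    linarith
  have hd2 : ‖c + 1 - t * (‖p‖ ^ 2 : ℝ)‖ < r * (‖p‖ - 1) := by
    apply norm_lt
    rw [← Complex.normSq_eq_norm_sq, hc]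
    simp only [Complex.normSq_apply]
    simp [-Complex.ofReal_pow] at h ⊢
    linarith
  have step : ∀ b : ℂ, ‖b + 1 - t * (‖p‖ ^ 2 : ℝ)‖ < r * (‖p‖ - 1) →
      ∀ z ∈ Metric.closedBall b r, (z + 1) / p ∈ Metric.ball c r := by
    intro b hb z hz
    rw [Metric.mem_closedBall, dist_eq_norm] at hz
    rw [Metric.mem_ball, dist_eq_norm]
    have e : (z + 1) / p - c = ((z - b) + (b + 1 - t * (‖p‖ ^ 2 : ℝ))) / p := by
      rw [← hpp, hc]; field_simp; ring
    rw [e, norm_div, div_lt_iff₀ (by positivity)]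
    calc _ ≤ ‖z - b‖ + ‖b + 1 - t * (‖p‖ ^ 2 : ℝ)‖ := norm_add_le _ _
      _ < r * ‖p‖ := by linarith
  have hT : ∀ w : ℂ, q + (w - q) * p⁻¹ = (w + 1) / p := by
    intro w
    have : p * q = q + 1 := by linear_combination hq
    field_simp
    linear_combination this
  refine ⟨Metric.ball c r, Metric.isOpen_ball, ?_, ?_, ?_⟩
  · rw [Metric.mem_ball, dist_eq_norm, ← norm_sub_rev]
    have e : (c - q) * (p - 1) = -(c + 1 - p * c) := by linear_combination -hq
    have h1 : ‖c - q‖ * ‖p - 1‖ < r * (‖p‖ - 1) := by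
      rw [← norm_mul, e, norm_neg]
      have : p * c = t * (‖p‖ ^ 2 : ℝ) := by rw [← hpp, hc]; ring
      rw [this]; exact hd2
    have h2 : ‖p‖ - 1 ≤ ‖p - 1‖ := by
      have := norm_sub_norm_le p 1
      simpa using this
    have h3 : 0 < ‖p - 1‖ := norm_pos_iff.2 hp1'
    nlinarith
  · refine ⟨‖c‖ - r, ?_, ?_⟩
    · rw [hcn, gt_iff_lt, sub_pos]
      apply lt_of_pow_lt_pow_left₀ 2 (by positivity)
      rw [mul_pow, hr]; linarith
    · intro z hz
      rw [Metric.mem_ball, dist_eq_norm, ← norm_sub_rev] at hz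
      have := norm_sub_norm_le c z
      linarith
  · have hsub : closure ((fun w : ℂ => w⁻¹) '' Metric.ball c r) ⊆ Metric.closedBall (t * p) r := by
      apply closure_minimal _ Metric.isClosed_closedBall
      rintro _ ⟨z, hz, rfl⟩
      have := inv_mem_closedBall (s := 1) hr0.le one_pos (by rw [hcn, mul_pow, hr]; ring) hz
      simpa [hcc] using this
    intro z hz n
    have hz' := hsub hz
    induction n with
    | zero =>
      rw [zero_add, pow_one, hT]
      exact step _ hd1 z hz'
    | succ n ih =>
      have e : q + (z - q) * p⁻¹ ^ (n + 1 + 1)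
          = q + ((q + (z - q) * p⁻¹ ^ (n + 1)) - q) * p⁻¹ := by ring
      rw [e, hT]
      exact step c hd2 _ (Metric.ball_subset_closedBall ih)

/-! ### The union of a half-plane and a disc -/

/-- For α ≥ 0 the function is concave on [0, π/2], hence at least the smaller of its values at x and
π/2. For α ≤ 0 both terms increase. -/
theorem min_le_sinusoid {α β x y : ℝ} (hβ : 0 ≤ β) (hx : 0 ≤ x) (hxy : x ≤ y)
    (hy : y ≤ Real.pi / 2) :
    min (α * Real.cos x + β * Real.sin x) β ≤ α * Real.cos y + β * Real.sin y := by
  have hpi := Real.pi_pos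
  rcases le_total 0 α with hα | hα
  · have hc : ConcaveOn ℝ (Set.Icc 0 (Real.pi / 2))
        (fun x => α * Real.cos x + β * Real.sin x) := by
      apply ConcaveOn.add
      · have := (strictConcaveOn_cos_Icc.concaveOn.subset
          (Set.Icc_subset_Icc (by linarith : -(Real.pi / 2) ≤ 0) le_rfl) (convex_Icc _ _)).smul hα
        simpa using this
      · have := (strictConcaveOn_sin_Icc.concaveOn.subset
          (Set.Icc_subset_Icc le_rfl (by linarith : Real.pi / 2 ≤ Real.pi)) (convex_Icc _ _)).smul hβ
        simpa using this
    have := hc.min_le_of_mem_Icc (x := x) (y := Real.pi / 2) (z := y) ⟨hx, hxy.trans hy⟩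
      ⟨by linarith, le_rfl⟩ ⟨hxy, hy⟩
    simpa using this
  · apply min_le_of_left_le
    have h1 : Real.cos y ≤ Real.cos x := Real.cos_le_cos_of_nonneg_of_le_pi hx (by linarith) hxy
    have h2 : Real.sin x ≤ Real.sin y := Real.sin_le_sin_of_le_of_le_pi_div_two (by linarith) hy hxy
    have h3 := mul_le_mul_of_nonpos_left h1 hα
    have h4 := mul_le_mul_of_nonneg_left h2 hβ
    linarith

/-- The parameters of the half-plane construction: `1 / (p - 1) = k - h i`. -/
structure Params (p : ℂ) (k h a M : ℝ) : Prop where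
  hk : 1 / 2 ≤ k
  hh : k + 2 / 5 ≤ h
  ha : 0 < a
  hM : 0 < M
  ha2 : a ^ 2 = k ^ 2 + h ^ 2
  hM2 : M ^ 2 = (k + 1) ^ 2 + h ^ 2
  hq : (p - 1)⁻¹ = ⟨k, -h⟩

namespace Params
variable {p : ℂ} {k h a M : ℝ}

theorem h_pos (P : Params p k h a M) : 0 < h := by linarith [P.hk, P.hh]

theorem p_eq (P : Params p k h a M) : p = ⟨(a ^ 2 + k) / a ^ 2, h / a ^ 2⟩ := by
  have h0 := P.h_pos
  have hq0 : (⟨k, -h⟩ : ℂ) ≠ 0 := by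
    intro h1; have := congrArg Complex.im h1; simp at this; linarith
  have h1 : p = 1 + (⟨k, -h⟩ : ℂ)⁻¹ := by rw [← P.hq, inv_inv]; ring
  rw [h1]
  have ha := P.ha.ne'
  apply Complex.ext <;> simp [Complex.inv_re, Complex.inv_im, Complex.normSq_apply, P.ha2, ← sq]
  have : k ^ 2 + h ^ 2 ≠ 0 := by positivity
  field_simp

theorem norm_p (P : Params p k h a M) : ‖p‖ = M / a := by
  have ha := P.ha
  have hM := P.hM
  rw [← sq_eq_sq₀ (norm_nonneg _) (by positivity), ← Complex.normSq_eq_norm_sq, P.p_eq,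
    Complex.normSq_apply, div_pow, P.hM2]
  simp only
  field_simp
  rw [P.ha2]; ring

theorem p_ne_zero (P : Params p k h a M) : p ≠ 0 := by
  have := P.norm_p
  have ha := P.ha
  have hM := P.hM
  rw [← norm_pos_iff, this]; positivity

theorem one_lt_norm (P : Params p k h a M) : 1 < M / a := by
  rw [one_lt_div P.ha]
  apply lt_of_pow_lt_pow_left₀ 2 P.hM.le
  rw [P.ha2, P.hM2]; nlinarith [P.hk]

theorem cos_arg (P : Params p k h a M) : Real.cos p.arg = (a ^ 2 + k) / (a * M) := by
  have ha := P.ha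
  have hM := P.hM
  rw [Complex.cos_arg P.p_ne_zero, P.norm_p]
  conv_lhs => rw [P.p_eq]
  simp only
  field_simp

theorem sin_arg (P : Params p k h a M) : Real.sin p.arg = h / (a * M) := by
  have ha := P.ha
  have hM := P.hM
  rw [Complex.sin_arg, P.norm_p]
  conv_lhs => rw [P.p_eq]
  simp only
  field_simp

theorem arg_pos (P : Params p k h a M) : 0 < p.arg := by
  have ha := P.ha
  have hh := P.h_pos
  have him : 0 < p.im := by
    rw [P.p_eq]; positivity
  rw [lt_iff_le_and_ne]
  refine ⟨Complex.arg_nonneg_iff.2 him.le, fun h0 => ?_⟩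
  have := Complex.arg_eq_zero_iff.1 h0.symm
  linarith [this.2]

theorem arg_lt (P : Params p k h a M) : p.arg < Real.pi / 2 := by
  have ha := P.ha
  have hk : 0 < k := by linarith [P.hk]
  have hre : 0 < p.re := by
    rw [P.p_eq]; positivity
  exact (abs_lt.1 (Complex.abs_arg_lt_pi_div_two_iff.2 (Or.inl hre))).2

/-- Combines arg p ≤ tan(arg p) = h/(a²+k) with log(1+x) ≥ 2x/(x+2) at x = (2k+1)/a², where 1+x =
|p|². -/
theorem growthRate_le (P : Params p k h a M) : growthRate k h * p.arg ≤ Real.log (M / a) := by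
  have ha := P.ha
  have hM := P.hM
  have hh := P.h_pos
  have hk : 0 < k := by linarith [P.hk]
  have h1 : p.arg ≤ h / (a ^ 2 + k) := by
    have h2 := Real.lt_tan P.arg_pos P.arg_lt
    rw [Real.tan_eq_sin_div_cos, P.cos_arg, P.sin_arg, div_div_div_cancel_right₀ (by positivity)]
      at h2
    exact h2.le
  have h2 : growthRate k h * (h / (a ^ 2 + k)) = (k + 1 / 2) / (k ^ 2 + h ^ 2 + k + 1 / 2) := by
    unfold growthRate
    rw [P.ha2]
    field_simp
  have h3 : 0 ≤ growthRate k h := by unfold growthRate; positivity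
  have h4 := Real.le_log_one_add_of_nonneg (x := (2 * k + 1) / a ^ 2) (by positivity)
  have h5 : 1 + (2 * k + 1) / a ^ 2 = (M / a) ^ 2 := by
    rw [div_pow, P.hM2]
    field_simp
    rw [P.ha2]; ring
  rw [h5, Real.log_pow] at h4
  have h6 : 2 * ((2 * k + 1) / a ^ 2) / ((2 * k + 1) / a ^ 2 + 2)
      = 2 * ((k + 1 / 2) / (k ^ 2 + h ^ 2 + k + 1 / 2)) := by
    rw [← P.ha2]; field_simp; ring
  rw [h6] at h4
  push_cast at h4
  calc _ ≤ growthRate k h * (h / (a ^ 2 + k)) := by gcongr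
    _ ≤ _ := by rw [h2]; linarith

theorem exp_le_pow (P : Params p k h a M) {φ : ℝ} {n : ℕ} (hφ : φ ≤ n * p.arg) :
    Real.exp (growthRate k h * φ) ≤ (M / a) ^ n := by
  have ha := P.ha
  have hM := P.hM
  have hh := P.h_pos
  have hk : 0 < k := by linarith [P.hk]
  have h3 : 0 ≤ growthRate k h := by unfold growthRate; positivity
  rw [← Real.exp_log (by positivity : 0 < (M / a) ^ n), Real.log_pow]
  apply Real.exp_le_exp.2
  calc growthRate k h * φ ≤ growthRate k h * (n * p.arg) := by gcongr
    _ = n * (growthRate k h * p.arg) := by ring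
    _ ≤ _ := by gcongr; exact P.growthRate_le

theorem inv_pow (P : Params p k h a M) (n : ℕ) : p⁻¹ ^ n * ((M / a) ^ n : ℝ)
    = ⟨Real.cos (n * p.arg), -Real.sin (n * p.arg)⟩ := by
  have h1 := Complex.norm_mul_exp_arg_mul_I p
  rw [P.norm_p] at h1
  have h0 : ((M / a : ℝ) : ℂ) ≠ 0 := by
    have ha := P.ha
    have hM := P.hM
    have : M / a ≠ 0 := by positivity
    exact_mod_cast this
  have h2 : p⁻¹ * ((M / a : ℝ) : ℂ) = Complex.exp (-(p.arg * Complex.I)) := by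
    rw [Complex.exp_neg]
    nth_rewrite 1 [← h1]
    field_simp
  rw [Complex.ofReal_pow, ← mul_pow, h2, ← Complex.exp_nat_mul]
  have h3 : (n : ℂ) * -(p.arg * Complex.I) = ((-(n * p.arg) : ℝ) : ℂ) * Complex.I := by
    push_cast; ring
  rw [h3]
  apply Complex.ext
  · rw [Complex.exp_ofReal_mul_I_re]; simp
  · rw [Complex.exp_ofReal_mul_I_im]; simp

/-- The iterate T^n multiplies displacements from q by p^(-n), a rotation by -n·arg p and a scaling
by (a/M)^n. The two alternatives, multiplied by (M/a)^n, place the whole image disc in the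
half-plane or in the ball about q. -/
theorem disc_orbit (P : Params p k h a M) {α β r : ℝ} {n : ℕ}
    (H : r < (k - 2 / 5) * (M / a) ^ n + (α * Real.cos (n * p.arg) + β * Real.sin (n * p.arg)) ∨
      ‖(⟨α, β⟩ : ℂ)‖ + r < (M - 1) * (M / a) ^ n) {z : ℂ}
    (hz : z ∈ Metric.closedBall ((p - 1)⁻¹ + ⟨α, β⟩) r) :
    (p - 1)⁻¹ + (z - (p - 1)⁻¹) * p⁻¹ ^ n ∈
      {w : ℂ | 2 / 5 < w.re} ∪ Metric.ball (p - 1)⁻¹ (M - 1) := by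
  have ha := P.ha
  have hM := P.hM
  have hE : 0 < (M / a) ^ n := by positivity
  set E := (M / a) ^ n with hEdef
  rw [Metric.mem_closedBall, dist_eq_norm] at hz
  set q := (p - 1)⁻¹
  have hn : ‖p⁻¹ ^ n‖ = E⁻¹ := by rw [norm_pow, norm_inv, P.norm_p, _root_.inv_pow]
  rcases H with H | H
  · left
    rw [Set.mem_ofPred_eq]
    have hi := P.inv_pow n
    rw [← hEdef] at hi
    have e : ((q + (z - q) * p⁻¹ ^ n) - q) * (E : ℂ)
        = (⟨α, β⟩ + (z - (q + ⟨α, β⟩))) * ⟨Real.cos (n * p.arg), -Real.sin (n * p.arg)⟩ := by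
      rw [← hi]; ring
    have hb : |((z - (q + ⟨α, β⟩)) * (⟨Real.cos (n * p.arg), -Real.sin (n * p.arg)⟩ : ℂ)).re| ≤ r := by
      refine (Complex.abs_re_le_norm _).trans ?_
      rw [← hi, norm_mul, norm_mul, hn, Complex.norm_real, Real.norm_of_nonneg hE.le,
        inv_mul_cancel₀ hE.ne', mul_one]
      exact hz
    have e2 := congrArg Complex.re e
    rw [Complex.re_mul_ofReal, add_mul, Complex.add_re, Complex.sub_re] at e2
    have hqre : q.re = k := by rw [show q = ⟨k, -h⟩ from P.hq]
    rw [hqre] at e2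
    have e3 : ((⟨α, β⟩ : ℂ) * (⟨Real.cos (n * p.arg), -Real.sin (n * p.arg)⟩ : ℂ)).re
        = α * Real.cos (n * p.arg) + β * Real.sin (n * p.arg) := by
      simp [Complex.mul_re]
    rw [e3] at e2
    have h3 := (abs_le.1 hb).1
    have h4 : 0 < ((q + (z - q) * p⁻¹ ^ n).re - 2 / 5) * E := by linarith
    have := (mul_pos_iff_of_pos_right hE).1 h4
    linarith
  · right
    rw [Metric.mem_ball, dist_eq_norm]
    have e : q + (z - q) * p⁻¹ ^ n - q = (⟨α, β⟩ + (z - (q + ⟨α, β⟩))) * p⁻¹ ^ n := by ring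
    rw [e, norm_mul, hn, ← div_eq_mul_inv, div_lt_iff₀ hE]
    calc _ ≤ ‖(⟨α, β⟩ : ℂ)‖ + ‖z - (q + ⟨α, β⟩)‖ := norm_add_le _ _
      _ ≤ ‖(⟨α, β⟩ : ℂ)‖ + r := by gcongr
      _ < _ := H


/-- Three ranges of the total angle φ = (n+1)·arg p. Up to π/2, concavity interpolates between the
first step and a quarter turn; up to π/2 + ψ the sinusoid is estimated directly; beyond that, the
growth of |p|^(n+1) puts the image into the ball about q. -/
theorem orbit_cases (P : Params p k h a M) {α β r ψ : ℝ} (hβ : 0 ≤ β) (hψ : 0 ≤ ψ)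
    (h1 : r < (k - 2 / 5) * (M / a) + (α * Real.cos p.arg + β * Real.sin p.arg))
    (h2 : ∀ x, 0 ≤ x → x ≤ ψ →
      r < (k - 2 / 5) * (M / a) ^ 2 + β * Real.cos x - α * Real.sin x)
    (h3 : ‖(⟨α, β⟩ : ℂ)‖ + r < (M - 1) * Real.exp (growthRate k h * (Real.pi / 2 + ψ)))
    (n : ℕ) :
    r < (k - 2 / 5) * (M / a) ^ (n + 1) + (α * Real.cos ((n + 1 : ℕ) * p.arg)
        + β * Real.sin ((n + 1 : ℕ) * p.arg)) ∨
      ‖(⟨α, β⟩ : ℂ)‖ + r < (M - 1) * (M / a) ^ (n + 1) := by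
  have hδ : 0 ≤ k - 2 / 5 := by linarith [P.hk]
  have hM1 := lt_radius P.hk P.hh P.hM P.hM2
  rcases Nat.eq_zero_or_pos n with rfl | hn
  · left; simpa using h1
  have hpow : (M / a) ^ 2 ≤ (M / a) ^ (n + 1) := pow_le_pow_right₀ P.one_lt_norm.le (by omega)
  have hpow' := mul_le_mul_of_nonneg_left hpow hδ
  have hm2 : (M / a) ≤ (M / a) ^ 2 := by nlinarith [P.one_lt_norm]
  have hm2' := mul_le_mul_of_nonneg_left hm2 hδ
  set φ : ℝ := (n + 1 : ℕ) * p.arg with hφ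
  have hle : p.arg ≤ φ := by
    rw [hφ]; push_cast
    have : 0 ≤ (n : ℝ) * p.arg := mul_nonneg (Nat.cast_nonneg n) P.arg_pos.le
    linarith
  rcases le_total φ (Real.pi / 2) with h4 | h4
  · left
    have h5 := min_le_sinusoid (α := α) hβ P.arg_pos.le hle h4
    have h6 := h2 0 le_rfl hψ
    simp only [Real.cos_zero, Real.sin_zero, mul_one, mul_zero, sub_zero] at h6
    rcases min_choice (α * Real.cos p.arg + β * Real.sin p.arg) β with h7 | h7 <;>
    · rw [h7] at h5; linarith
  · rcases le_total φ (Real.pi / 2 + ψ) with h5 | h5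
    · left
      have h6 := h2 (φ - Real.pi / 2) (by linarith) (by linarith)
      rw [Real.cos_sub_pi_div_two, Real.sin_sub_pi_div_two] at h6
      linarith
    · right
      refine h3.trans_le ?_
      apply mul_le_mul_of_nonneg_left (P.exp_le_pow h5)
      linarith [P.hk]

theorem orbit_first (P : Params p k h a M) (n : ℕ) :
    5 / 4 < (k - 2 / 5) * (M / a) ^ (n + 1) + ((5 / 4 - k) * Real.cos ((n + 1 : ℕ) * p.arg)
        + h * Real.sin ((n + 1 : ℕ) * p.arg)) ∨
      ‖(⟨5 / 4 - k, h⟩ : ℂ)‖ + 5 / 4 < (M - 1) * (M / a) ^ (n + 1) := by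
  have ha := P.ha
  have hM := P.hM
  have hn : ‖(⟨5 / 4 - k, h⟩ : ℂ)‖ = √((5 / 4 - k) ^ 2 + h ^ 2) := by
    rw [Complex.norm_def, Complex.normSq_apply]; congr 1; ring
  have h1 : 5 / 4 < (k - 2 / 5) * (M / a) + ((5 / 4 - k) * Real.cos p.arg
      + h * Real.sin p.arg) := by
    rw [P.cos_arg, P.sin_arg]
    have e : (k - 2 / 5) * (M / a) + ((5 / 4 - k) * ((a ^ 2 + k) / (a * M)) + h * (h / (a * M)))
        = ((k - 2 / 5) * M ^ 2 + (5 / 4 - k) * (a ^ 2 + k) + h ^ 2) / (a * M) := by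
      field_simp
      ring
    rw [e, lt_div_iff₀ (by positivity)]
    exact s1_first P.hk P.hh P.ha2 P.hM2
  -- For small h two explicit steps reach the range where the ball about q takes over. For large h
  -- the window ψ = 7/10 - 7/(10h) is nonnegative and `orbit_cases` applies.
  rcases le_total h (6 / 5) with h5 | h5
  · rcases n with _ | _ | n
    · left; simpa using h1
    · left
      have h2 := s1_second P.hk P.hh P.ha2 P.hM2
      have e : (((0 + 1 + 1 : ℕ) : ℝ)) * p.arg = 2 * p.arg := by norm_num
      rw [e, Real.cos_two_mul', Real.sin_two_mul, P.cos_arg, P.sin_arg]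
      have e : (k - 2 / 5) * (M / a) ^ (0 + 1 + 1) + ((5 / 4 - k) * (((a ^ 2 + k) / (a * M)) ^ 2
          - (h / (a * M)) ^ 2) + h * (2 * (h / (a * M)) * ((a ^ 2 + k) / (a * M))))
          = ((k - 2 / 5) * M ^ 4 + (5 / 4 - k) * ((a ^ 2 + k) ^ 2 - h ^ 2)
            + 2 * h ^ 2 * (a ^ 2 + k)) / (a ^ 2 * M ^ 2) := by
        rw [zero_add, show 1 + 1 = 2 from rfl, div_pow M a 2]
        field_simp
        ring
      rw [e, lt_div_iff₀ (by positivity)]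
      exact h2
    · right
      have h2 := s1_third P.hk P.hh P.ha P.hM P.ha2 P.hM2 h5
      rw [hn]
      refine h2.trans_le ?_
      have := lt_radius P.hk P.hh P.hM P.hM2
      apply mul_le_mul_of_nonneg_left _ (by linarith [P.hk])
      exact pow_le_pow_right₀ P.one_lt_norm.le (by omega)
  · refine P.orbit_cases P.h_pos.le (ψ := 7 / 10 - 7 / 10 / h) ?_ h1 ?_ ?_ n
    · rw [sub_nonneg, div_le_iff₀ P.h_pos]; linarith
    · intro x hx0 hx1
      exact s1_mid P.hk P.hh P.ha2 P.hM2 h5 hx0 hx1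
    · rw [hn]
      exact s1_exp P.hk P.hh P.hM P.hM2 h5

theorem orbit_second (P : Params p k h a M) {s : ℝ} (hs : s = 2 * (M - k - 1)) (n : ℕ) :
    (M - 1) / s < (k - 2 / 5) * (M / a) ^ (n + 1)
        + (k * (1 / s - 1) * Real.cos ((n + 1 : ℕ) * p.arg)
        + h * (1 / s + 1) * Real.sin ((n + 1 : ℕ) * p.arg)) ∨
      ‖(⟨k * (1 / s - 1), h * (1 / s + 1)⟩ : ℂ)‖ + (M - 1) / s < (M - 1) * (M / a) ^ (n + 1) := by
  have ha := P.ha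
  have hM := P.hM
  have hh := P.h_pos
  have hk : 0 < k := by linarith [P.hk]
  have hr := lt_radius P.hk P.hh P.hM P.hM2
  have hs0 : 0 < s := by linarith [P.hk]
  refine P.orbit_cases (by positivity) (ψ := 3 / 4) (by norm_num) ?_ ?_ ?_ n
  · rw [P.cos_arg, P.sin_arg]
    have e : (k - 2 / 5) * (M / a) + (k * (1 / s - 1) * ((a ^ 2 + k) / (a * M))
        + h * (1 / s + 1) * (h / (a * M)))
        = ((k - 2 / 5) * M ^ 2 * s + k * (1 - s) * (a ^ 2 + k) + h ^ 2 * (1 + s))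
          / (a * M) / s := by
      field_simp; ring
    rw [e, div_lt_div_iff_of_pos_right hs0, lt_div_iff₀ (by positivity), hs]
    exact s2_first P.hk P.hh P.hM P.ha2 P.hM2
  · intro x hx0 hx1
    have h1 := s2_mid P.hk P.hh P.hM P.hM2 hx0 hx1
    rw [← hs] at h1
    have h2 : 0 ≤ (k - 2 / 5) * (M / a) ^ 2 := mul_nonneg (by linarith [P.hk]) (by positivity)
    have e : h * (1 / s + 1) * Real.cos x - k * (1 / s - 1) * Real.sin x
        = (h * (1 + s) * Real.cos x - k * (1 - s) * Real.sin x) / s := by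
      field_simp
    have h3 : (M - 1) / s < (h * (1 + s) * Real.cos x - k * (1 - s) * Real.sin x) / s := by
      gcongr
    linarith
  · refine lt_of_le_of_lt ?_ (s2_exp P.hk P.hh P.ha P.hM P.ha2 P.hM2)
    have hq : ‖(⟨k, -h⟩ : ℂ)‖ = a := by
      rw [← sq_eq_sq₀ (norm_nonneg _) ha.le, ← Complex.normSq_eq_norm_sq, Complex.normSq_apply,
        P.ha2]; simp only; ring
    have hq' : ‖(⟨k, h⟩ : ℂ)‖ = a := by
      rw [← sq_eq_sq₀ (norm_nonneg _) ha.le, ← Complex.normSq_eq_norm_sq, Complex.normSq_apply,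
        P.ha2]; simp only; ring
    have e : (⟨k * (1 / s - 1), h * (1 / s + 1)⟩ : ℂ) = ⟨k, h⟩ * ((1 / s : ℝ) : ℂ) - ⟨k, -h⟩ := by
      apply Complex.ext <;> simp <;> ring
    have h1 : ‖(⟨k * (1 / s - 1), h * (1 / s + 1)⟩ : ℂ)‖ ≤ a * (1 / s) + a := by
      rw [e]
      refine (norm_sub_le _ _).trans ?_
      rw [norm_mul, hq, hq', Complex.norm_real, Real.norm_of_nonneg (by positivity)]
    have hs2 : s = (a - (M - 1)) * (a + (M - 1)) := by
      rw [hs]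
      have : (a - (M - 1)) * (a + (M - 1)) = a ^ 2 - M ^ 2 + 2 * M - 1 := by ring
      rw [this, P.ha2, P.hM2]; ring
    have h2 : 0 < a + (M - 1) := by linarith
    have h3 : 0 < a - (M - 1) := by
      rw [hs2] at hs0; exact (mul_pos_iff_of_pos_right h2).1 hs0
    have h4 : a * (1 / s) + a + (M - 1) / s = a + 1 / (1 - (M - a)) := by
      have : 1 - (M - a) = a - (M - 1) := by ring
      rw [this, hs2]
      field_simp
      ring
    linarith

/-- The region is the half-plane Re > 2/5 joined to the ball of radius M - 1 < |q| about q. The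
inverse of its union lies in two discs, each followed under all iterates of T. -/
theorem exists_region (P : Params p k h a M) : ∃ R, IsInvariantRegion p R := by
  have ha := P.ha
  have hM := P.hM
  have hr := lt_radius P.hk P.hh P.hM P.hM2
  have hk := P.hk
  obtain ⟨s, hs⟩ : ∃ s, s = 2 * (M - k - 1) := ⟨_, rfl⟩
  have hs0 : 0 < s := by linarith
  have hqn : ‖(p - 1)⁻¹‖ = a := by
    rw [← sq_eq_sq₀ (norm_nonneg _) ha.le, ← Complex.normSq_eq_norm_sq, P.hq, Complex.normSq_apply,
      P.ha2]; simp only; ring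
  have hs2 : s = a ^ 2 - (M - 1) ^ 2 := by
    have : a ^ 2 - (M - 1) ^ 2 = a ^ 2 - M ^ 2 + 2 * M - 1 := by ring
    rw [this, P.ha2, P.hM2, hs]; ring
  have hra : M - 1 < a := by
    apply lt_of_pow_lt_pow_left₀ 2 ha.le; linarith
  have hball : Metric.ball ((p - 1)⁻¹) (M - 1) ⊆ {z | a - (M - 1) ≤ ‖z‖} := by
    intro z hz
    rw [Metric.mem_ball, dist_comm, dist_eq_norm] at hz
    have := norm_sub_norm_le (p - 1)⁻¹ z
    rw [Set.mem_ofPred_eq]; linarith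
  refine ⟨{w : ℂ | 2 / 5 < w.re} ∪ Metric.ball (p - 1)⁻¹ (M - 1), ?_, ?_, ?_, ?_⟩
  · exact (isOpen_lt continuous_const Complex.continuous_re).union Metric.isOpen_ball
  · right; exact Metric.mem_ball_self (by linarith)
  · refine ⟨min (2 / 5) (a - (M - 1)), lt_min (by norm_num) (by linarith), ?_⟩
    rintro z (hz | hz)
    · exact (min_le_left _ _).trans ((le_of_lt hz).trans (Complex.re_le_norm z))
    · exact (min_le_right _ _).trans (hball hz)
  · have hc1 : (((1 / (2 * (2 / 5)) : ℝ)) : ℂ) = (p - 1)⁻¹ + ⟨5 / 4 - k, h⟩ := by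
      rw [P.hq]; apply Complex.ext <;> norm_num
    have hc2 : (starRingEnd ℂ) (p - 1)⁻¹ / s
        = (p - 1)⁻¹ + ⟨k * (1 / s - 1), h * (1 / s + 1)⟩ := by
      rw [P.hq]; apply Complex.ext <;> simp <;> ring
    have hsub : closure ((fun w : ℂ => w⁻¹) '' ({w : ℂ | 2 / 5 < w.re} ∪
        Metric.ball (p - 1)⁻¹ (M - 1))) ⊆
        Metric.closedBall ((p - 1)⁻¹ + ⟨5 / 4 - k, h⟩) (5 / 4) ∪
        Metric.closedBall ((p - 1)⁻¹ + ⟨k * (1 / s - 1), h * (1 / s + 1)⟩) ((M - 1) / s) := by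
      apply closure_minimal _ (Metric.isClosed_closedBall.union Metric.isClosed_closedBall)
      rintro _ ⟨z, hz | hz, rfl⟩
      · left
        have := inv_mem_closedBall_of_re (by norm_num : (0 : ℝ) < 2 / 5) hz
        rw [hc1] at this
        norm_num at this ⊢
        exact this
      · right
        have := inv_mem_closedBall (by linarith) hs0 (by rw [hs2, hqn]) hz
        rw [hc2] at this
        exact this
    intro z hz n
    rcases hsub hz with hz | hz
    · exact P.disc_orbit (P.orbit_first n) hz
    · exact P.disc_orbit (P.orbit_second hs n) hz

end Params

/-! ### Existence of an invariant region for every admissible p ≠ 1 -/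

/-- With a = |q|, M = |q+1| and e = M - a one has |p| = M/a, and the quantities in
`exists_disc_parameter` become rational in a, e, k, which turns its condition into `regimeI_ineq`.
-/
theorem exists_region_of_small {p : ℂ} {k h : ℝ} (hk : 0 < k) (hh : 0 ≤ h)
    (H : h = 0 ∨ (1 / 2 ≤ k ∧ h ≤ k + 2 / 5)) (hq : (p - 1)⁻¹ = ⟨k, -h⟩) :
    ∃ R, IsInvariantRegion p R := by
  have hN : 0 < k ^ 2 + h ^ 2 := by positivity
  obtain ⟨a, ha, ha2⟩ : ∃ a, 0 < a ∧ a ^ 2 = k ^ 2 + h ^ 2 :=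
    ⟨√(k ^ 2 + h ^ 2), Real.sqrt_pos.2 hN, Real.sq_sqrt hN.le⟩
  have hN' : 0 < (k + 1) ^ 2 + h ^ 2 := by positivity
  obtain ⟨M, hM, hM2⟩ : ∃ M, 0 < M ∧ M ^ 2 = (k + 1) ^ 2 + h ^ 2 :=
    ⟨√((k + 1) ^ 2 + h ^ 2), Real.sqrt_pos.2 hN', Real.sq_sqrt hN'.le⟩
  obtain ⟨e, he⟩ : ∃ e, e = M - a := ⟨_, rfl⟩
  have hMe : M = a + e := by linarith
  have he0 : 0 < e := by
    rw [he, sub_pos]; apply lt_of_pow_lt_pow_left₀ 2 hM.le; rw [ha2, hM2]; nlinarith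
  have hke : 2 * k + 1 = 2 * a * e + e ^ 2 := by
    have : M ^ 2 = a ^ 2 + 2 * a * e + e ^ 2 := by rw [hMe]; ring
    linarith
  have hka : k ≤ a := by
    apply le_of_sq_le_sq _ ha.le; rw [ha2]; nlinarith
  have he1 : e ≤ 1 := by
    by_contra hcon
    push Not at hcon
    nlinarith
  have hineq := regimeI_ineq (n := k ^ 2 + h ^ 2) ha ha2.symm he0 he1 hke hk (by
    rcases H with rfl | ⟨h1, h2⟩
    · left
      have : a = k := by
        have : a ^ 2 = k ^ 2 := by rw [ha2]; ring
        exact (sq_eq_sq₀ ha.le hk.le).1 this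
      rw [this] at hke
      have h3 : (e - 1) * (e + 1 + 2 * k) = 0 := by linarith
      rcases mul_eq_zero.1 h3 with h4 | h4 <;> linarith
    · right
      refine ⟨h1, ?_⟩
      have : h ^ 2 ≤ (k + 2 / 5) ^ 2 := by gcongr
      linarith)
  rw [← hMe] at hineq
  have hq0 : (⟨k, -h⟩ : ℂ) ≠ 0 := by
    intro h1; have := congrArg Complex.re h1; simp at this; linarith
  have hp : p = ⟨(a ^ 2 + k) / a ^ 2, h / a ^ 2⟩ := by
    have h1 : p = 1 + (⟨k, -h⟩ : ℂ)⁻¹ := by rw [← hq, inv_inv]; ring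
    rw [h1]
    have ha := ha.ne'
    apply Complex.ext <;> simp [Complex.inv_re, Complex.inv_im, Complex.normSq_apply, ha2, ← sq]
    field_simp
  have hnorm : ‖p‖ = M / a := by
    rw [← sq_eq_sq₀ (norm_nonneg _) (by positivity), ← Complex.normSq_eq_norm_sq, hp,
      Complex.normSq_apply, div_pow, hM2]
    simp only
    field_simp
    rw [ha2]; ring
  have h1 : 1 < ‖p‖ := by
    rw [hnorm, one_lt_div ha]; linarith
  have hpre : p.re = (a ^ 2 + k) / a ^ 2 := by rw [hp]
  have hpim : p.im = h / a ^ 2 := by rw [hp]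
  have hsq : ‖p‖ ^ 2 = p.re ^ 2 + p.im ^ 2 := by
    rw [← Complex.normSq_eq_norm_sq, Complex.normSq_apply]; ring
  have hB : ‖p‖ ^ 2 - p.re = (k + 1) / a ^ 2 := by
    rw [hnorm, hpre, div_pow, hM2]
    field_simp
    rw [ha2]; ring
  have hA : ‖p‖ - p.re = (1 - e ^ 2) / 2 / a ^ 2 := by
    rw [hnorm, hpre, hMe]
    field_simp
    linarith
  have hC : 1 + (‖p‖ - 1) ^ 2 = (k ^ 2 + h ^ 2 + e ^ 2) / a ^ 2 := by
    rw [hnorm, hMe, ← ha2]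
    field_simp
    ring
  obtain ⟨t, ht0, ht⟩ := exists_disc_parameter hsq (by rw [hB]; positivity) (by
    rw [hB, hA, hC, hnorm]
    have e1 : 2 * (M / a) ^ 2 * ((1 - e ^ 2) / 2 / a ^ 2) * ((k ^ 2 + h ^ 2 + e ^ 2) / a ^ 2)
        = ((1 - e ^ 2) * M ^ 2 * (k ^ 2 + h ^ 2 + e ^ 2)) / a ^ 6 := by
      field_simp
    have e2 : ((k + 1) / a ^ 2) ^ 2 = ((k + 1) ^ 2 * (k ^ 2 + h ^ 2)) / a ^ 6 := by
      rw [← ha2]; field_simp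
    rw [e1, e2]
    gcongr)
  exact isInvariantRegion_ball h1 ht0 ht

theorem IsInvariantRegion.conj {p : ℂ} {R : Set ℂ} (h : IsInvariantRegion ((starRingEnd ℂ) p) R) :
    IsInvariantRegion p ((starRingEnd ℂ) ⁻¹' R) := by
  have hc : Continuous (starRingEnd ℂ) := Complex.continuous_conj
  refine ⟨h.isOpen.preimage hc, ?_, ?_, ?_⟩
  · simpa using h.fixedPoint_mem
  · obtain ⟨ε, hε, H⟩ := h.away
    refine ⟨ε, hε, fun z hz => ?_⟩
    simpa using H _ hz
  · intro z hz n
    have h1 : (starRingEnd ℂ) z ∈ closure ((fun w => w⁻¹) '' R) := by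
      have h2 : Set.MapsTo (starRingEnd ℂ) ((fun w => w⁻¹) '' ((starRingEnd ℂ) ⁻¹' R))
          ((fun w => w⁻¹) '' R) := by
        rintro _ ⟨w, hw, rfl⟩
        exact ⟨_, hw, by simp⟩
      exact h2.closure hc hz
    have := h.orbit _ h1 n
    simpa using this

/-- The disc |p-2| ≤ 1 without 1 corresponds to Re q ≥ 1/2. Conjugation gives Im p ≥ 0, and real p >
1 is the case h = 0 with any k > 0. -/
theorem exists_region {p : ℂ} (hp : ‖p - 2‖ ≤ 1 ∨ (1 ≤ p.re ∧ p.im = 0)) (h1 : p ≠ 1) :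
    ∃ R, IsInvariantRegion p R := by
  have hw : p - 1 ≠ 0 := sub_ne_zero.2 h1
  have key : ∀ p : ℂ, ‖p - 2‖ ≤ 1 → p - 1 ≠ 0 → 0 ≤ p.im → ∃ R, IsInvariantRegion p R := by
    intro p hp hw him
    obtain ⟨k, h, hq⟩ : ∃ k h : ℝ, (p - 1)⁻¹ = ⟨k, -h⟩ :=
      ⟨(p - 1)⁻¹.re, -(p - 1)⁻¹.im, by apply Complex.ext <;> simp⟩
    have hn : 0 < Complex.normSq (p - 1) := Complex.normSq_pos.2 hw
    have hk : 1 / 2 ≤ k := by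
      have e : k = (p - 1)⁻¹.re := by rw [hq]
      rw [e, Complex.inv_re, le_div_iff₀ hn]
      have h2 : ‖p - 2‖ ^ 2 ≤ 1 := by nlinarith [norm_nonneg (p - 2)]
      rw [← Complex.normSq_eq_norm_sq] at h2
      simp [Complex.normSq_apply] at h2 ⊢
      nlinarith
    have hh : 0 ≤ h := by
      have e : -h = (p - 1)⁻¹.im := by rw [hq]
      rw [Complex.inv_im] at e
      simp at e
      have : 0 ≤ p.im / Complex.normSq (p - 1) := by positivity
      rw [neg_div] at e
      linarith
    rcases le_total h (k + 2 / 5) with h2 | h2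
    · exact exists_region_of_small (by linarith) hh (Or.inr ⟨hk, h2⟩) hq
    · have hN : 0 < k ^ 2 + h ^ 2 := by positivity
      have hN' : 0 < (k + 1) ^ 2 + h ^ 2 := by positivity
      exact Params.exists_region (k := k) (h := h) (a := √(k ^ 2 + h ^ 2))
        (M := √((k + 1) ^ 2 + h ^ 2)) ⟨hk, h2, Real.sqrt_pos.2 hN, Real.sqrt_pos.2 hN',
          Real.sq_sqrt hN.le, Real.sq_sqrt hN'.le, hq⟩
  rcases hp with hp | ⟨hre, him⟩
  · rcases le_total 0 p.im with h0 | h0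
    · exact key p hp hw h0
    · obtain ⟨R, hR⟩ := key ((starRingEnd ℂ) p) (by
          rw [← Complex.norm_conj]; simpa [Complex.conj_ofNat] using hp) (by
          intro h2
          apply hw
          have := congrArg (starRingEnd ℂ) h2
          simpa using this) (by simpa using h0)
      exact ⟨_, hR.conj⟩
  · obtain ⟨x, rfl⟩ : ∃ x : ℝ, p = x := ⟨p.re, by apply Complex.ext <;> simp [him]⟩
    have hx : 1 < x := by
      rw [Complex.ofReal_re] at hre
      rcases hre.eq_or_lt with h2 | h2
      · exact absurd (by rw [← h2]; simp) h1
      · exact h2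
    refine exists_region_of_small (k := (x - 1)⁻¹) (h := 0) (inv_pos.2 (by linarith)) le_rfl
      (Or.inl rfl) ?_
    rw [← Complex.ofReal_one, ← Complex.ofReal_sub, ← Complex.ofReal_inv]
    apply Complex.ext
    · rw [Complex.ofReal_re]
    · rw [Complex.ofReal_im, neg_zero]

/-! ### Words in the two generators -/

/-- The two maps `T z = (z + 1) / p` and `1 / T`. -/
noncomputable def pStep (p : ℂ) : Bool → ℂ → ℂ
  | true, z => (z + 1) / p
  | false, z => p / (z + 1)

/-- The derivatives of the maps `pStep`. -/
noncomputable def pStepDeriv (p : ℂ) : Bool → ℂ → ℂ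
  | true, _ => 1 / p
  | false, z => -p / (z + 1) ^ 2

/-- Compositions of the maps `pStep`. -/
noncomputable def pWord (p : ℂ) : List Bool → ℂ → ℂ
  | [], z => z
  | b :: w, z => pStep p b (pWord p w z)

/-- The derivatives of the maps `pWord`. -/
noncomputable def pWordDeriv (p : ℂ) : List Bool → ℂ → ℂ
  | [], _ => 1
  | b :: w, z => pStepDeriv p b (pWord p w z) * pWordDeriv p w z

theorem pWord_append (p : ℂ) (w w' : List Bool) (z : ℂ) :
    pWord p (w ++ w') z = pWord p w (pWord p w' z) := by
  induction w with
  | nil => rfl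
  | cons b w ih => simp [pWord, ih]

theorem pStep_inv (p : ℂ) (b : Bool) (z : ℂ) : (pStep p b z)⁻¹ = pStep p (!b) z := by
  cases b <;> simp [pStep, inv_div]

theorem hasDerivAt_pStep {p z : ℂ} (b : Bool) (hz : z + 1 ≠ 0) :
    HasDerivAt (pStep p b) (pStepDeriv p b z) z := by
  cases b with
  | true =>
    have := ((hasDerivAt_id z).add_const 1).div_const p
    exact this
  | false =>
    have := ((hasDerivAt_const z p).div ((hasDerivAt_id z).add_const 1) hz)
    exact this.congr_deriv (by simp [pStepDeriv])

/-- The Möbius identity (g z - g w)² = g'(z) g'(w) (z-w)². It is multiplicative along compositions,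
so it passes to words and replaces a mean value estimate, which would need convexity. -/
theorem pStep_sub_sq {p z w : ℂ} (hp : p ≠ 0) (b : Bool) (hz : z + 1 ≠ 0) (hw : w + 1 ≠ 0) :
    (pStep p b z - pStep p b w) ^ 2 = pStepDeriv p b z * pStepDeriv p b w * (z - w) ^ 2 := by
  cases b with
  | true => simp only [pStep, pStepDeriv]; field_simp; ring
  | false => simp only [pStep, pStepDeriv]; field_simp; ring

/-! ### From an invariant region to a contractive neighbourhood -/

/-- A bounded open set that is mapped well inside itself by both generators. -/
structure IsContractive (p : ℂ) (V : Set ℂ) : Prop where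
  isOpen : IsOpen V
  bounded : ∃ B > 0, ∀ z ∈ V, ‖z‖ ≤ B
  away : ∃ ε > 0, ∀ z ∈ V, ε ≤ ‖z‖
  inv_mem : ∀ z ∈ V, z⁻¹ ∈ V
  fixedPoint_mem : (p - 1)⁻¹ ∈ V
  inside : ∃ δ > 0, ∀ z ∈ V, ∀ b, ∀ w, ‖w - pStep p b z‖ ≤ δ → w ∈ V

theorem one_lt_norm_of_mem {p : ℂ} (hp : ‖p - 2‖ ≤ 1 ∨ (1 ≤ p.re ∧ p.im = 0)) (h1 : p ≠ 1) :
    1 < ‖p‖ := by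
  have hre : 1 ≤ p.re := by
    rcases hp with hp | hp
    · have := (abs_le.1 ((Complex.abs_re_le_norm (p - 2)).trans hp)).1
      simp at this; linarith
    · exact hp.1
  by_contra hcon
  push Not at hcon
  have h2 : p.re ^ 2 + p.im ^ 2 ≤ 1 := by
    have : ‖p‖ ^ 2 ≤ 1 := by nlinarith [norm_nonneg p]
    rw [← Complex.normSq_eq_norm_sq, Complex.normSq_apply] at this
    linarith
  apply h1
  have h3 : p.im = 0 := by nlinarith [sq_nonneg p.im]
  have h4 : p.re = 1 := by nlinarith
  apply Complex.ext <;> simp [h3, h4]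

/-- The images T^(n+1)(S), S = closure of 1/R, together with their limit q form a compact K ⊂ R with
T K ⊂ K. Take a thickening N of K inside R and V = N ∪ 1/N. Since T contracts, T N lies closer to K
than the thickening radius, and T(1/N) ⊂ K. Thus T V is deep inside N, and (1/T)V deep inside 1/N.
-/
theorem IsInvariantRegion.exists_isContractive {p : ℂ} {R : Set ℂ} (hR : IsInvariantRegion p R)
    (hp : 1 < ‖p‖) : ∃ V, IsContractive p V := by
  have hp0 : p ≠ 0 := by rintro rfl; simp at hp; linarith
  have hp1' : p - 1 ≠ 0 := by
    intro h0
    rw [sub_eq_zero.1 h0] at hp; simp at hp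
  have hq := inv_mul_cancel₀ hp1'
  obtain ⟨ε, hε, hRε⟩ := hR.away
  set q := (p - 1)⁻¹ with hqdef
  have hT : ∀ w : ℂ, (w + 1) / p = q + (w - q) * p⁻¹ := by
    intro w
    have : p * q = q + 1 := by linear_combination hq
    field_simp
    linear_combination -this
  set S := closure ((fun w : ℂ => w⁻¹) '' R) with hS
  have hSb : S ⊆ Metric.closedBall 0 ε⁻¹ := by
    apply closure_minimal _ Metric.isClosed_closedBall
    rintro _ ⟨z, hz, rfl⟩
    rw [mem_closedBall_zero_iff, norm_inv]
    exact inv_anti₀ hε (hRε z hz)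
  have hSc : IsCompact S := (isCompact_closedBall (0 : ℂ) ε⁻¹).of_isClosed_subset isClosed_closure hSb
  have hv : ‖p⁻¹‖ < 1 := by rw [norm_inv]; exact inv_lt_one_of_one_lt₀ hp
  -- the compact set
  set K : Set ℂ := {q} ∪ ⋃ n : ℕ, (fun z => q + (z - q) * p⁻¹ ^ (n + 1)) '' S with hK
  have hKR : K ⊆ R := by
    rintro z (rfl | hz)
    · exact hR.fixedPoint_mem
    · obtain ⟨n, y, hy, rfl⟩ := Set.mem_iUnion.1 hz
      exact hR.orbit y hy n
  -- K is the image of S × ({0} ∪ {p^(-n-1)}) under (z, c) ↦ q + (z-q)c, joined with q. The factor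
  -- is compact because the powers tend to 0.
  have hKc : IsCompact K := by
    have hC : IsCompact (insert (0 : ℂ) (Set.range fun n : ℕ => p⁻¹ ^ (n + 1))) :=
      Filter.Tendsto.isCompact_insert_range
        ((tendsto_pow_atTop_nhds_zero_of_norm_lt_one hv).comp (Filter.tendsto_add_atTop_nat 1))
    have hcont : Continuous fun a : ℂ × ℂ => q + (a.1 - q) * a.2 := by fun_prop
    have := (isCompact_singleton (x := q)).union ((hSc.prod hC).image hcont)
    convert this using 1
    ext y
    constructor
    · rintro (hy | hy)
      · exact Or.inl hy
      · obtain ⟨n, s, hs, rfl⟩ := Set.mem_iUnion.1 hy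
        exact Or.inr ⟨(s, p⁻¹ ^ (n + 1)), ⟨hs, Or.inr ⟨n, rfl⟩⟩, rfl⟩
    · rintro (hy | ⟨⟨s, c⟩, ⟨hs, hc⟩, rfl⟩)
      · exact Or.inl hy
      · rcases hc with hc | ⟨n, hc⟩
        · left; simp only at hc; simp [hc]
        · right; exact Set.mem_iUnion.2 ⟨n, s, hs, by simp only at hc; simp [← hc]⟩
  obtain ⟨δ, hδ, hδR⟩ := hKc.exists_thickening_subset_open hR.isOpen hKR
  set N := Metric.thickening δ K with hN
  have hTK : ∀ z ∈ K, (z + 1) / p ∈ K := by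
    rintro z (rfl | hz)
    · left; rw [hT]; simp
    · obtain ⟨n, y, hy, rfl⟩ := Set.mem_iUnion.1 hz
      right
      refine Set.mem_iUnion.2 ⟨n + 1, y, hy, ?_⟩
      simp only
      rw [hT]; ring
  have hTN : ∀ z ∈ N, ∃ y ∈ K, ‖(z + 1) / p - y‖ ≤ ‖p⁻¹‖ * δ := by
    intro z hz
    obtain ⟨y, hy, hd⟩ := Metric.mem_thickening_iff.1 hz
    refine ⟨(y + 1) / p, hTK y hy, ?_⟩
    rw [show (z + 1) / p - (y + 1) / p = p⁻¹ * (z - y) by field_simp; ring, norm_mul]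
    rw [dist_eq_norm] at hd
    gcongr
  have hTJ : ∀ z ∈ N, (z⁻¹ + 1) / p ∈ K := by
    intro z hz
    right
    refine Set.mem_iUnion.2 ⟨0, z⁻¹, subset_closure ⟨z, hδR hz, rfl⟩, ?_⟩
    simp only
    rw [hT]; ring
  have hNε : ∀ z ∈ N, ε ≤ ‖z‖ := fun z hz => hRε z (hδR hz)
  have hKN : K ⊆ N := Metric.self_subset_thickening hδ K
  obtain ⟨B, hB⟩ := hKc.isBounded.exists_norm_le
  have hNB : ∀ z ∈ N, ‖z‖ ≤ B + δ := by
    intro z hz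
    obtain ⟨y, hy, hd⟩ := Metric.mem_thickening_iff.1 hz
    rw [dist_eq_norm] at hd
    have := hB y hy
    have h2 : ‖z‖ ≤ ‖z - y‖ + ‖y‖ := by simpa using norm_add_le (z - y) y
    linarith
  have hB0 : 0 ≤ B := (norm_nonneg q).trans (hB q (Or.inl rfl))
  -- a point near the image
  have hTall : ∀ z ∈ N ∪ {z | z⁻¹ ∈ N}, ∃ y ∈ K, ‖(z + 1) / p - y‖ ≤ ‖p⁻¹‖ * δ := by
    rintro z (hz | hz)
    · exact hTN z hz
    · have := hTJ _ hz
      rw [inv_inv] at this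
      exact ⟨_, this, by simp; positivity⟩
  have hNopen : IsOpen N := Metric.isOpen_thickening
  have hN0 : ∀ z, z⁻¹ ∈ N → z ≠ 0 := by
    rintro z hz rfl
    have := hNε _ hz
    simp at this; linarith
  refine ⟨N ∪ {z | z⁻¹ ∈ N}, ?_, ?_, ?_, ?_, ?_, ?_⟩
  · apply hNopen.union
    rw [isOpen_iff_mem_nhds]
    intro z hz
    exact (continuousAt_inv₀ (hN0 z hz)).preimage_mem_nhds (hNopen.mem_nhds hz)
  · refine ⟨max (B + δ) ε⁻¹, by positivity, ?_⟩
    rintro z (hz | hz)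
    · exact (hNB z hz).trans (le_max_left _ _)
    · refine le_trans ?_ (le_max_right _ _)
      have := hNε _ hz
      rw [norm_inv] at this
      exact (le_inv_comm₀ hε (norm_pos_iff.2 (hN0 z hz))).1 this
  · refine ⟨min ε (B + δ)⁻¹, by positivity, ?_⟩
    rintro z (hz | hz)
    · exact (min_le_left _ _).trans (hNε z hz)
    · refine (min_le_right _ _).trans ?_
      have := hNB _ hz
      rw [norm_inv] at this
      exact (inv_le_comm₀ (norm_pos_iff.2 (hN0 z hz)) (by positivity)).1 this
  · rintro z (hz | hz)
    · right; simpa using hz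
    · left; exact hz
  · left; exact hKN (Or.inl rfl)
  · set η := (1 - ‖p⁻¹‖) * δ with hη
    have hη0 : 0 < η := mul_pos (by linarith) hδ
    have hnear : ∀ u y : ℂ, y ∈ K → ‖u - y‖ < δ → u ∈ N := by
      intro u y hy hu
      rw [hN, Metric.mem_thickening_iff]
      exact ⟨y, hy, by rwa [dist_eq_norm]⟩
    obtain ⟨C, hC, hC0⟩ : ∃ C, C = B + δ ∧ 0 < C := ⟨_, rfl, by positivity⟩
    -- The first entry is the margin left by T. The other two carry it through inversion: they keep
    -- w away from 0 and bound |1/w - u|, where the points of N have norm at most C.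
    refine ⟨min (η / 2) (min (1 / (2 * C)) (η / (4 * C ^ 2))), by positivity, ?_⟩
    intro z hz b w hw
    obtain ⟨y, hy, hyd⟩ := hTall z hz
    cases b with
    | true =>
      left
      apply hnear w y hy
      have h1 : ‖w - (z + 1) / p‖ ≤ η / 2 := hw.trans (min_le_left _ _)
      have h2 : ‖w - y‖ ≤ ‖w - (z + 1) / p‖ + ‖(z + 1) / p - y‖ := by
        simpa using norm_add_le (w - (z + 1) / p) ((z + 1) / p - y)
      rw [hη] at h1
      have : 0 < (1 - ‖p⁻¹‖) * δ := hη0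
      linarith
    | false =>
      right
      have huN : (z + 1) / p ∈ N := hnear _ y hy (by nlinarith)
      set u := (z + 1) / p with hu
      have hu0 : u ≠ 0 := by
        rintro h0; have := hNε u huN; rw [h0] at this; simp at this; linarith
      have huC : ‖u‖ ≤ C := hC ▸ hNB u huN
      have e : pStep p false z = u⁻¹ := by simp [pStep, hu, inv_div]
      rw [e] at hw
      have h1 : ‖w - u⁻¹‖ ≤ 1 / (2 * C) := hw.trans ((min_le_right _ _).trans (min_le_left _ _))
      have h2 : ‖w - u⁻¹‖ ≤ η / (4 * C ^ 2) :=
        hw.trans ((min_le_right _ _).trans (min_le_right _ _))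
      have hui : 1 / C ≤ ‖u⁻¹‖ := by
        rw [norm_inv, one_div]; exact inv_anti₀ (norm_pos_iff.2 hu0) huC
      have hwl : 1 / (2 * C) ≤ ‖w‖ := by
        have h3 := norm_sub_norm_le u⁻¹ w
        rw [norm_sub_rev] at h3
        have : 1 / C = 1 / (2 * C) + 1 / (2 * C) := by field_simp; norm_num
        linarith
      have hw0 : w ≠ 0 := by
        rintro rfl; simp at hwl; linarith [hwl, (by positivity : 0 < C⁻¹ * 2⁻¹)]
      have hwi : ‖w⁻¹‖ ≤ 2 * C := by
        rw [norm_inv, inv_le_comm₀ (norm_pos_iff.2 hw0) (by positivity), ← one_div]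
        exact hwl
      apply hnear _ y hy
      have h3 : ‖w⁻¹ - u‖ ≤ η / 2 := by
        have e2 : w⁻¹ - u = -((w - u⁻¹) * (w⁻¹ * u)) := by field_simp; ring
        rw [e2, norm_neg, norm_mul, norm_mul]
        calc _ ≤ η / (4 * C ^ 2) * (2 * C * C) := by gcongr
          _ = η / 2 := by field_simp; norm_num
      have h4 : ‖w⁻¹ - y‖ ≤ ‖w⁻¹ - u‖ + ‖u - y‖ := by
        simpa using norm_add_le (w⁻¹ - u) (u - y)
      rw [hη] at h3
      have : 0 < (1 - ‖p⁻¹‖) * δ := hη0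
      linarith

/-! ### Contraction by words, after Earle and Hamilton -/

namespace IsContractive

variable {p : ℂ} {V : Set ℂ}

theorem step_mem (hV : IsContractive p V) {z : ℂ} (hz : z ∈ V) (b : Bool) : pStep p b z ∈ V := by
  obtain ⟨δ, hδ, h⟩ := hV.inside
  exact h z hz b _ (by simpa using hδ.le)

theorem ne_zero (hV : IsContractive p V) {z : ℂ} (hz : z ∈ V) : z ≠ 0 := by
  obtain ⟨ε, hε, h⟩ := hV.away
  rintro rfl
  simpa using hε.trans_le (h 0 hz)

theorem add_one_ne_zero (hV : IsContractive p V) {z : ℂ} (hz : z ∈ V) : z + 1 ≠ 0 := by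
  intro h0
  exact hV.ne_zero (hV.step_mem hz true) (by simp [pStep, h0])

theorem param_ne_zero (hV : IsContractive p V) : p ≠ 0 := by
  intro h0
  exact hV.ne_zero (hV.step_mem hV.fixedPoint_mem true) (by simp [pStep, h0])

theorem word_mem (hV : IsContractive p V) {z : ℂ} (hz : z ∈ V) (w : List Bool) :
    pWord p w z ∈ V := by
  induction w with
  | nil => exact hz
  | cons b w ih => exact hV.step_mem ih b

theorem word_sub_sq (hV : IsContractive p V) {z z' : ℂ} (hz : z ∈ V) (hz' : z' ∈ V)
    (w : List Bool) : (pWord p w z - pWord p w z') ^ 2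
      = pWordDeriv p w z * pWordDeriv p w z' * (z - z') ^ 2 := by
  induction w with
  | nil => simp [pWord, pWordDeriv]
  | cons b w ih =>
    simp only [pWord, pWordDeriv]
    rw [pStep_sub_sq hV.param_ne_zero b (hV.add_one_ne_zero (hV.word_mem hz w))
      (hV.add_one_ne_zero (hV.word_mem hz' w)), ih]
    ring

/-- Each word can be replaced by a self-map of `V` with the same value and a much larger
derivative at a given point. -/
theorem exists_selfMap (hV : IsContractive p V) : ∃ d > 0, ∀ z ∈ V, ∀ w : List Bool,
    ∃ G : ℂ → ℂ, Set.MapsTo G V V ∧ DifferentiableOn ℂ G V ∧ G z = pWord p w z ∧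
      HasDerivAt G ((1 + d : ℝ) ^ w.length * pWordDeriv p w z) z := by
  obtain ⟨B, hB, hVB⟩ := hV.bounded
  obtain ⟨δ, hδ, hVδ⟩ := hV.inside
  -- Two points of V differ by at most 2B, so adding d times the displacement of the image from its
  -- base value moves it by at most δ. This keeps the map inside V, preserves the base value and
  -- multiplies the derivative there by 1 + d.
  refine ⟨δ / (2 * B), by positivity, fun z hz w => ?_⟩
  set d := δ / (2 * B) with hd
  have hdB : d * (2 * B) = δ := by rw [hd]; field_simp
  have hd0 : 0 < d := by positivity
  induction w with
  | nil => exact ⟨id, Set.mapsTo_id V, differentiableOn_id, rfl, by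
      simpa [pWordDeriv] using hasDerivAt_id z⟩
  | cons b w ih =>
    obtain ⟨G, hG, hGd, hGz, hGz'⟩ := ih
    have hzw := hV.word_mem hz w
    have hF : ∀ u ∈ V, HasDerivAt (fun u => pStep p b u
        + (d : ℂ) * (pStep p b u - pStep p b (pWord p w z))) ((1 + d : ℝ) * pStepDeriv p b u) u := by
      intro u hu
      have h1 := hasDerivAt_pStep (p := p) b (hV.add_one_ne_zero hu)
      refine (h1.add ((h1.sub_const _).const_mul (d : ℂ))).congr_deriv ?_
      push_cast; ring
    refine ⟨fun u => pStep p b (G u) + (d : ℂ) * (pStep p b (G u) - pStep p b (pWord p w z)),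
      ?_, ?_, ?_, ?_⟩
    · intro u hu
      refine hVδ (G u) (hG hu) b _ ?_
      rw [add_sub_cancel_left, norm_mul, Complex.norm_real, Real.norm_of_nonneg hd0.le, ← hdB]
      refine mul_le_mul_of_nonneg_left ?_ hd0.le
      have h1 := hVB _ (hV.step_mem (hG hu) b)
      have h2 := hVB _ (hV.step_mem hzw b)
      have h3 := norm_sub_le (pStep p b (G u)) (pStep p b (pWord p w z))
      linarith
    · intro u hu
      exact ((hF _ (hG hu)).differentiableAt.comp_differentiableWithinAt u (hGd u hu))
    · simp [hGz, pWord]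
    · have h1 := hF (G z) (hG hz)
      refine (h1.comp z hGz').congr_deriv ?_
      rw [hGz, List.length_cons, pWordDeriv, pow_succ]
      push_cast; ring

/-- Cauchy's estimate for the amplified self-map of the bounded set V bounds (1+d)^length times the
derivative of the word. -/
theorem exists_deriv_bound (hV : IsContractive p V) : ∃ B > 0, ∃ k : ℝ, 0 < k ∧ k < 1 ∧
    ∀ z r, 0 < r → Metric.closedBall z r ⊆ V → ∀ w : List Bool,
      ‖pWordDeriv p w z‖ ≤ B / r * k ^ w.length := by
  obtain ⟨B, hB, hVB⟩ := hV.bounded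
  obtain ⟨d, hd, h⟩ := hV.exists_selfMap
  refine ⟨B, hB, (1 + d)⁻¹, by positivity, inv_lt_one_of_one_lt₀ (by linarith), ?_⟩
  intro z r hr hzr w
  obtain ⟨G, hG, hGd, -, hGz⟩ := h z (hzr (Metric.mem_closedBall_self hr.le)) w
  have h1 := Complex.norm_deriv_le_of_forall_mem_sphere_norm_le hr (hGd.diffContOnCl_ball hzr)
    (fun u hu => hVB _ (hG (hzr (Metric.sphere_subset_closedBall hu))))
  rw [hGz.deriv, norm_mul, norm_pow, Complex.norm_real, Real.norm_of_nonneg (by positivity)] at h1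
  rw [inv_pow, ← div_eq_mul_inv, le_div_iff₀ (by positivity), mul_comm]
  exact h1

/-- The innermost letter moves both points δ-deep into V, where the derivative bound is uniform.
`word_sub_sq` then compares them, wherever in V they lie. -/
theorem exists_diam_bound (hV : IsContractive p V) : ∃ C > 0, ∃ k : ℝ, 0 < k ∧ k < 1 ∧
    ∀ z ∈ V, ∀ z' ∈ V, ∀ w : List Bool, ‖pWord p w z - pWord p w z'‖ ≤ C * k ^ w.length := by
  obtain ⟨A, hA, hVA⟩ := hV.bounded
  obtain ⟨δ, hδ, hVδ⟩ := hV.inside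
  obtain ⟨B, hB, k, hk0, hk1, h⟩ := hV.exists_deriv_bound
  refine ⟨2 * A + B / δ * (2 * A) / k, by positivity, k, hk0, hk1, ?_⟩
  intro z hz z' hz' w
  have hsub : ∀ u ∈ V, ∀ u' ∈ V, ‖u - u'‖ ≤ 2 * A := fun u hu u' hu' =>
    (norm_sub_le u u').trans (by linarith [hVA u hu, hVA u' hu'])
  rcases List.eq_nil_or_concat w with rfl | ⟨w, b, rfl⟩
  · have := hsub z hz z' hz'
    simp only [pWord, List.length_nil, pow_zero, mul_one]
    have : 0 ≤ B / δ * (2 * A) / k := by positivity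
    linarith
  · rw [List.concat_eq_append, pWord_append, pWord_append, List.length_append, List.length_singleton]
    simp only [pWord]
    have hball : ∀ u ∈ V, Metric.closedBall (pStep p b u) δ ⊆ V := fun u hu v hv =>
      hVδ u hu b v (by rwa [Metric.mem_closedBall, dist_eq_norm] at hv)
    have h1 := h _ δ hδ (hball z hz) w
    have h2 := h _ δ hδ (hball z' hz') w
    have h3 := hsub _ (hV.step_mem hz b) _ (hV.step_mem hz' b)
    have h4 := congrArg norm (hV.word_sub_sq (hV.step_mem hz b) (hV.step_mem hz' b) w)
    rw [norm_pow, norm_mul, norm_mul, norm_pow] at h4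
    have h5 : ‖pWord p w (pStep p b z) - pWord p w (pStep p b z')‖ ≤
        B / δ * k ^ w.length * (2 * A) := by
      refine le_of_sq_le_sq ?_ (by positivity)
      rw [h4]
      calc _ ≤ (B / δ * k ^ w.length) * (B / δ * k ^ w.length) * (2 * A) ^ 2 := by gcongr
        _ = _ := by ring
    refine h5.trans ?_
    rw [pow_succ, add_mul]
    have : B / δ * k ^ w.length * (2 * A) = B / δ * (2 * A) / k * (k ^ w.length * k) := by
      field_simp
    rw [this]
    have : 0 ≤ 2 * A * (k ^ w.length * k) := by positivity
    linarith

end IsContractive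

/-! ### Continuity from the Farey coding of `[0, ∞]` -/

/-- The two generators of the tree on `[0, ∞]`. -/
noncomputable def fareyStep : Bool → ENNReal → ENNReal
  | true, x => x + 1
  | false, x => (x + 1)⁻¹

/-- Compositions of the maps `fareyStep`. -/
noncomputable def fareyWord : List Bool → ENNReal → ENNReal
  | [], x => x
  | b :: w, x => fareyStep b (fareyWord w x)

theorem continuous_fareyWord (w : List Bool) : Continuous (fareyWord w) := by
  induction w with
  | nil => exact continuous_id
  | cons b w ih =>
    have h : Continuous fun x => fareyWord w x + 1 := ih.add continuous_const
    cases b with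
    | true => exact h
    | false => exact h.inv

theorem exists_fareyStep (x : ENNReal) : ∃ b y, fareyStep b y = x := by
  rcases le_total 1 x with h | h
  · exact ⟨true, x - 1, tsub_add_cancel_of_le h⟩
  · refine ⟨false, x⁻¹ - 1, ?_⟩
    change (x⁻¹ - 1 + 1)⁻¹ = x
    rw [tsub_add_cancel_of_le (ENNReal.one_le_inv.2 h), inv_inv]

theorem exists_fareyWord (n : ℕ) (x : ENNReal) : ∃ w y, w.length = n ∧ fareyWord w y = x := by
  induction n generalizing x with
  | zero => exact ⟨[], x, rfl, rfl⟩
  | succ n ih =>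
    obtain ⟨b, y, rfl⟩ := exists_fareyStep x
    obtain ⟨w, z, hw, rfl⟩ := ih y
    exact ⟨b :: w, z, by simp [hw], rfl⟩

/-- There are finitely many words of length n and their ranges are compact. Discarding those that
miss x leaves a neighbourhood of x each of whose points shares a piece with x. -/
theorem continuous_of_fareyWord {E : Type*} [PseudoMetricSpace E] {f : ENNReal → E} {c : ℕ → ℝ}
    (hc : Filter.Tendsto c Filter.atTop (nhds 0))
    (h : ∀ w x y, dist (f (fareyWord w x)) (f (fareyWord w y)) ≤ c w.length) : Continuous f := by
  rw [continuous_iff_continuousAt]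
  intro x
  rw [ContinuousAt, Metric.tendsto_nhds]
  intro ε hε
  obtain ⟨n, hn⟩ := (hc.eventually (gt_mem_nhds hε)).exists
  have hfin : {w : List Bool | w.length = n ∧ x ∉ Set.range (fareyWord w)}.Finite :=
    (List.finite_length_eq Bool n).subset fun w hw => hw.1
  have hcl : IsClosed (⋃ w ∈ {w : List Bool | w.length = n ∧ x ∉ Set.range (fareyWord w)},
      Set.range (fareyWord w)) :=
    hfin.isClosed_biUnion fun w _ => (isCompact_range (continuous_fareyWord w)).isClosed
  have hx : x ∈ (⋃ w ∈ {w : List Bool | w.length = n ∧ x ∉ Set.range (fareyWord w)},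
      Set.range (fareyWord w))ᶜ := by
    intro hx
    obtain ⟨w, hw, hxw⟩ := Set.mem_iUnion₂.1 hx
    exact hw.2 hxw
  filter_upwards [hcl.isOpen_compl.mem_nhds hx] with y hy
  obtain ⟨w, z, hw, rfl⟩ := exists_fareyWord n y
  by_cases hxw : x ∈ Set.range (fareyWord w)
  · obtain ⟨x', rfl⟩ := hxw
    refine (h w z x').trans_lt ?_
    rwa [hw]
  · exact (hy (Set.mem_biUnion (x := w) (And.intro hw hxw) (Set.mem_range_self z))).elim

/-! ### Convergents -/

theorem nonneg_induction {P : ℝ → Prop} (h0 : ∀ x, 0 ≤ x → x < 1 → P x)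
    (h1 : ∀ x, 0 ≤ x → P x → P (x + 1)) (x : ℝ) (hx : 0 ≤ x) : P x := by
  obtain ⟨n, hn⟩ := exists_nat_gt x
  induction n generalizing x with
  | zero => simp at hn; linarith
  | succ n ih =>
    rcases lt_or_ge x 1 with h | h
    · exact h0 x hx h
    · have := h1 (x - 1) (by linarith) (ih (x - 1) (by linarith) (by push_cast at hn; linarith))
      simpa using this

theorem pConvergent_add_one {p : ℂ} (hp : p ≠ 0) (n : ℕ) {x : ℝ} (hx : 0 ≤ x) :
    pConvergent p n (x + 1) = (pConvergent p n x + 1) / p := by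
  have hW : ∀ a, pW p (a + 1) = (pW p a + 1) / p := by
    intro a
    rw [pW, pW, Finset.sum_range_succ']
    simp only [pow_succ _ (_ + 1), mul_inv, zero_add, pow_one, ← Finset.sum_mul]
    field_simp
  have h1 : ⌊x + 1⌋₊ = ⌊x⌋₊ + 1 := Nat.floor_add_one hx
  cases n with
  | zero =>
    simp only [pConvergent, h1, hW, pow_succ, mul_inv]
    field_simp
    ring
  | succ n =>
    simp only [pConvergent, h1, hW, pow_succ, mul_inv, Int.fract_add_one]
    field_simp
    ring

theorem pConvergent_zero_of_lt_one (p : ℂ) {x : ℝ} (h1 : x < 1) :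
    pConvergent p 0 x = p - 1 := by
  simp [pConvergent, Nat.floor_eq_zero.2 h1, pW]

theorem pConvergent_zero_right (p : ℂ) (n : ℕ) : pConvergent p n 0 = p - 1 := by
  cases n <;> simp [pConvergent, pW]

theorem pX_zero (p : ℂ) : pX p 0 = p - 1 := by
  have h : (fun n => pConvergent p n 0) = fun _ => p - 1 := funext (pConvergent_zero_right p)
  rw [pX, h]
  exact tendsto_const_nhds.limUnder_eq

theorem pConvergent_succ_of_lt_one (p : ℂ) (n : ℕ) {x : ℝ} (h0 : 0 < x) (h1 : x < 1) :
    pConvergent p (n + 1) x = (pConvergent p n x⁻¹)⁻¹ := by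
  simp [pConvergent, Nat.floor_eq_zero.2 h1, pW, Int.fract_eq_self.2 ⟨h0.le, h1⟩, h0.ne']

namespace IsContractive

variable {p : ℂ} {V : Set ℂ}

theorem sub_one_mem (hV : IsContractive p V) : p - 1 ∈ V := by
  simpa using hV.inv_mem _ hV.fixedPoint_mem

theorem pConvergent_mem (hV : IsContractive p V) (n : ℕ) {x : ℝ} (hx : 0 ≤ x) :
    pConvergent p n x ∈ V := by
  induction n generalizing x with
  | zero =>
    refine nonneg_induction (P := fun x => pConvergent p 0 x ∈ V) (fun x _ h1 => ?_) (fun x hx h => ?_) x hx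
    · rw [pConvergent_zero_of_lt_one p h1]; exact hV.sub_one_mem
    · rw [pConvergent_add_one hV.param_ne_zero _ hx]; exact hV.step_mem h true
  | succ n ih =>
    refine nonneg_induction (P := fun x => pConvergent p (n + 1) x ∈ V) (fun x h0 h1 => ?_) (fun x hx h => ?_) x hx
    · rcases h0.eq_or_lt with rfl | h0
      · rw [pConvergent_zero_right]; exact hV.sub_one_mem
      · rw [pConvergent_succ_of_lt_one p n h0 h1]
        exact hV.inv_mem _ (ih (inv_nonneg.2 h0.le))
    · rw [pConvergent_add_one hV.param_ne_zero _ hx]; exact hV.step_mem h true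

end IsContractive

/-! ### Convergence of the convergents and the functional equations of X_p -/

/-- Two points are equal or lie in the same piece of level `n`. -/
def WordClose (p : ℂ) (V : Set ℂ) (n : ℕ) (z z' : ℂ) : Prop :=
  z = z' ∨ ∃ w : List Bool, w.length = n ∧ ∃ y ∈ V, ∃ y' ∈ V, z = pWord p w y ∧ z' = pWord p w y'

namespace WordClose

variable {p : ℂ} {V : Set ℂ} {n : ℕ} {z z' : ℂ}

theorem step (h : WordClose p V n z z') (b : Bool) :
    WordClose p V (n + 1) (pStep p b z) (pStep p b z') := by
  rcases h with rfl | ⟨w, hw, y, hy, y', hy', rfl, rfl⟩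
  · exact Or.inl rfl
  · exact Or.inr ⟨b :: w, by simp [hw], y, hy, y', hy', rfl, rfl⟩

theorem of_succ (hV : IsContractive p V) (h : WordClose p V (n + 1) z z') :
    WordClose p V n z z' := by
  rcases h with rfl | ⟨w, hw, y, hy, y', hy', rfl, rfl⟩
  · exact Or.inl rfl
  · rcases List.eq_nil_or_concat w with rfl | ⟨w, b, rfl⟩
    · simp at hw
    · rw [List.concat_eq_append] at *
      refine Or.inr ⟨w, by simpa using hw, pStep p b y, hV.step_mem hy b, pStep p b y',
        hV.step_mem hy' b, ?_, ?_⟩ <;> rw [pWord_append] <;> rfl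

theorem inv (hV : IsContractive p V) (h : WordClose p V n z z') :
    WordClose p V n z⁻¹ z'⁻¹ := by
  rcases h with rfl | ⟨w, hw, y, hy, y', hy', rfl, rfl⟩
  · exact Or.inl rfl
  · cases w with
    | nil => exact Or.inr ⟨[], hw, y⁻¹, hV.inv_mem y hy, y'⁻¹, hV.inv_mem y' hy', rfl, rfl⟩
    | cons b w =>
      exact Or.inr ⟨(!b) :: w, by simpa using hw, y, hy, y', hy', pStep_inv p b _, pStep_inv p b _⟩

end WordClose

namespace IsContractive

variable {p : ℂ} {V : Set ℂ}

/-- Each inversion in the expansion uses up one index of the convergent but leads to an argument at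
least 1, where a T is available to gain a level. Inversion itself loses no level, since it exchanges
T and 1/T in the outermost letter. -/
theorem wordClose_pConvergent (hV : IsContractive p V) (N : ℕ) {x : ℝ} (hx : 0 ≤ x) {n m : ℕ}
    (hn : N + 1 ≤ n) (hm : N + 1 ≤ m) :
    WordClose p V N (pConvergent p n x) (pConvergent p m x) := by
  have hp := hV.param_ne_zero
  have main : ∀ N, (∀ x : ℝ, 1 ≤ x → ∀ n m : ℕ, N ≤ n → N ≤ m →
      WordClose p V N (pConvergent p n x) (pConvergent p m x)) →
      ∀ x : ℝ, 0 ≤ x → ∀ n m : ℕ, N + 1 ≤ n → N + 1 ≤ m →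
      WordClose p V N (pConvergent p n x) (pConvergent p m x) := by
    intro N hA
    refine nonneg_induction ?_ ?_
    · intro x h0 h1 n m hn hm
      obtain ⟨n, rfl⟩ := Nat.exists_eq_add_of_le' (Nat.one_le_of_lt hn)
      obtain ⟨m, rfl⟩ := Nat.exists_eq_add_of_le' (Nat.one_le_of_lt hm)
      rcases h0.eq_or_lt with rfl | h0
      · left; simp only [pConvergent_zero_right]
      · rw [pConvergent_succ_of_lt_one p _ h0 h1, pConvergent_succ_of_lt_one p _ h0 h1]
        exact (hA x⁻¹ ((one_le_inv₀ h0).2 h1.le) n m (by omega) (by omega)).inv hV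
    · intro x hx ih n m hn hm
      rw [pConvergent_add_one hp _ hx, pConvergent_add_one hp _ hx]
      exact ((ih n m hn hm).step true).of_succ hV
  have hA : ∀ N, ∀ x : ℝ, 1 ≤ x → ∀ n m : ℕ, N ≤ n → N ≤ m →
      WordClose p V N (pConvergent p n x) (pConvergent p m x) := by
    intro N
    induction N with
    | zero =>
      intro x hx n m _ _
      exact Or.inr ⟨[], rfl, _, hV.pConvergent_mem n (by linarith), _,
        hV.pConvergent_mem m (by linarith), rfl, rfl⟩
    | succ N ih =>
      intro x hx n m hn hm
      have := (main N ih (x - 1) (by linarith) n m hn hm).step true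
      simp only [pStep] at this
      rw [← pConvergent_add_one hp _ (by linarith), ← pConvergent_add_one hp _ (by linarith),
        sub_add_cancel] at this
      exact this
  exact main N (hA N) x hx n m hn hm

theorem tendsto_pConvergent (hV : IsContractive p V) {x : ℝ} (hx : 0 ≤ x) :
    Filter.Tendsto (fun n => pConvergent p n x) Filter.atTop (nhds (pX p x)) := by
  obtain ⟨C, hC, k, hk0, hk1, h⟩ := hV.exists_diam_bound
  have hlim : Filter.Tendsto (fun N => C * k ^ N) Filter.atTop (nhds 0) := by
    simpa using (tendsto_pow_atTop_nhds_zero_of_lt_one hk0.le hk1).const_mul C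
  have hcau : CauchySeq fun n => pConvergent p n x := by
    rw [Metric.cauchySeq_iff]
    intro ε hε
    obtain ⟨N, hN⟩ := (hlim.eventually (gt_mem_nhds hε)).exists
    refine ⟨N + 1, fun m hm n hn => ?_⟩
    rcases hV.wordClose_pConvergent N hx hm hn with e | ⟨w, hw, y, hy, y', hy', e, e'⟩
    · rw [e, dist_self]; exact hε
    · rw [e, e', dist_eq_norm]
      exact (h y hy y' hy' w).trans_lt (by rwa [hw])
  exact hcau.tendsto_limUnder

theorem pX_add_one (hV : IsContractive p V) {x : ℝ} (hx : 0 ≤ x) :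
    pX p (x + 1) = (pX p x + 1) / p := by
  refine tendsto_nhds_unique (hV.tendsto_pConvergent (by linarith)) ?_
  exact (((hV.tendsto_pConvergent hx).add_const 1).div_const p).congr fun n =>
    (pConvergent_add_one hV.param_ne_zero n hx).symm

theorem pX_mem_closure (hV : IsContractive p V) {x : ℝ} (hx : 0 ≤ x) : pX p x ∈ closure V :=
  mem_closure_of_tendsto (hV.tendsto_pConvergent hx)
    (Filter.Eventually.of_forall fun n => hV.pConvergent_mem n hx)

theorem pX_ne_zero (hV : IsContractive p V) {x : ℝ} (hx : 0 ≤ x) : pX p x ≠ 0 := by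
  obtain ⟨ε, hε, h⟩ := hV.away
  intro h0
  have hcl : IsClosed {z : ℂ | ε ≤ ‖z‖} := isClosed_le continuous_const continuous_norm
  have h1 : ε ≤ ‖pX p x‖ := closure_minimal (s := V) h hcl (hV.pX_mem_closure hx)
  rw [h0, norm_zero] at h1
  linarith

theorem pX_inv_of_lt_one (hV : IsContractive p V) {x : ℝ} (h0 : 0 < x) (h1 : x < 1) :
    pX p x = (pX p x⁻¹)⁻¹ := by
  refine tendsto_nhds_unique
    ((hV.tendsto_pConvergent h0.le).comp (Filter.tendsto_add_atTop_nat 1)) ?_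
  have := (hV.tendsto_pConvergent (inv_nonneg.2 h0.le)).inv₀ (hV.pX_ne_zero (inv_nonneg.2 h0.le))
  refine this.congr fun n => ?_
  exact (pConvergent_succ_of_lt_one p n h0 h1).symm

theorem pX_inv (hV : IsContractive p V) {x : ℝ} (h0 : 0 < x) : pX p x⁻¹ = (pX p x)⁻¹ := by
  rcases lt_trichotomy x 1 with h | rfl | h
  · rw [hV.pX_inv_of_lt_one h0 h, inv_inv]
  · have : pX p 1 = 1 := by
      have := hV.pX_add_one le_rfl
      rwa [zero_add, pX_zero, sub_add_cancel, div_self hV.param_ne_zero] at this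
    simp [this]
  · rw [hV.pX_inv_of_lt_one (inv_pos.2 h0) (inv_lt_one_of_one_lt₀ h), inv_inv]

/-- Limits of convergents lie only in the closure of V. For x ≥ 1 the value is T of such a limit,
hence well inside V; inversion handles 0 < x < 1. -/
theorem pX_mem (hV : IsContractive p V) {x : ℝ} (hx : 0 ≤ x) : pX p x ∈ V := by
  have key : ∀ x : ℝ, 1 ≤ x → pX p x ∈ V := by
    intro x hx
    obtain ⟨δ, hδ, h⟩ := hV.inside
    have hp := hV.param_ne_zero
    have h2 := Metric.mem_closure_iff.1 (hV.pX_mem_closure (by linarith : 0 ≤ x - 1)) (δ * ‖p‖)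
      (mul_pos hδ (norm_pos_iff.2 hp))
    obtain ⟨v, hv, hd⟩ := h2
    have h3 := hV.pX_add_one (by linarith : 0 ≤ x - 1)
    rw [sub_add_cancel] at h3
    refine h v hv true _ ?_
    rw [h3, pStep, show (pX p (x - 1) + 1) / p - (v + 1) / p = (pX p (x - 1) - v) / p by ring,
      norm_div, div_le_iff₀ (norm_pos_iff.2 hp), ← dist_eq_norm]
    exact hd.le
  rcases lt_or_ge x 1 with h1 | h1
  · rcases hx.eq_or_lt with rfl | h0
    · rw [pX_zero]; exact hV.sub_one_mem
    · rw [hV.pX_inv_of_lt_one h0 h1]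
      exact hV.inv_mem _ (key _ ((one_le_inv₀ h0).2 h1.le))
  · exact key x h1

end IsContractive

/-! ### The curve -/

/-- The properties of the function `X(p, ·)` and of the curve `I_p` on which the theory of the
generating function rests. -/
structure IsRegularCurve (p : ℂ) : Prop where
  param_ne_zero : p ≠ 0
  pX_add_one : ∀ x, 0 ≤ x → pX p (x + 1) = (pX p x + 1) / p
  pX_inv : ∀ x, 0 < x → pX p x⁻¹ = (pX p x)⁻¹
  continuousOn : ContinuousOn (pX p) (Set.Ici 0)
  isClosed : IsClosed (pCurve p)
  neg_one_notMem : -1 ∉ pCurve p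

/-- The extension of `X(p, ·)` to `[0, ∞]`. -/
noncomputable def pXExt (p : ℂ) (x : ENNReal) : ℂ := if x = ⊤ then (p - 1)⁻¹ else pX p x.toReal

namespace IsContractive

variable {p : ℂ} {V : Set ℂ}

theorem pXExt_fareyStep (hV : IsContractive p V) (h1 : p ≠ 1) (b : Bool) (x : ENNReal) :
    pXExt p (fareyStep b x) = pStep p b (pXExt p x) := by
  have hp := hV.param_ne_zero
  have h1' : p - 1 ≠ 0 := sub_ne_zero.2 h1
  have hfix : ((p - 1)⁻¹ + 1) / p = (p - 1)⁻¹ := by field_simp; ring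
  by_cases hx : x = ⊤
  · subst hx
    cases b with
    | true => simp [fareyStep, pXExt, pStep, hfix]
    | false =>
      have : pStep p false (p - 1)⁻¹ = p - 1 := by
        rw [pStep, ← inv_div, hfix, inv_inv]
      simp [fareyStep, pXExt, this, pX_zero]
  · have hx1 : x + 1 ≠ ⊤ := ENNReal.add_ne_top.2 ⟨hx, ENNReal.one_ne_top⟩
    have hr : (x + 1).toReal = x.toReal + 1 := by
      rw [ENNReal.toReal_add hx ENNReal.one_ne_top, ENNReal.toReal_one]
    have hx0 := ENNReal.toReal_nonneg (a := x)
    cases b with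
    | true =>
      simp only [fareyStep, pXExt, pStep, if_neg hx, if_neg hx1, hr, hV.pX_add_one hx0]
    | false =>
      have hx2 : (x + 1)⁻¹ ≠ ⊤ := by simp
      simp only [fareyStep, pXExt, pStep, if_neg hx, if_neg hx2, ENNReal.toReal_inv, hr]
      rw [hV.pX_inv (by positivity), hV.pX_add_one hx0, inv_div]

theorem pXExt_mem (hV : IsContractive p V) (x : ENNReal) : pXExt p x ∈ V := by
  unfold pXExt
  split_ifs
  · exact hV.fixedPoint_mem
  · exact hV.pX_mem ENNReal.toReal_nonneg

theorem pXExt_fareyWord (hV : IsContractive p V) (h1 : p ≠ 1) (w : List Bool) (x : ENNReal) :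
    pXExt p (fareyWord w x) = pWord p w (pXExt p x) := by
  induction w with
  | nil => rfl
  | cons b w ih => rw [fareyWord, pWord, hV.pXExt_fareyStep h1, ih]

/-- X_p carries Farey pieces to word pieces, and these shrink geometrically in the length of the
word. -/
theorem continuous_pXExt (hV : IsContractive p V) (h1 : p ≠ 1) : Continuous (pXExt p) := by
  obtain ⟨C, hC, k, hk0, hk1, h⟩ := hV.exists_diam_bound
  have hlim : Filter.Tendsto (fun N => C * k ^ N) Filter.atTop (nhds 0) := by
    simpa using (tendsto_pow_atTop_nhds_zero_of_lt_one hk0.le hk1).const_mul C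
  refine continuous_of_fareyWord hlim fun w x y => ?_
  rw [hV.pXExt_fareyWord h1, hV.pXExt_fareyWord h1, dist_eq_norm]
  exact h _ (hV.pXExt_mem x) _ (hV.pXExt_mem y) w

theorem pCurve_eq (h1 : p ≠ 1) : pCurve p = Set.range (pXExt p) := by
  ext z
  constructor
  · rintro (⟨x, hx, rfl⟩ | ⟨-, rfl⟩)
    · exact ⟨ENNReal.ofReal x, by simp [pXExt, ENNReal.toReal_ofReal hx]⟩
    · exact ⟨⊤, by simp [pXExt]⟩
  · rintro ⟨x, rfl⟩
    by_cases hx : x = ⊤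
    · right; simp [pXExt, hx, h1]
    · left; exact ⟨x.toReal, ENNReal.toReal_nonneg, by simp [pXExt, hx]⟩

theorem pCurve_subset (hV : IsContractive p V) (h1 : p ≠ 1) : pCurve p ⊆ V := by
  rw [pCurve_eq h1]
  rintro _ ⟨x, rfl⟩
  exact hV.pXExt_mem x

theorem isCompact_pCurve (hV : IsContractive p V) (h1 : p ≠ 1) : IsCompact (pCurve p) := by
  rw [pCurve_eq h1]
  exact isCompact_range (hV.continuous_pXExt h1)

theorem isRegularCurve (hV : IsContractive p V) (h1 : p ≠ 1) : IsRegularCurve p where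
  param_ne_zero := hV.param_ne_zero
  pX_add_one _ := hV.pX_add_one
  pX_inv _ := hV.pX_inv
  continuousOn := by
    have : ContinuousOn (fun x => pXExt p (ENNReal.ofReal x)) (Set.Ici 0) :=
      ((hV.continuous_pXExt h1).comp ENNReal.continuous_ofReal).continuousOn
    refine this.congr fun x hx => ?_
    simp [pXExt, ENNReal.toReal_ofReal (Set.mem_Ici.1 hx)]
  isClosed := (hV.isCompact_pCurve h1).isClosed
  neg_one_notMem h := hV.add_one_ne_zero (hV.pCurve_subset h1 h) (by simp)

end IsContractive

/-! ### The case `p = 1` -/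

/-- The convergents of a continued fraction. -/
noncomputable def fractionConvergent : ℕ → ℝ → ℝ
  | 0, x => ⌊x⌋₊
  | n + 1, x => ⌊x⌋₊ + if Int.fract x = 0 then 0 else (fractionConvergent n (Int.fract x)⁻¹)⁻¹

theorem pConvergent_one (n : ℕ) (x : ℝ) : pConvergent 1 n x = fractionConvergent n x := by
  induction n generalizing x with
  | zero => simp [pConvergent, fractionConvergent, pW]
  | succ n ih =>
    simp only [pConvergent, fractionConvergent, pW, ih]
    split_ifs <;> simp

theorem one_le_fractionConvergent (n : ℕ) {x : ℝ} (hx : 1 ≤ x) : 1 ≤ fractionConvergent n x := by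
  have h1 : (1 : ℝ) ≤ ⌊x⌋₊ := by exact_mod_cast Nat.le_floor (by simpa using hx)
  induction n generalizing x with
  | zero => exact h1
  | succ n ih =>
    rw [fractionConvergent]
    split_ifs with hf
    · simpa using h1
    · have hy := (one_lt_inv_fract hf).le
      have := ih hy (by exact_mod_cast Nat.le_floor (by simpa using hy))
      have : 0 ≤ (fractionConvergent n (Int.fract x)⁻¹)⁻¹ := by positivity
      linarith

theorem eq_floor_add_inv {x : ℝ} (hx : 0 ≤ x) : x = ⌊x⌋₊ + ((Int.fract x)⁻¹)⁻¹ := by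
  rw [inv_inv, natCast_floor_eq_intCast_floor hx, Int.floor_add_fract]

/-- Taking reciprocals divides the error by c·y. Over two levels the divisor is (c'c)(y'y) ≥ 4,
because a complete quotient times the next one is at least 2, and likewise for convergents. One
level alone gives no uniform gain. -/
theorem abs_fractionConvergent_sub_le (n : ℕ) : ∀ x : ℝ, 1 ≤ x →
    |fractionConvergent n x - x| ≤ 2 * (1 / 2) ^ n := by
  have step : ∀ c y : ℝ, 1 ≤ c → 1 ≤ y → |c⁻¹ - y⁻¹| = |c - y| / (c * y) := by
    intro c y hc hy
    rw [show c⁻¹ - y⁻¹ = (y - c) / (c * y) by field_simp, abs_div, abs_sub_comm,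
      abs_of_pos (by positivity : 0 < c * y)]
  induction n using Nat.twoStepInduction with
  | zero =>
    intro x hx
    have h1 := Nat.floor_le (by linarith : 0 ≤ x)
    have h2 := Nat.lt_floor_add_one x
    rw [fractionConvergent, abs_le]
    constructor <;> norm_num <;> linarith
  | one =>
    intro x hx
    have h1 := Nat.floor_le (by linarith : 0 ≤ x)
    have h2 := Nat.lt_floor_add_one x
    rw [fractionConvergent]
    split_ifs with hf
    · rw [abs_le]; constructor <;> norm_num <;> linarith
    · have hy := one_lt_inv_fract hf
      have hc := inv_le_one_of_one_le₀ (one_le_fractionConvergent 0 hy.le)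
      have hc0 := inv_nonneg.2 (zero_le_one.trans (one_le_fractionConvergent 0 hy.le))
      rw [abs_le]; constructor <;> norm_num <;> linarith
  | more n ih _ =>
    intro x hx
    rw [fractionConvergent]
    have ex := eq_floor_add_inv (by linarith : 0 ≤ x)
    split_ifs with hf
    · rw [hf, inv_inv] at ex
      rw [← ex, sub_self, abs_zero]
      positivity
    · rw [show ∀ c : ℝ, ⌊x⌋₊ + c - x = c - ((Int.fract x)⁻¹)⁻¹ from fun c => by linarith]
      have hy := (one_lt_inv_fract hf).le
      set y := (Int.fract x)⁻¹
      have hc := one_le_fractionConvergent (n + 1) hy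
      rw [step _ _ hc hy]
      have hfl : (1 : ℝ) ≤ ⌊y⌋₊ := by exact_mod_cast Nat.le_floor (by simpa using hy)
      by_cases hf' : Int.fract y = 0
      · have e : fractionConvergent (n + 1) y - y = 0 := by
          nth_rewrite 2 [eq_floor_add_inv (by linarith : 0 ≤ y)]
          simp [fractionConvergent, hf']
        rw [e, abs_zero, zero_div]; positivity
      · have hy' := (one_lt_inv_fract hf').le
        have ey := eq_floor_add_inv (by linarith : 0 ≤ y)
        have ec : fractionConvergent (n + 1) y
            = ⌊y⌋₊ + (fractionConvergent n (Int.fract y)⁻¹)⁻¹ := by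
          rw [fractionConvergent, if_neg hf']
        have hc' := one_le_fractionConvergent n hy'
        have ih' := ih _ hy'
        set y' := (Int.fract y)⁻¹
        set c' := fractionConvergent n y'
        set c := fractionConvergent (n + 1) y
        have e1 : |c - y| = |c' - y'| / (c' * y') := by
          rw [← step _ _ hc' hy', ec]
          nth_rewrite 2 [ey]
          rw [add_sub_add_left_eq_sub]
        rw [e1, div_div]
        have h3 : 2 ≤ c' * c := by
          rw [ec, mul_add, mul_inv_cancel₀ (by linarith)]; nlinarith
        have h4 : 2 ≤ y' * y := by
          have h5 : y' * y = y' * ⌊y⌋₊ + 1 := by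
            rw [← mul_inv_cancel₀ (by linarith : y' ≠ 0), ← mul_add, ← ey]
          nlinarith
        rw [div_le_iff₀ (by positivity)]
        have h5 : 4 ≤ c' * y' * (c * y) := by nlinarith
        have h6 : (1 / 2 : ℝ) ^ (n + 1 + 1) = (1 / 2) ^ n / 4 := by ring
        rw [h6]
        have : (0 : ℝ) < (1 / 2) ^ n := by positivity
        nlinarith

theorem pX_one {x : ℝ} (hx : 0 ≤ x) : pX 1 x = x := by
  have hreal : Filter.Tendsto (fun n => fractionConvergent (n + 1) x) Filter.atTop (nhds x) := by
    by_cases hf : Int.fract x = 0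
    · refine tendsto_const_nhds.congr fun n => ?_
      nth_rewrite 1 [eq_floor_add_inv hx]
      simp [fractionConvergent, hf]
    · have hy := (one_lt_inv_fract hf).le
      have h0 : Filter.Tendsto (fun n : ℕ => 2 * (1 / 2 : ℝ) ^ n) Filter.atTop (nhds 0) := by
        simpa using (tendsto_pow_atTop_nhds_zero_of_lt_one (r := (1 / 2 : ℝ)) (by norm_num)
          (by norm_num)).const_mul 2
      have h1 : Filter.Tendsto (fun n => fractionConvergent n (Int.fract x)⁻¹) Filter.atTop
          (nhds (Int.fract x)⁻¹) :=
        tendsto_iff_norm_sub_tendsto_zero.2 (squeeze_zero (fun _ => norm_nonneg _)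
          (fun n => abs_fractionConvergent_sub_le n _ hy) h0)
      have h2 := (h1.inv₀ (by linarith)).const_add (⌊x⌋₊ : ℝ)
      rw [← eq_floor_add_inv hx] at h2
      refine h2.congr fun n => ?_
      rw [fractionConvergent, if_neg hf]
  refine Filter.Tendsto.limUnder_eq ?_
  rw [← Filter.tendsto_add_atTop_iff_nat 1]
  simp only [pConvergent_one]
  exact (Complex.continuous_ofReal.tendsto x).comp hreal

theorem pCurve_one : pCurve 1 = (fun x : ℝ => (x : ℂ)) '' Set.Ici 0 := by
  have : {w : ℂ | (1 : ℂ) ≠ 1 ∧ w = (1 - 1)⁻¹} = ∅ := by simp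
  rw [pCurve, this, Set.union_empty]
  exact Set.image_congr fun x hx => pX_one hx

theorem isRegularCurve_one : IsRegularCurve 1 where
  param_ne_zero := one_ne_zero
  pX_add_one x hx := by rw [pX_one hx, pX_one (by linarith)]; simp
  pX_inv x hx := by rw [pX_one hx.le, pX_one (by positivity)]; simp
  continuousOn := Complex.continuous_ofReal.continuousOn.congr fun x hx => pX_one hx
  isClosed := by
    rw [pCurve_one]
    exact Complex.isometry_ofReal.isClosedEmbedding.isClosedMap _ isClosed_Ici
  neg_one_notMem := by
    rw [pCurve_one]
    rintro ⟨x, hx, h⟩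
    have : x = -1 := Complex.ofReal_injective (by simpa using h)
    have : (0 : ℝ) ≤ x := hx
    linarith

theorem isRegularCurve {p : ℂ} (hp : ‖p - 2‖ ≤ 1 ∨ (1 ≤ p.re ∧ p.im = 0)) : IsRegularCurve p := by
  by_cases h1 : p = 1
  · rw [h1]; exact isRegularCurve_one
  · obtain ⟨R, hR⟩ := exists_region hp h1
    obtain ⟨V, hV⟩ := hR.exists_isContractive (one_lt_norm_of_mem hp h1)
    exact hV.isRegularCurve h1

/-! ### The measure `dF` -/

/-- The extension of the question mark function to `[0, ∞]`. -/
noncomputable def questionMarkExt (x : ENNReal) : ℝ := if x = ⊤ then 1 else questionMark x.toReal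

theorem questionMarkExt_of_ne_top {x : ENNReal} (hx : x ≠ ⊤) :
    questionMarkExt x = questionMark x.toReal := if_neg hx

theorem questionMark_add_one {x : ℝ} (hx : 0 ≤ x) :
    questionMark (x + 1) = (questionMark x + 1) / 2 := by
  rw [questionMark_of_one_le (by linarith), add_sub_cancel_right]

theorem questionMarkExt_fareyStep_sub (b : Bool) (x y : ENNReal) :
    |questionMarkExt (fareyStep b x) - questionMarkExt (fareyStep b y)|
      = |questionMarkExt x - questionMarkExt y| / 2 := by
  have ht : ∀ x, questionMarkExt (fareyStep true x) = (questionMarkExt x + 1) / 2 := by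
    intro x
    by_cases hx : x = ⊤
    · simp [hx, fareyStep, questionMarkExt]
    · have hx1 : x + 1 ≠ ⊤ := ENNReal.add_ne_top.2 ⟨hx, ENNReal.one_ne_top⟩
      change questionMarkExt (x + 1) = _
      rw [questionMarkExt_of_ne_top hx, questionMarkExt_of_ne_top hx1, ENNReal.toReal_add hx ENNReal.one_ne_top, ENNReal.toReal_one,
        questionMark_add_one ENNReal.toReal_nonneg]
  have hf : ∀ x, questionMarkExt (fareyStep false x) = (1 - questionMarkExt x) / 2 := by
    intro x
    by_cases hx : x = ⊤
    · simp [hx, fareyStep, questionMarkExt, questionMark_zero]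
    · have hx2 : (x + 1)⁻¹ ≠ ⊤ := by simp
      change questionMarkExt (x + 1)⁻¹ = _
      rw [questionMarkExt_of_ne_top hx, questionMarkExt_of_ne_top hx2]
      have h0 := ENNReal.toReal_nonneg (a := x)
      rw [ENNReal.toReal_inv, ENNReal.toReal_add hx ENNReal.one_ne_top, ENNReal.toReal_one]
      have h1 := questionMark_add_inv (by positivity : 0 < x.toReal + 1)
      rw [questionMark_add_one h0] at h1
      linarith
  cases b with
  | true =>
    rw [ht, ht, ← sub_div, abs_div, abs_two, add_sub_add_right_eq_sub]
  | false =>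
    rw [hf, hf, ← sub_div, abs_div, abs_two, sub_sub_sub_cancel_left, abs_sub_comm]

theorem continuous_questionMarkExt : Continuous questionMarkExt := by
  have hlim : Filter.Tendsto (fun n : ℕ => (1 / 2 : ℝ) ^ n) Filter.atTop (nhds 0) :=
    tendsto_pow_atTop_nhds_zero_of_lt_one (by norm_num) (by norm_num)
  have hmem : ∀ x, 0 ≤ questionMarkExt x ∧ questionMarkExt x ≤ 1 := by
    intro x
    unfold questionMarkExt
    split_ifs
    · norm_num
    · exact questionMark_mem _
  refine continuous_of_fareyWord hlim fun w x y => ?_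
  rw [Real.dist_eq]
  induction w with
  | nil =>
    simp only [fareyWord, List.length_nil, pow_zero, abs_le]
    constructor <;> linarith [(hmem x).1, (hmem x).2, (hmem y).1, (hmem y).2]
  | cons b w ih =>
    rw [fareyWord, fareyWord, questionMarkExt_fareyStep_sub, List.length_cons, pow_succ]
    linarith

theorem questionMark_eq_ext (x : ℝ) : questionMark x = questionMarkExt (ENNReal.ofReal x) := by
  rcases lt_or_ge x 0 with hx | hx
  · rw [ENNReal.ofReal_of_nonpos hx.le]
    rw [questionMarkExt, if_neg ENNReal.zero_ne_top, ENNReal.toReal_zero, questionMark_zero,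
      questionMark, if_pos hx]
  · simp [questionMarkExt, ENNReal.toReal_ofReal hx]

theorem continuous_questionMark : Continuous questionMark := by
  have h : questionMark = fun x => questionMarkExt (ENNReal.ofReal x) :=
    funext questionMark_eq_ext
  rw [h]
  exact continuous_questionMarkExt.comp ENNReal.continuous_ofReal

theorem questionMark_of_nonpos {x : ℝ} (hx : x ≤ 0) : questionMark x = 0 := by
  rcases hx.eq_or_lt with rfl | hx
  · exact questionMark_zero
  · simp [questionMark, hx]

theorem questionMark_stieltjesFunction (x : ℝ) :
    questionMark_monotone.stieltjesFunction x = questionMark x := by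
  rw [Monotone.stieltjesFunction_eq]
  exact continuous_questionMark.continuousWithinAt.rightLim_eq

theorem tendsto_questionMark_atBot :
    Filter.Tendsto questionMark_monotone.stieltjesFunction Filter.atBot (nhds 0) := by
  refine tendsto_const_nhds.congr' ?_
  filter_upwards [Filter.eventually_le_atBot 0] with x hx
  rw [questionMark_stieltjesFunction, questionMark_of_nonpos hx]

theorem tendsto_questionMark_atTop :
    Filter.Tendsto questionMark_monotone.stieltjesFunction Filter.atTop (nhds 1) := by
  have h := (continuous_questionMarkExt.tendsto ⊤).comp ENNReal.tendsto_ofReal_atTop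
  rw [show questionMarkExt ⊤ = 1 by simp [questionMarkExt]] at h
  refine h.congr fun x => ?_
  rw [questionMark_stieltjesFunction, questionMark_eq_ext]; rfl

instance : MeasureTheory.IsProbabilityMeasure questionMarkMeasure :=
  questionMark_monotone.stieltjesFunction.isProbabilityMeasure tendsto_questionMark_atBot
    tendsto_questionMark_atTop

theorem questionMarkMeasure_Iic (x : ℝ) :
    questionMarkMeasure (Set.Iic x) = ENNReal.ofReal (questionMark x) := by
  rw [questionMarkMeasure, StieltjesFunction.measure_Iic _ tendsto_questionMark_atBot, sub_zero,
    questionMark_stieltjesFunction]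

theorem questionMarkMeasure_Ici (x : ℝ) :
    questionMarkMeasure (Set.Ici x) = ENNReal.ofReal (1 - questionMark x) := by
  have h : (questionMark_monotone.stieltjesFunction : ℝ → ℝ) = questionMark :=
    funext questionMark_stieltjesFunction
  rw [questionMarkMeasure, StieltjesFunction.measure_Ici _ tendsto_questionMark_atTop, h,
    continuous_questionMark.continuousWithinAt.leftLim_eq]

theorem ae_nonneg_questionMarkMeasure : ∀ᵐ x ∂questionMarkMeasure, 0 ≤ x := by
  have h : questionMarkMeasure (Set.Iio 0) = 0 := by
    refine MeasureTheory.measure_mono_null Set.Iio_subset_Iic_self ?_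
    rw [questionMarkMeasure_Iic, questionMark_zero, ENNReal.ofReal_zero]
  rw [MeasureTheory.ae_iff]
  simp only [not_le]
  exact h

/-- On (-∞, a] with a > 0 this reads 2F(a) = F(a-1) + 1 - F(1/a-1), which is the recursion of F for
a ≥ 1 and for a < 1. Continuity of F makes endpoints irrelevant; for a ≤ 0 both sides vanish. -/
theorem questionMarkMeasure_add_self : questionMarkMeasure + questionMarkMeasure =
    questionMarkMeasure.map (fun x => x + 1) + questionMarkMeasure.map (fun x => (x + 1)⁻¹) := by
  have hm1 : Measurable fun x : ℝ => x + 1 := by fun_prop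
  have hm2 : Measurable fun x : ℝ => (x + 1)⁻¹ := by fun_prop
  refine MeasureTheory.Measure.ext_of_Iic _ _ fun a => ?_
  rw [MeasureTheory.Measure.add_apply, MeasureTheory.Measure.add_apply,
    MeasureTheory.Measure.map_apply hm1 measurableSet_Iic,
    MeasureTheory.Measure.map_apply hm2 measurableSet_Iic]
  have h1 : (fun x : ℝ => x + 1) ⁻¹' Set.Iic a = Set.Iic (a - 1) := by
    ext x; simp [le_sub_iff_add_le]
  rw [h1, questionMarkMeasure_Iic, questionMarkMeasure_Iic]
  rcases le_or_gt a 0 with ha | ha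
  · have h2 : questionMarkMeasure ((fun x : ℝ => (x + 1)⁻¹) ⁻¹' Set.Iic a) = 0 := by
      have : ∀ᵐ x ∂questionMarkMeasure, x ∉ (fun x : ℝ => (x + 1)⁻¹) ⁻¹' Set.Iic a := by
        filter_upwards [ae_nonneg_questionMarkMeasure] with x hx hxa
        have h3 : 0 < (x + 1)⁻¹ := by positivity
        have h4 : (x + 1)⁻¹ ≤ a := hxa
        linarith
      exact MeasureTheory.measure_eq_zero_iff_ae_notMem.2 this
    rw [h2, questionMark_of_nonpos ha, questionMark_of_nonpos (by linarith)]
    simp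
  · have h2 : questionMarkMeasure ((fun x : ℝ => (x + 1)⁻¹) ⁻¹' Set.Iic a)
        = questionMarkMeasure (Set.Ici (a⁻¹ - 1)) := by
      refine MeasureTheory.measure_congr ?_
      filter_upwards [ae_nonneg_questionMarkMeasure] with x hx
      refine propext (?_ : (x + 1)⁻¹ ≤ a ↔ a⁻¹ - 1 ≤ x)
      rw [inv_le_comm₀ (by positivity) ha, sub_le_iff_le_add]
    rw [h2, questionMarkMeasure_Ici, ← ENNReal.ofReal_add (questionMark_mem _).1
      (questionMark_mem _).1, ← ENNReal.ofReal_add (questionMark_mem _).1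
      (sub_nonneg.2 (questionMark_mem _).2)]
    congr 1
    rcases le_or_gt 1 a with h | h
    · rw [questionMark_of_one_le h, questionMark_of_nonpos (x := a⁻¹ - 1)]
      · ring
      · linarith [inv_le_one_of_one_le₀ h]
    · rw [questionMark_of_lt_one ha h, questionMark_of_nonpos (x := a - 1) (by linarith),
        questionMark_of_one_le ((one_le_inv₀ ha).2 h.le)]
      ring

theorem two_mul_integral_questionMarkMeasure {g : ℝ → ℂ}
    (hg : MeasureTheory.Integrable g questionMarkMeasure) :
    2 * ∫ x, g x ∂questionMarkMeasure = (∫ x, g (x + 1) ∂questionMarkMeasure)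
      + ∫ x, g ((x + 1)⁻¹) ∂questionMarkMeasure := by
  have hm1 : Measurable fun x : ℝ => x + 1 := by fun_prop
  have hm2 : Measurable fun x : ℝ => (x + 1)⁻¹ := by fun_prop
  have hs : MeasureTheory.Integrable g (questionMarkMeasure + questionMarkMeasure) :=
    hg.add_measure hg
  have h1 := MeasureTheory.integral_add_measure hg hg
  rw [questionMarkMeasure_add_self] at hs h1
  rw [MeasureTheory.integral_add_measure hs.left_of_add_measure hs.right_of_add_measure,
    MeasureTheory.integral_map hm1.aemeasurable hs.left_of_add_measure.aestronglyMeasurable,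
    MeasureTheory.integral_map hm2.aemeasurable hs.right_of_add_measure.aestronglyMeasurable] at h1
  rw [h1, two_mul]

/-! ### The generating function -/

section

open MeasureTheory

theorem mem_pCurveShift {p z : ℂ} : z ∈ pCurveShift p ↔ z - 1 ∈ pCurve p := by
  constructor
  · rintro ⟨w, hw, rfl⟩; simpa using hw
  · intro h; exact ⟨z - 1, h, sub_add_cancel z 1⟩

theorem pX_mem_pCurve (p : ℂ) {x : ℝ} (hx : 0 ≤ x) : pX p x ∈ pCurve p := Or.inl ⟨x, hx, rfl⟩

theorem nonempty_pCurve (p : ℂ) : (pCurve p).Nonempty := ⟨_, pX_mem_pCurve p le_rfl⟩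

namespace IsRegularCurve

variable {p : ℂ}

theorem step_mem (h : IsRegularCurve p) {z : ℂ} (hz : z ∈ pCurve p) : (z + 1) / p ∈ pCurve p := by
  rcases hz with ⟨x, hx, rfl⟩ | ⟨h1, rfl⟩
  · rw [← h.pX_add_one x hx]
    have : 0 ≤ x := hx
    exact pX_mem_pCurve p (by linarith)
  · refine Or.inr ⟨h1, ?_⟩
    have h1' : p - 1 ≠ 0 := sub_ne_zero.2 h1
    have hp := h.param_ne_zero
    field_simp
    ring

theorem inv_mem (h : IsRegularCurve p) {z : ℂ} (hz : z ∈ pCurve p) (h0 : z ≠ 0) :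
    z⁻¹ ∈ pCurve p := by
  rcases hz with ⟨x, hx, rfl⟩ | ⟨h1, rfl⟩
  · rcases (Set.mem_Ici.1 hx).eq_or_lt with rfl | hx
    · rw [pX_zero] at *
      exact Or.inr ⟨sub_ne_zero.1 h0, rfl⟩
    · rw [← h.pX_inv x hx]
      exact pX_mem_pCurve p (by positivity)
  · rw [inv_inv, ← pX_zero]
    exact pX_mem_pCurve p le_rfl

theorem add_one_ne_zero (h : IsRegularCurve p) {z : ℂ} (hz : z ∈ pCurve p) : z + 1 ≠ 0 :=
  fun h0 => h.neg_one_notMem (eq_neg_of_add_eq_zero_left h0 ▸ hz)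

theorem inv_step_mem (h : IsRegularCurve p) {z : ℂ} (hz : z ∈ pCurve p) :
    p / (z + 1) ∈ pCurve p := by
  rw [← inv_div]
  exact h.inv_mem (h.step_mem hz) (div_ne_zero (h.add_one_ne_zero hz) h.param_ne_zero)

theorem exists_le_norm_sub (h : IsRegularCurve p) {z : ℂ} (hz : z ∉ pCurve p) :
    ∃ d > 0, ∀ w ∈ pCurve p, d ≤ ‖w - z‖ := by
  refine ⟨Metric.infDist z (pCurve p),
    (h.isClosed.notMem_iff_infDist_pos (nonempty_pCurve p)).1 hz, fun w hw => ?_⟩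
  rw [← dist_eq_norm, dist_comm]
  exact Metric.infDist_le_dist_of_mem hw

theorem isOpen_compl (h : IsRegularCurve p) : IsOpen (pCurveShift p)ᶜ :=
  ((Homeomorph.addRight (1 : ℂ)).isClosedMap _ h.isClosed).isOpen_compl

theorem aemeasurable (h : IsRegularCurve p) : AEMeasurable (pX p) questionMarkMeasure := by
  have := h.continuousOn.aemeasurable (μ := questionMarkMeasure) measurableSet_Ici
  rwa [Measure.restrict_eq_self_of_ae_mem (s := Set.Ici (0 : ℝ)) ae_nonneg_questionMarkMeasure] at this

theorem isProbabilityMeasure (h : IsRegularCurve p) : IsProbabilityMeasure (pMeasure p) :=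
  Measure.isProbabilityMeasure_map h.aemeasurable

theorem ae_mem (h : IsRegularCurve p) : ∀ᵐ w ∂(pMeasure p), w ∈ pCurve p := by
  refine (ae_map_iff (p := fun w => w ∈ pCurve p) h.aemeasurable h.isClosed.measurableSet).2 ?_
  filter_upwards [ae_nonneg_questionMarkMeasure] with x hx
  exact pX_mem_pCurve p hx

theorem integrable (h : IsRegularCurve p) {f : ℂ → ℂ} (hf : Measurable f) {C : ℝ}
    (hC : ∀ w ∈ pCurve p, ‖f w‖ ≤ C) : Integrable f (pMeasure p) := by
  have := h.isProbabilityMeasure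
  refine Integrable.of_bound hf.aestronglyMeasurable C ?_
  filter_upwards [h.ae_mem] with w hw
  exact hC w hw

theorem two_mul_integral (h : IsRegularCurve p) {f : ℂ → ℂ} (hf : Measurable f) {C : ℝ}
    (hC : ∀ w ∈ pCurve p, ‖f w‖ ≤ C) :
    2 * ∫ w, f w ∂(pMeasure p) = (∫ w, f ((w + 1) / p) ∂(pMeasure p))
      + ∫ w, f (p / (w + 1)) ∂(pMeasure p) := by
  have hi := (h.integrable hf hC).comp_aemeasurable h.aemeasurable
  have key := two_mul_integral_questionMarkMeasure hi
  have e1 : ∫ x, (f ∘ pX p) (x + 1) ∂questionMarkMeasure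
      = ∫ x, f ((pX p x + 1) / p) ∂questionMarkMeasure := by
    refine integral_congr_ae ?_
    filter_upwards [ae_nonneg_questionMarkMeasure] with x hx
    rw [Function.comp_apply, h.pX_add_one x hx]
  have e2 : ∫ x, (f ∘ pX p) ((x + 1)⁻¹) ∂questionMarkMeasure
      = ∫ x, f (p / (pX p x + 1)) ∂questionMarkMeasure := by
    refine integral_congr_ae ?_
    filter_upwards [ae_nonneg_questionMarkMeasure] with x hx
    rw [Function.comp_apply, h.pX_inv _ (by positivity), h.pX_add_one x hx, inv_div]
  rw [e1, e2] at key
  rw [pMeasure, integral_map h.aemeasurable hf.aestronglyMeasurable,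
    integral_map h.aemeasurable (f := fun w => f ((w + 1) / p))
      (hf.comp (by fun_prop)).aestronglyMeasurable,
    integral_map h.aemeasurable (f := fun w => f (p / (w + 1)))
      (hf.comp (by fun_prop)).aestronglyMeasurable]
  exact key

/-- Invariance of dF_p under inversion: splitting both integrals by self-similarity interchanges the
parts from T and 1/T. Only nonzero points w enter, which matters for p = 1, where 0 lies on the
curve. -/
theorem integral_eq_of_inv (h : IsRegularCurve p) {f g : ℂ → ℂ} (hf : Measurable f)
    (hg : Measurable g) {C D : ℝ} (hC : ∀ w ∈ pCurve p, ‖f w‖ ≤ C)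
    (hD : ∀ w ∈ pCurve p, ‖g w‖ ≤ D) (hfg : ∀ w ∈ pCurve p, w ≠ 0 → f w = g w⁻¹) :
    ∫ w, f w ∂(pMeasure p) = ∫ w, g w ∂(pMeasure p) := by
  refine mul_left_cancel₀ (two_ne_zero : (2 : ℂ) ≠ 0) ?_
  rw [h.two_mul_integral hf hC, h.two_mul_integral hg hD, add_comm]
  congr 1
  · refine integral_congr_ae ?_
    filter_upwards [h.ae_mem] with w hw
    rw [hfg _ (h.inv_step_mem hw) (div_ne_zero h.param_ne_zero (h.add_one_ne_zero hw)), inv_div]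
  · refine integral_congr_ae ?_
    filter_upwards [h.ae_mem] with w hw
    rw [hfg _ (h.step_mem hw) (div_ne_zero (h.add_one_ne_zero hw) h.param_ne_zero), inv_div]

theorem norm_inv_le {w z : ℂ} {d : ℝ} (hd : 0 < d) (h : d ≤ ‖w - z‖) : ‖1 / (w - z)‖ ≤ 1 / d := by
  rw [norm_div, norm_one]
  exact one_div_le_one_div_of_le hd h

theorem integrable_kernel (h : IsRegularCurve p) {z : ℂ} (hz : z ∉ pCurveShift p) :
    Integrable (fun w : ℂ => 1 / (w + 1 - z)) (pMeasure p) := by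
  obtain ⟨d, hd, hdw⟩ := h.exists_le_norm_sub (mt mem_pCurveShift.2 hz)
  refine h.integrable (by fun_prop) (C := 1 / d) fun w hw => ?_
  rw [add_sub_assoc, ← neg_sub z 1, ← sub_eq_add_neg]
  exact norm_inv_le hd (hdw w hw)

theorem analyticOnNhd_pG (h : IsRegularCurve p) : AnalyticOnNhd ℂ (pG p) (pCurveShift p)ᶜ := by
  refine DifferentiableOn.analyticOnNhd (fun z hz => ?_) h.isOpen_compl
  obtain ⟨d, hd, hdw⟩ := h.exists_le_norm_sub (mt mem_pCurveShift.2 hz)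
  have hball : ∀ x ∈ Metric.ball z (d / 2), ∀ w ∈ pCurve p, d / 2 ≤ ‖w + 1 - x‖ := by
    intro x hx w hw
    rw [mem_ball_iff_norm] at hx
    have h1 : ‖w - (z - 1)‖ ≤ ‖w + 1 - x‖ + ‖x - z‖ := by
      refine le_trans (le_of_eq ?_) (norm_add_le _ _)
      congr 1; ring
    linarith [hdw w hw]
  have := h.isProbabilityMeasure
  have key := hasDerivAt_integral_of_dominated_loc_of_deriv_le
    (F := fun x w : ℂ => 1 / (w + 1 - x)) (F' := fun x w : ℂ => 1 / (w + 1 - x) ^ 2)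
    (μ := pMeasure p) (x₀ := z) (bound := fun _ => (1 / (d / 2)) ^ 2)
    (Metric.ball_mem_nhds z (half_pos hd))
    (Filter.Eventually.of_forall fun x => Measurable.aestronglyMeasurable (by fun_prop))
    (h.integrable_kernel hz) (Measurable.aestronglyMeasurable (by fun_prop)) ?_
    (integrable_const _) ?_
  · exact key.2.differentiableAt.differentiableWithinAt
  · filter_upwards [h.ae_mem] with w hw x hx
    rw [← one_div_pow, norm_pow]
    exact pow_le_pow_left₀ (norm_nonneg _) (norm_inv_le (half_pos hd) (hball x hx w hw)) 2
  · filter_upwards [h.ae_mem] with w hw x hx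
    have h0 : w + 1 - x ≠ 0 := norm_pos_iff.1 ((half_pos hd).trans_le (hball x hx w hw))
    have h1 := ((hasDerivAt_id x).const_sub (w + 1)).inv h0
    simp only [one_div]
    exact h1.congr_deriv (by simp)

theorem threeTermEquation_pG (h : IsRegularCurve p) : ThreeTermEquation p (pG p) := by
  intro z h0 hz
  have hp := h.param_ne_zero
  have := h.isProbabilityMeasure
  obtain ⟨d, hd, hdw⟩ := h.exists_le_norm_sub hz
  have key := h.two_mul_integral (f := fun w => 1 / (w - z)) (by fun_prop) (C := 1 / d)
    fun w hw => norm_inv_le hd (hdw w hw)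
  have e1 : ∫ w, 1 / ((w + 1) / p - z) ∂(pMeasure p) = p * pG p (p * z) := by
    rw [pG, ← integral_const_mul]
    congr 1; ext w
    rw [div_sub' hp, one_div_div, mul_one_div]
  have hpz : p / z ∉ pCurveShift p := by
    rintro ⟨w, hw, e⟩
    refine hz ?_
    have := h.inv_step_mem hw
    rwa [show w + 1 = p / z from e, div_div_cancel₀ hp] at this
  have e2 : ∫ w, 1 / (p / (w + 1) - z) ∂(pMeasure p) = -(1 / z) - p / z ^ 2 * pG p (p / z) := by
    have : ∫ w, (-(1 / z) - p / z ^ 2 * (1 / (w + 1 - p / z))) ∂(pMeasure p)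
        = -(1 / z) - p / z ^ 2 * pG p (p / z) := by
      rw [integral_sub (integrable_const _) ((h.integrable_kernel hpz).const_mul _),
        integral_const_mul, integral_const, pG]
      simp
    rw [← this]
    refine integral_congr_ae ?_
    filter_upwards [h.ae_mem] with w hw
    have hw1 := h.add_one_ne_zero hw
    have h3 : p - z * (w + 1) ≠ 0 := by
      intro h3
      refine hz ?_
      have := h.inv_step_mem hw
      rwa [show p / (w + 1) = z by rw [div_eq_iff hw1]; linear_combination h3] at this
    have h4 : z * (w + 1) - p ≠ 0 := by rwa [← neg_sub, neg_ne_zero]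
    have h5 : p / (w + 1) - z ≠ 0 := by
      rw [div_sub' hw1]; refine div_ne_zero ?_ hw1; rwa [mul_comm]
    have h6 : w + 1 - p / z ≠ 0 := by
      rw [sub_div' h0]; refine div_ne_zero ?_ h0; rwa [mul_comm]
    rw [eq_sub_iff_add_eq, eq_comm]
    field_simp
    ring
  rw [e1, e2] at key
  have e3 : pG p (z + 1) = ∫ w, 1 / (w - z) ∂(pMeasure p) := by
    rw [pG]; simp only [add_sub_add_right_eq_sub]
  rw [e3, key]
  ring

/-- The equation at z plus z⁻² times the equation at 1/z: the values at pz and p/z cancel, and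
division by 2 gives the symmetry. -/
theorem symmetryProperty (h : IsRegularCurve p) {H : ℂ → ℂ} (hH : ThreeTermEquation p H) :
    SymmetryProperty p H := by
  intro z h0 hz
  have h1 := hH z h0 hz
  have h2 := hH z⁻¹ (inv_ne_zero h0) fun hm => hz (by
    simpa using h.inv_mem hm (inv_ne_zero h0))
  rw [show p / z⁻¹ = p * z from div_inv_eq_mul p z,
    show p * z⁻¹ = p / z from (div_eq_mul_inv p z).symm, ← one_div z] at h2
  generalize H (p / z) = A at *
  generalize H (p * z) = B at *
  generalize H (1 / z + 1) = C at *
  generalize H (z + 1) = D at *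
  field_simp at h1 h2 ⊢
  linear_combination (h1 + h2) / 2

theorem vanishesFarFromCurve_pG (h : IsRegularCurve p) : VanishesFarFromCurve p (pG p) := by
  have := h.isProbabilityMeasure
  have hb : ∀ z, 2 ≤ Metric.infDist z (pCurve p) →
      ‖pG p z‖ ≤ 1 / (Metric.infDist z (pCurve p) - 1) := by
    intro z hz
    refine (norm_integral_le_of_norm_le_const (C := 1 / (Metric.infDist z (pCurve p) - 1))
      ?_).trans (by simp)
    filter_upwards [h.ae_mem] with w hw
    rw [add_sub_assoc, ← neg_sub z 1, ← sub_eq_add_neg]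
    refine norm_inv_le (by linarith) ?_
    have h1 := Metric.infDist_le_dist_of_mem (x := z) hw
    have h2 : ‖z - w‖ ≤ ‖w - (z - 1)‖ + ‖(1 : ℂ)‖ := by
      rw [norm_sub_rev w]
      refine le_trans (le_of_eq ?_) (norm_add_le _ _)
      congr 1; ring
    rw [dist_eq_norm] at h1
    rw [norm_one] at h2
    linarith
  have hlim : Filter.Tendsto (fun t : ℝ => 1 / (t - 1)) Filter.atTop (nhds 0) := by
    simp only [one_div]
    exact tendsto_inv_atTop_zero.comp (Filter.tendsto_atTop_add_const_right _ (-1)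
      Filter.tendsto_id)
  refine squeeze_zero_norm' ?_ (hlim.comp Filter.tendsto_comap)
  exact (Filter.tendsto_comap.eventually (Filter.eventually_ge_atTop 2)).mono hb

/-- Since w/(w+1) is bounded on the curve, the series may be integrated term by term near z = 0. -/
theorem eventually_hasSum (h : IsRegularCurve p) : ∀ᶠ z in nhds (0 : ℂ), z ∉ pCurveShift p ∧
    HasSum (fun L : ℕ => pMoment p (L + 1) / p ^ (L + 1) * z ^ L) (pG p z) := by
  have := h.isProbabilityMeasure
  have hp := h.param_ne_zero
  have h0 : (0 : ℂ) ∈ (pCurveShift p)ᶜ := fun h0 => h.neg_one_notMem (by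
    simpa using mem_pCurveShift.1 h0)
  obtain ⟨d, hd, hdw⟩ := h.exists_le_norm_sub h.neg_one_notMem
  set Y : ℝ := 1 + 1 / d with hY
  have hY0 : 0 < Y := by positivity
  have hyb : ∀ w ∈ pCurve p, ‖w / (w + 1)‖ ≤ Y := by
    intro w hw
    have e : w / (w + 1) = 1 - 1 / (w - -1) := by
      rw [sub_neg_eq_add, one_sub_div (h.add_one_ne_zero hw), add_sub_cancel_right]
    rw [e]
    refine (norm_sub_le _ _).trans ?_
    rw [norm_one]
    exact add_le_add le_rfl (norm_inv_le hd (hdw w hw))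
  have hball : Metric.ball (0 : ℂ) (1 / (2 * Y)) ∈ nhds (0 : ℂ) :=
    Metric.ball_mem_nhds 0 (by positivity)
  filter_upwards [h.isOpen_compl.mem_nhds h0, hball] with z hz hzb
  refine ⟨hz, ?_⟩
  rw [mem_ball_zero_iff, lt_div_iff₀ (by positivity)] at hzb
  have hyz : ∀ w ∈ pCurve p, ‖w / (w + 1) * z‖ ≤ 1 / 2 := by
    intro w hw
    rw [norm_mul]
    have := mul_le_mul_of_nonneg_right (hyb w hw) (norm_nonneg z)
    linarith
  have hone : ∀ w ∈ pCurve p, 1 / 2 ≤ ‖1 - w / (w + 1) * z‖ := by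
    intro w hw
    have := norm_sub_norm_le (1 : ℂ) (w / (w + 1) * z)
    rw [norm_one] at this
    linarith [hyz w hw]
  have hterm : ∀ L : ℕ, pMoment p (L + 1) / p ^ (L + 1) * z ^ L
      = ∫ w, (w / (w + 1)) ^ (L + 1) * z ^ L ∂(pMeasure p) := by
    intro L
    rw [pMoment, ← integral_div, ← integral_mul_const]
    congr 1; ext w
    rw [mul_div_assoc p w, mul_pow, mul_div_cancel_left₀ _ (pow_ne_zero _ hp)]
  have hFb : ∀ L : ℕ, ∀ w ∈ pCurve p, ‖(w / (w + 1)) ^ (L + 1) * z ^ L‖ ≤ Y * (1 / 2) ^ L := by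
    intro L w hw
    rw [pow_succ', mul_assoc, ← mul_pow, norm_mul, norm_pow]
    exact mul_le_mul (hyb w hw) (pow_le_pow_left₀ (norm_nonneg _) (hyz w hw) L)
      (by positivity) hY0.le
  have hsum := hasSum_integral_of_summable_integral_norm (μ := pMeasure p)
    (F := fun (L : ℕ) (w : ℂ) => (w / (w + 1)) ^ (L + 1) * z ^ L)
    (fun L => h.integrable (by fun_prop) (hFb L)) ?_
  · simp only [hterm]
    have hgeom : ∀ w ∈ pCurve p, ∑' L : ℕ, (w / (w + 1)) ^ (L + 1) * z ^ L
        = w / (w + 1) / (1 - w / (w + 1) * z) := by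
      intro w hw
      simp only [pow_succ', mul_assoc, ← mul_pow]
      rw [tsum_mul_left, tsum_geometric_of_norm_lt_one ((hyz w hw).trans_lt (by norm_num)),
        div_eq_mul_inv (w / (w + 1))]
    -- The geometric sum is w/(w+1-wz), which is 1/(1/w+1-z) for w ≠ 0: the kernel of G_p at 1/w.
    suffices hG : ∫ w, w / (w + 1) / (1 - w / (w + 1) * z) ∂(pMeasure p) = pG p z by
      rwa [integral_congr_ae (h.ae_mem.mono hgeom), hG] at hsum
    obtain ⟨d', hd', hdw'⟩ := h.exists_le_norm_sub (mt mem_pCurveShift.2 hz)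
    refine (h.integral_eq_of_inv (C := Y / (1 / 2)) (D := 1 / d') (by fun_prop) (by fun_prop)
      ?_ ?_ ?_)
    · intro w hw
      rw [norm_div]
      exact div_le_div₀ hY0.le (hyb w hw) (by norm_num) (hone w hw)
    · intro w hw
      rw [add_sub_assoc, ← neg_sub z 1, ← sub_eq_add_neg]
      exact norm_inv_le hd' (hdw' w hw)
    · intro w hw hw0
      have hw1 := h.add_one_ne_zero hw
      have h2 : w + 1 - w * z ≠ 0 := by
        have h3 : 1 - w / (w + 1) * z ≠ 0 := norm_pos_iff.1 (by linarith [hone w hw])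
        intro h4
        refine h3 ?_
        rw [div_mul_eq_mul_div, one_sub_div hw1, h4, zero_div]
      have h5 : 1 - w / (w + 1) * z = (w + 1 - w * z) / (w + 1) := by field_simp
      have h6 : w⁻¹ + 1 - z = (w + 1 - w * z) / w := by field_simp; ring
      rw [h5, h6]
      field_simp
  · refine Summable.of_nonneg_of_le (fun L => integral_nonneg fun _ => norm_nonneg _) (fun L => ?_)
      ((summable_geometric_of_lt_one (r := (1 / 2 : ℝ)) (by norm_num) (by norm_num)).mul_left Y)
    refine (integral_mono_ae (h.integrable (by fun_prop) (hFb L)).norm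
      (integrable_const (Y * (1 / 2) ^ L)) (h.ae_mem.mono (hFb L))).trans (by simp)

end IsRegularCurve

end

/-! ### Uniqueness for `p ≠ 1` -/

/-- The homogeneous equation satisfied by the difference of two solutions, in the variable shifted
by one. -/
def HomogeneousEquation (p : ℂ) (E : ℂ → ℂ) : Prop :=
  ∀ z : ℂ, z ≠ 0 → z ∉ pCurve p → 2 * E z = p * E (p * z - 1) - p / z ^ 2 * E (p / z - 1)

/-- The symmetry of the difference of two solutions. -/
def HomogeneousSymmetry (p : ℂ) (E : ℂ → ℂ) : Prop :=
  ∀ z : ℂ, z ≠ 0 → z ∉ pCurve p → E z = -(1 / z ^ 2) * E (1 / z)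

namespace IsRegularCurve

variable {p : ℂ}

/-- The two right-hand terms are, up to sign, E(ζ) divided by the derivative of the step at its
preimage ζ of z. The larger of them has norm at least |E(z)|. -/
theorem exists_preimage (h : IsRegularCurve p) {E : ℂ → ℂ} (hE : HomogeneousEquation p E) {z : ℂ}
    (h0 : z ≠ 0) (hz : z ∉ pCurve p) : ∃ b ζ, ζ ∉ pCurve p ∧ ζ + 1 ≠ 0 ∧ pStep p b ζ = z ∧
      ‖E z‖ * ‖pStepDeriv p b ζ‖ ≤ ‖E ζ‖ := by
  have hp := h.param_ne_zero
  have h1 := congrArg norm (hE z h0 hz)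
  rw [norm_mul, Complex.norm_ofNat] at h1
  have h2 := norm_sub_le (p * E (p * z - 1)) (p / z ^ 2 * E (p / z - 1))
  rcases le_total ‖p / z ^ 2 * E (p / z - 1)‖ ‖p * E (p * z - 1)‖ with h3 | h3
  · have e : pStep p true (p * z - 1) = z := by
      simp only [pStep, sub_add_cancel]; field_simp
    refine ⟨true, p * z - 1, fun hm => hz (e ▸ h.step_mem hm), by simp [h0, hp], e, ?_⟩
    have h4 : ‖E z‖ ≤ ‖p‖ * ‖E (p * z - 1)‖ := by rw [← norm_mul]; linarith
    rw [pStepDeriv, norm_div, norm_one, mul_one_div, div_le_iff₀ (norm_pos_iff.2 hp), mul_comm]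
    exact h4
  · have e : pStep p false (p / z - 1) = z := by
      simp only [pStep, sub_add_cancel]; field_simp
    refine ⟨false, p / z - 1, fun hm => hz (e ▸ h.inv_step_mem hm), by simp [h0, hp], e, ?_⟩
    have h4 : ‖E z‖ ≤ ‖p / z ^ 2‖ * ‖E (p / z - 1)‖ := by rw [← norm_mul]; linarith
    have e2 : pStepDeriv p false (p / z - 1) = -(p / z ^ 2)⁻¹ := by
      simp only [pStepDeriv, sub_add_cancel]; field_simp
    rw [e2, norm_neg, norm_inv, ← div_eq_mul_inv, div_le_iff₀
      (norm_pos_iff.2 (div_ne_zero hp (pow_ne_zero 2 h0))), mul_comm]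
    exact h4

/-- Avoiding the word images of 0 keeps every intermediate point nonzero, so the equation can be
applied n times. The Möbius identity is carried along because ζ may lie outside V. -/
theorem exists_word_preimage (h : IsRegularCurve p) {E : ℂ → ℂ} (hE : HomogeneousEquation p E)
    (n : ℕ) {z : ℂ} (h0 : ∀ w, pWord p w 0 ≠ z) (hz : z ∉ pCurve p) :
    ∃ w ζ, w.length = n ∧ ζ ∉ pCurve p ∧ pWord p w ζ = z ∧
      ‖E z‖ * ‖pWordDeriv p w ζ‖ ≤ ‖E ζ‖ ∧ ∀ ζ₀ ∈ pCurve p,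
        (z - pWord p w ζ₀) ^ 2 = pWordDeriv p w ζ * pWordDeriv p w ζ₀ * (ζ - ζ₀) ^ 2 := by
  induction n generalizing z with
  | zero => exact ⟨[], z, rfl, hz, rfl, by simp [pWordDeriv], by simp [pWord, pWordDeriv]⟩
  | succ n ih =>
    obtain ⟨b, ζ₁, hζ₁, hn, rfl, hle⟩ := h.exists_preimage hE (h0 []).symm hz
    obtain ⟨w, ζ, hw, hζ, rfl, hle', hid⟩ := ih (fun w hw => h0 (b :: w) (by rw [pWord, hw])) hζ₁
    refine ⟨b :: w, ζ, by simp [hw], hζ, rfl, ?_, fun ζ₀ h₀ => ?_⟩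
    · rw [pWordDeriv, norm_mul, ← mul_assoc]
      exact (mul_le_mul_of_nonneg_right hle (norm_nonneg _)).trans hle'
    · have hmem : ∀ w : List Bool, pWord p w ζ₀ ∈ pCurve p := by
        intro w
        induction w with
        | nil => exact h₀
        | cons b w ih =>
          cases b with
          | true => exact h.step_mem ih
          | false => exact h.inv_step_mem ih
      simp only [pWord, pWordDeriv]
      rw [pStep_sub_sq h.param_ne_zero b hn (h.add_one_ne_zero (hmem w)), hid ζ₀ h₀]
      ring

end IsRegularCurve

namespace IsContractive

variable {p : ℂ} {V : Set ℂ}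

/-- Near infinity the symmetry gives E(ζ) = -ζ⁻²E(1/ζ), with 1/ζ near 0, a point off the curve where
E is continuous. The remaining part of the complement of V is compact. -/
theorem exists_decay_bound (hV : IsContractive p V) (h1 : p ≠ 1) {E : ℂ → ℂ}
    (hc : ContinuousOn E (pCurve p)ᶜ) (hS : HomogeneousSymmetry p E) (q : ℂ) :
    ∃ M > 0, ∀ ζ ∉ V, ‖E ζ‖ * ‖ζ - q‖ ^ 2 ≤ M := by
  have hsub := hV.pCurve_subset h1
  have h0 : (0 : ℂ) ∈ (pCurve p)ᶜ := fun h => hV.ne_zero (hsub h) rfl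
  have hopen := (hV.isCompact_pCurve h1).isClosed.isOpen_compl
  have hc0 := hc.continuousAt (hopen.mem_nhds h0)
  have hb : ∀ᶠ u in nhds (0 : ℂ), ‖E u‖ < ‖E 0‖ + 1 :=
    hc0.norm.eventually (gt_mem_nhds (lt_add_one _))
  obtain ⟨δ, hδ, hb⟩ := Metric.eventually_nhds_iff.1 hb
  have hK : IsCompact (Metric.closedBall (0 : ℂ) (2 / δ) \ V) :=
    (isCompact_closedBall _ _).diff hV.isOpen
  have hKc : ContinuousOn (fun ζ => ‖E ζ‖ * ‖ζ - q‖ ^ 2) (Metric.closedBall (0 : ℂ) (2 / δ) \ V) :=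
    ((hc.mono fun ζ hζ hm => hζ.2 (hsub hm)).norm).mul (by fun_prop)
  obtain ⟨M, hM⟩ := hK.exists_bound_of_continuousOn hKc
  refine ⟨max M ((‖E 0‖ + 1) * (1 + ‖q‖ * δ) ^ 2), lt_max_of_lt_right (by positivity), ?_⟩
  intro ζ hζ
  rcases le_or_gt ‖ζ‖ (2 / δ) with hle | hgt
  · refine le_trans ?_ (le_max_left _ _)
    have := hM ζ ⟨by simpa using hle, hζ⟩
    rwa [Real.norm_of_nonneg (by positivity)] at this
  · refine le_trans ?_ (le_max_right _ _)
    have hpos : 0 < ‖ζ‖ := lt_trans (by positivity) hgt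
    have hζ0 : ζ ≠ 0 := norm_pos_iff.1 hpos
    have hinv : ‖ζ‖⁻¹ < δ := by
      rw [inv_lt_comm₀ hpos hδ]
      refine lt_of_le_of_lt ?_ hgt
      rw [inv_eq_one_div]
      gcongr; norm_num
    have h2 := (hb (y := 1 / ζ) (by simpa using hinv)).le
    rw [hS ζ hζ0 fun hm => hζ (hsub hm), norm_mul, norm_neg, norm_div, norm_one, norm_pow]
    have h3 : ‖ζ - q‖ ≤ ‖ζ‖ * (1 + ‖q‖ * δ) := by
      have h4 : ‖q‖ * 1 ≤ ‖q‖ * (‖ζ‖ * δ) := by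
        refine mul_le_mul_of_nonneg_left ?_ (norm_nonneg q)
        have := mul_lt_mul_of_pos_left hinv hpos
        rw [mul_inv_cancel₀ hpos.ne'] at this
        exact this.le
      have := norm_sub_le ζ q
      linarith
    calc _ ≤ 1 / ‖ζ‖ ^ 2 * (‖E 0‖ + 1) * (‖ζ‖ * (1 + ‖q‖ * δ)) ^ 2 := by gcongr
      _ = _ := by field_simp

theorem eq_zero_of_homogeneous (hV : IsContractive p V) (h1 : p ≠ 1) {E : ℂ → ℂ}
    (hc : ContinuousOn E (pCurve p)ᶜ) (hE : HomogeneousEquation p E)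
    (hS : HomogeneousSymmetry p E) : Set.EqOn E 0 (pCurve p)ᶜ := by
  have hR := hV.isRegularCurve h1
  have hsub := hV.pCurve_subset h1
  have hqm : (p - 1)⁻¹ ∈ pCurve p := Or.inr ⟨h1, rfl⟩
  set q := (p - 1)⁻¹ with hq
  obtain ⟨M, hM, hMb⟩ := hV.exists_decay_bound h1 hc hS q
  obtain ⟨C, hC, k, hk0, hk1, hdiam⟩ := hV.exists_diam_bound
  obtain ⟨B, hB, l, hl0, hl1, hder⟩ := hV.exists_deriv_bound
  obtain ⟨r, hr, hrV⟩ := Metric.isOpen_iff.1 hV.isOpen q hV.fixedPoint_mem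
  have hrV' : Metric.closedBall q (r / 2) ⊆ V :=
    (Metric.closedBall_subset_ball (half_lt_self hr)).trans hrV
  have hlimk : Filter.Tendsto (fun n : ℕ => C * k ^ n) Filter.atTop (nhds 0) := by
    simpa using (tendsto_pow_atTop_nhds_zero_of_lt_one hk0.le hk1).const_mul C
  have hliml : Filter.Tendsto (fun n : ℕ => M * (B / (r / 2) * l ^ n)) Filter.atTop (nhds 0) := by
    simpa using ((tendsto_pow_atTop_nhds_zero_of_lt_one hl0.le hl1).const_mul _).const_mul M
  have hqw : ∀ w : List Bool, pWord p w q ∈ pCurve p := by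
    intro w
    induction w with
    | nil => exact hqm
    | cons b w ih =>
      cases b with
      | true => exact hR.step_mem ih
      | false => exact hR.inv_step_mem ih
  have hgen : Set.EqOn E 0 ((pCurve p)ᶜ ∩ (Set.range fun w => pWord p w 0)ᶜ) := by
    rintro z ⟨hz, hz0⟩
    obtain ⟨d, hd, hdz⟩ := hR.exists_le_norm_sub hz
    have hbound : ∀ᶠ n : ℕ in Filter.atTop, ‖E z‖ * d ^ 2 ≤ M * (B / (r / 2) * l ^ n) := by
      filter_upwards [hlimk.eventually (gt_mem_nhds hd)] with n hn
      obtain ⟨w, ζ, hw, hζ, hwz, hle, hid⟩ :=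
        hR.exists_word_preimage hE n (fun w hw => hz0 ⟨w, hw⟩) hz
      -- If ζ were in V, a long word would bring z = w(ζ) within d of the curve point w(q).
      have hζV : ζ ∉ V := by
        intro hζV
        have h2 := hdiam q hV.fixedPoint_mem ζ hζV w
        rw [hw, hwz] at h2
        linarith [hdz _ (hqw w)]
      have h3 := congrArg norm (hid q hqm)
      rw [norm_pow, norm_mul, norm_mul, norm_pow, norm_sub_rev] at h3
      have h4 := hder q (r / 2) (half_pos hr) hrV' w
      rw [hw] at h4
      calc ‖E z‖ * d ^ 2 ≤ ‖E z‖ * ‖pWord p w q - z‖ ^ 2 := by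
            gcongr; exact hdz _ (hqw w)
        _ = ‖E z‖ * ‖pWordDeriv p w ζ‖ * (‖pWordDeriv p w q‖ * ‖ζ - q‖ ^ 2) := by rw [h3]; ring
        _ ≤ ‖E ζ‖ * (‖pWordDeriv p w q‖ * ‖ζ - q‖ ^ 2) := by gcongr
        _ = ‖E ζ‖ * ‖ζ - q‖ ^ 2 * ‖pWordDeriv p w q‖ := by ring
        _ ≤ M * (B / (r / 2) * l ^ n) := mul_le_mul (hMb ζ hζV) h4 (norm_nonneg _) hM.le
    have h5 := ge_of_tendsto hliml hbound
    have h6 : ‖E z‖ ≤ 0 := by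
      by_contra hcon
      push Not at hcon
      have : 0 < ‖E z‖ * d ^ 2 := by positivity
      linarith
    simpa using h6
  -- The excluded word images of 0 are countable, so continuity of E fills them in.
  have hdense : Dense (Set.range fun w => pWord p w 0)ᶜ :=
    (Set.countable_range _).dense_compl ℂ
  exact hgen.of_subset_closure hc continuousOn_const Set.inter_subset_left
    (hdense.open_subset_closure_inter hR.isClosed.isOpen_compl)

end IsContractive

/-! ### Uniqueness for `p = 1` -/

theorem mem_pCurve_one {z : ℂ} : z ∈ pCurve 1 ↔ 0 ≤ z.re ∧ z.im = 0 := by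
  rw [pCurve_one]
  constructor
  · rintro ⟨x, hx, rfl⟩
    exact ⟨by simpa using hx, by simp⟩
  · rintro ⟨h1, h2⟩
    exact ⟨z.re, h1, by apply Complex.ext <;> simp [h2]⟩

/-- The ray (-∞,-1] is stable under both preimage maps. At a point -y where |E| is maximal the
equation gives |E| ≤ |E|/y², which forces y = 1, but the symmetry at -1 gives E(-1) = 0. -/
theorem eq_zero_of_homogeneous_one {E : ℂ → ℂ} (hc : ContinuousOn E (pCurve 1)ᶜ)
    (hE : HomogeneousEquation 1 E) (hS : HomogeneousSymmetry 1 E)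
    (hlim : Filter.Tendsto (fun x : ℝ => E (-x)) Filter.atTop (nhds 0)) {x : ℝ} (hx : 1 ≤ x) :
    E (-x) = 0 := by
  have hnot : ∀ x : ℝ, 1 ≤ x → -(x : ℂ) ∉ pCurve 1 := by
    intro x hx hm
    have := (mem_pCurve_one.1 hm).1
    simp at this
    linarith
  have h1 : E (-1) = 0 := by
    have h := hS (-1) (by simp) (by simpa using hnot 1 le_rfl)
    norm_num at h
    have h2 : 2 * E (-1) = 0 := by linear_combination h
    simpa using h2
  -- Folding the ray by t ↦ 1+|t| gives a continuous function on ℝ vanishing at infinity, so a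
  -- positive value forces a maximum.
  set g : ℝ → ℝ := fun t => ‖E (-((1 + |t| : ℝ) : ℂ))‖ with hg
  have hgc : Continuous g := by
    refine (hc.comp_continuous (by fun_prop) fun t => ?_).norm
    exact hnot _ (by linarith [abs_nonneg t])
  have hg0 : Filter.Tendsto g (Filter.cocompact ℝ) (nhds 0) := by
    have h2 : Filter.Tendsto (fun t : ℝ => 1 + |t|) (Filter.cocompact ℝ) Filter.atTop :=
      Filter.tendsto_atTop_add_const_left _ 1 (tendsto_norm_cocompact_atTop (E := ℝ))
    rw [← norm_zero (E := ℂ)]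
    exact (hlim.comp h2).norm
  have hgz : ∀ t, g t = 0 := by
    by_contra! hcon
    obtain ⟨t, ht⟩ := hcon
    have ht0 : 0 < g t := lt_of_le_of_ne (norm_nonneg _) (Ne.symm ht)
    obtain ⟨s, hs⟩ := hgc.exists_forall_ge' t
      ((hg0.eventually (gt_mem_nhds ht0)).mono fun _ h => h.le)
    have hs0 : 0 < g s := ht0.trans_le (hs t)
    set y : ℝ := 1 + |s| with hy
    have hy1 : 1 ≤ y := by linarith [abs_nonneg s]
    have hmax : ∀ u : ℝ, 1 ≤ u → ‖E (-(u : ℂ))‖ ≤ g s := by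
      intro u hu
      have := hs (u - 1)
      rw [hg] at this
      simp only at this
      rwa [abs_of_nonneg (by linarith), add_sub_cancel] at this
    have hyC : (y : ℂ) ≠ 0 := by exact_mod_cast (by linarith : y ≠ 0)
    have h2 := congrArg norm (hE (-(y : ℂ)) (neg_ne_zero.2 hyC) (hnot y hy1))
    have e1 : (1 : ℂ) * -(y : ℂ) - 1 = -((y + 1 : ℝ) : ℂ) := by push_cast; ring
    have e2 : (1 : ℂ) / -(y : ℂ) - 1 = -((1 + y⁻¹ : ℝ) : ℂ) := by push_cast; field_simp; ring
    rw [e1, e2, norm_mul, Complex.norm_ofNat, one_mul] at h2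
    have h3 := norm_sub_le (E (-((y + 1 : ℝ) : ℂ))) (1 / (-(y : ℂ)) ^ 2 * E (-((1 + y⁻¹ : ℝ) : ℂ)))
    rw [norm_mul, norm_div, norm_one, norm_pow, norm_neg, Complex.norm_real,
      Real.norm_of_nonneg (by linarith)] at h3
    have h4 := hmax (y + 1) (by linarith)
    have hyi : 0 < y⁻¹ := by positivity
    have h5 := hmax (1 + y⁻¹) (by linarith)
    have h6 : 1 / y ^ 2 * ‖E (-((1 + y⁻¹ : ℝ) : ℂ))‖ ≤ 1 / y ^ 2 * g s := by gcongr
    have h7 : ‖E (-(y : ℂ))‖ = g s := rfl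
    rw [h7] at h2
    have h8 : g s ≤ 1 / y ^ 2 * g s := by linarith
    have h9 : y ^ 2 ≤ 1 := by
      rw [div_mul_eq_mul_div, one_mul, le_div_iff₀ (by positivity)] at h8
      nlinarith
    have h10 : y = 1 := by nlinarith
    rw [h10] at h7
    rw [← h7] at hs0
    simp [h1] at hs0
  have := hgz (x - 1)
  rw [hg] at this
  simp only at this
  rwa [abs_of_nonneg (by linarith), add_sub_cancel, norm_eq_zero] at this

theorem isPreconnected_compl_pCurveShift_one : IsPreconnected (pCurveShift 1)ᶜ := by
  have h : (pCurveShift 1)ᶜ = (fun z => 1 - z) '' Complex.slitPlane := by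
    ext z
    rw [Set.mem_compl_iff, mem_pCurveShift, mem_pCurve_one]
    constructor
    · intro hz
      refine ⟨1 - z, ?_, by ring⟩
      rw [Complex.mem_slitPlane_iff]
      by_contra! hcon
      refine hz ⟨?_, ?_⟩
      · have := hcon.1; simp at this ⊢; linarith
      · have := hcon.2; simp at this ⊢; linarith
    · rintro ⟨w, hw, rfl⟩ ⟨h1, h2⟩
      simp at h1 h2
      rcases Complex.mem_slitPlane_iff.1 hw with h | h
      · linarith
      · exact h h2
  rw [h]
  refine IsPreconnected.image ?_ _ (by fun_prop)
  exact (Complex.starConvex_one_slitPlane.isPathConnected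
    Complex.one_mem_slitPlane).isConnected.isPreconnected

theorem tendsto_of_vanishesFarFromCurve_one {H : ℂ → ℂ} (hH : VanishesFarFromCurve 1 H) :
    Filter.Tendsto (fun x : ℝ => H (-x + 1)) Filter.atTop (nhds 0) := by
  refine hH.comp (Filter.tendsto_comap_iff.2 ?_)
  refine Filter.tendsto_atTop_mono (f := fun x : ℝ => x + -1) (fun x => ?_)
    (Filter.tendsto_atTop_add_const_right _ _ Filter.tendsto_id)
  refine (Metric.le_infDist (nonempty_pCurve 1)).2 fun {w} hw => ?_
  have h1 := (mem_pCurve_one.1 hw).1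
  have h2 := Complex.re_le_norm (w - (-x + 1))
  rw [dist_comm, dist_eq_norm]
  simp at h2
  linarith

/-! ### Uniqueness -/

theorem eqOn_pG {p : ℂ} (hp : ‖p - 2‖ ≤ 1 ∨ (1 ≤ p.re ∧ p.im = 0)) {H : ℂ → ℂ}
    (hA : AnalyticOnNhd ℂ H (pCurveShift p)ᶜ) (hT : ThreeTermEquation p H)
    (hv : VanishesFarFromCurve p H) : Set.EqOn H (pG p) (pCurveShift p)ᶜ := by
  have hR := isRegularCurve hp
  have hGT := hR.threeTermEquation_pG
  have hDA := hA.sub hR.analyticOnNhd_pG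
  set E : ℂ → ℂ := fun z => H (z + 1) - pG p (z + 1) with hE
  have hEE : HomogeneousEquation p E := by
    intro z h0 hz
    have h1 := hT z h0 hz
    have h2 := hGT z h0 hz
    simp only [hE, sub_add_cancel]
    linear_combination h1 - h2
  have hES : HomogeneousSymmetry p E := by
    intro z h0 hz
    have h1 := hR.symmetryProperty hT z h0 hz
    have h2 := hR.symmetryProperty hGT z h0 hz
    simp only [hE]
    linear_combination h1 - h2
  have hEc : ContinuousOn E (pCurve p)ᶜ := by
    refine ContinuousOn.comp (t := (pCurveShift p)ᶜ) (f := fun z : ℂ => z + 1) hDA.continuousOn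
      (by fun_prop) fun z hz hm => hz ?_
    simpa using mem_pCurveShift.1 hm
  by_cases h1 : p = 1
  · subst h1
    have hlim : Filter.Tendsto (fun x : ℝ => E (-x)) Filter.atTop (nhds 0) := by
      have h2 := (tendsto_of_vanishesFarFromCurve_one hv).sub
        (tendsto_of_vanishesFarFromCurve_one hR.vanishesFarFromCurve_pG)
      rwa [sub_zero] at h2
    have hz : ∀ t : ℝ, t < 0 → H t - pG 1 t = 0 := by
      intro t ht
      have := eq_zero_of_homogeneous_one hEc hEE hES hlim (x := 1 - t) (by linarith)
      simpa [hE] using this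
    have hmem : ((-1 : ℝ) : ℂ) ∈ (pCurveShift 1)ᶜ := by
      intro hm
      have := (mem_pCurve_one.1 (mem_pCurveShift.1 hm)).1
      norm_num at this
    have hmap : Filter.Tendsto (fun t : ℝ => (t : ℂ)) (nhdsWithin (-1) {-1}ᶜ)
        (nhdsWithin ((-1 : ℝ) : ℂ) {((-1 : ℝ) : ℂ)}ᶜ) :=
      Complex.continuous_ofReal.continuousWithinAt.tendsto_nhdsWithin fun t ht hm =>
        ht (Complex.ofReal_injective hm)
    -- The difference vanishes on the negative axis, which accumulates at -1, and the complement of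
    -- [1,∞) is connected, so the identity theorem applies.
    have hev : ∀ᶠ t : ℝ in nhdsWithin (-1) {-1}ᶜ, (H - pG 1) t = 0 := by
      filter_upwards [mem_nhdsWithin_of_mem_nhds (Iio_mem_nhds (by norm_num : (-1 : ℝ) < 0))]
        with t ht using hz t ht
    have := hDA.eqOn_zero_of_preconnected_of_frequently_eq_zero
      isPreconnected_compl_pCurveShift_one hmem (hmap.frequently hev.frequently)
    intro z hz
    exact sub_eq_zero.1 (this hz)
  · obtain ⟨R, hRR⟩ := exists_region hp h1
    obtain ⟨V, hV⟩ := hRR.exists_isContractive (one_lt_norm_of_mem hp h1)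
    intro z hz
    have := hV.eq_zero_of_homogeneous h1 hEc hEE hES (mt mem_pCurveShift.2 hz)
    simp only [hE, sub_add_cancel] at this
    exact sub_eq_zero.1 this

theorem theorem5p1 (p : ℂ) (hp : ‖p - 2‖ ≤ 1 ∨ (1 ≤ p.re ∧ p.im = 0)) :
    -- the complement of `I_p + 1` is open, and the integral `G_p` is analytic there
    IsOpen (pCurveShift p)ᶜ ∧
    (∀ z ∉ pCurveShift p,
      MeasureTheory.Integrable (fun x : ℂ => 1 / (x + 1 - z)) (pMeasure p)) ∧
    AnalyticOnNhd ℂ (pG p) (pCurveShift p)ᶜ ∧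
    -- it extends the generating power series of the moments
    (∀ᶠ z in nhds (0 : ℂ), z ∉ pCurveShift p ∧
      HasSum (fun L : ℕ => pMoment p (L + 1) / p ^ (L + 1) * z ^ L) (pG p z)) ∧
    -- the three-term equation, its consequence, and the behaviour far from the curve
    ThreeTermEquation p (pG p) ∧
    (∀ H : ℂ → ℂ, ThreeTermEquation p H → SymmetryProperty p H) ∧
    SymmetryProperty p (pG p) ∧
    VanishesFarFromCurve p (pG p) ∧
    -- uniqueness
    (∀ H : ℂ → ℂ, AnalyticOnNhd ℂ H (pCurveShift p)ᶜ → ThreeTermEquation p H →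
      VanishesFarFromCurve p H → Set.EqOn H (pG p) (pCurveShift p)ᶜ) := by
  have h := isRegularCurve hp
  exact ⟨h.isOpen_compl, fun z hz => h.integrable_kernel hz, h.analyticOnNhd_pG,
    h.eventually_hasSum, h.threeTermEquation_pG, fun H hH => h.symmetryProperty hH,
    h.symmetryProperty h.threeTermEquation_pG, h.vanishesFarFromCurve_pG,
    fun H hA hT hv => eqOn_pG hp hA hT hv⟩
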